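/- **Conventions.** Let $\mathbf{k}$ be a field and $H$ a cocommutative Hopf algebra over $\mathbf{k}$ with comultiplication $\Delta$. For a left $H$-module $M$ and $n\ge 1$, form $H^{\otimes n}\otimes_H M$, where $H$ acts on $H^{\otimes n}$ from the right through the iterated comultiplication $\Delta^{(n-1)}$; it is a left $H^{\otimes n}$-module. Permutations $\sigma$ of the tensor factors of $H^{\otimes n}$ act as $\sigma\otimes_H\mathrm{id}$. A *polylinear map* from left $H$-modules $M_1,\dots,M_n$ to $M$ is an $H^{\otimes n}$-linear map $M_1\otimes\cdots\otimes M_n\to H^{\otimes n}\otimes_H M$. Polylinear maps are composed by the usual convention: $\beta$ is extended to elements $F\otimes_H m$ of $H^{\otimes p}\otimes_H M$ in each argument, e.g. $\beta(F\otimes_H x,\,G\otimes_H y)=\big((F\otimes G)\otimes_H 1\big)\,\big((\Delta^{(p-1)}\otimes\Delta^{(q-1)})\otimes_H\mathrm{id}\big)\beta(x,y)$. In all identities below, the tensor factors of each term are permuted into the order in which the variables are listed at the start of the identity ($x,y,z,w$). A polylinear map $\beta$ of $n$ variables in one module is *skew-symmetric* if exchanging the arguments $i,i+1$ gives $-(\sigma_{i,i+1}\otimes_H\mathrm{id})\beta$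 for all $i$. **2-term $L_\infty$ $H$-pseudoalgebras.** An object of $\mathbf{2shLie}H$ is $(L_1\xrightarrow{\beta_1}L_0,\beta_2,\beta_3)$: an $H$-linear map $\beta_1$, polylinear maps $\beta_2:L_0\boxtimes L_0\to L_0$, $\beta_2:L_0\boxtimes L_1\to L_1$, extended to $L_1\boxtimes L_0$ by $\beta_2(u,x)=-(\sigma_{12}\otimes_H\mathrm{id})\beta_2(x,u)$, and $\beta_3: L_0\boxtimes L_0\boxtimes L_0\to L_1$, with $\beta_2|_{L_0\boxtimes L_0}$ and $\beta_3$ skew-symmetric, such that for $x,y,z,w\in L_0$, $u,v\in L_1$: 1. $\beta_1\beta_2(x,u)=\beta_2(x,\beta_1u)$; 2. $\beta_2(\beta_1u,v)=\beta_2(u,\beta_1v)$; 3. $\beta_2(\beta_2(x,y),z)-\beta_2(x,\beta_2(y,z))+\beta_2(y,\beta_2(x,z))=-\beta_1\beta_3(x,y,z)$; 4. $\beta_2(\beta_2(x,y),v)-\beta_2(x,\beta_2(y,v))+\beta_2(y,\beta_2(x,v))=-\beta_3(x,y,\beta_1v)$; 5. $\beta_2(x,\beta_3(y,z,w))-\beta_2(y,\beta_3(x,z,w))+\beta_2(z,\beta_3(x,y,w))-\beta_2(w,\beta_3(x,y,z))-\beta_3(\beta_2(x,y),z,w)+\beta_3(\beta_2(x,z),y,w)-\beta_3(\beta_2(x,w),y,z)-\beta_3(\beta_2(y,z),x,w)+\beta_3(\beta_2(y,w),x,z)-\beta_3(\beta_2(z,w),x,y)=0$.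 A morphism $L\to L'$ is $(f_0,f_1,f_2)$ with $f_0:L_0\to L_0'$, $f_1:L_1\to L_1'$ $H$-linear and $f_2:L_0\boxtimes L_0\to L_1'$ polylinear and skew-symmetric, with $f_0\beta_1=\beta_1'f_1$; $f_0\beta_2(x,y)-\beta_2'(f_0x,f_0y)=\beta_1'f_2(x,y)$; $f_1\beta_2(x,u)-\beta_2'(f_0x,f_1u)=f_2(x,\beta_1u)$; and $$\begin{aligned}&\beta_2'(f_2(x,y),f_0z)-\beta_2'(f_0x,f_2(y,z))+\beta_2'(f_0y,f_2(x,z))+f_2(\beta_2(x,y),z)-f_2(x,\beta_2(y,z))+f_2(y,\beta_2(x,z))\\&\qquad=\beta_3'(f_0x,f_0y,f_0z)-f_1\beta_3(x,y,z).\end{aligned}$$ The composite of $f:L\to L'$ and $g:L'\to L''$ is $(g_0f_0,\ g_1f_1,\ g_2\circ(f_0\otimes f_0)+g_1f_2)$; the identity is $(\mathrm{id},\mathrm{id},0)$. **Lie-2 $H$-pseudoalgebras.** Let $C=(C_1\rightrightarrows C_0)$ be a category internal to left $H$-modules, with source $s$, target $t$, identities $x\mapsto 1_x$ and composition $H$-linear.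 Applying $H^{\otimes n}\otimes_H-$ gives a category $H^{\otimes n}\otimes_HC$. An object of $\mathbf{Lie2}H$ is such a $C$ with a *pseudobracket* $[\,*\,]$, a skew-symmetric bilinear functor $C\times C\to H^{\otimes 2}\otimes_HC$, that is, skew-symmetric polylinear maps on objects and on arrows that respect sources, targets, identities and composites; and a *Jacobiator*, a polylinear map $J:C_0\boxtimes C_0\boxtimes C_0\to C_1$ giving a natural isomorphism $$J_{x,y,z}:[[x*y]*z]\to[x*[y*z]]-[y*[x*z]],$$ whose arrow part $J_{x,y,z}-1_{[[x*y]*z]}$ is skew-symmetric, such that for all $x,y,z,w\in C_0$ the following two composites of arrows in $H^{\otimes 4}\otimes_H C$ (arrows are applied from left to right; an object stands for its identity) from $[[[x*y]*z]*w]$ are equal: $$\begin{aligned}&[J_{x,y,z}*w]\ ;\ J_{x,[y*z],w}-J_{y,[x*z],w}\ ;\ [x*J_{y,z,w}]-J_{y,z,[x*w]}-[y*J_{x,z,w}]+J_{x,z,[y*w]},\\&J_{[x*y],z,w}\ ;\ 1_{[[x*y]*[z*w]]}-[z*J_{x,y,w}]\ ;\ J_{x,y,[z*w]}-1_{[z*[x*[y*w]]]}+1_{[z*[y*[x*w]]]}.\end{aligned}$$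 A morphism $C\to C'$ is a functor $(F_0,F_1)$ of internal categories ($F_0,F_1$ $H$-linear) with a polylinear, skew-symmetric natural isomorphism $F_2(x,y):[F_0x*F_0y]\to F_0[x*y]$ such that $$[F_2(x,y)*F_0z]\,;\,F_2([x*y],z)\,;\,F_1J_{x,y,z}\ =\ J'_{F_0x,F_0y,F_0z}\,;\,[F_0x*F_2(y,z)]-[F_0y*F_2(x,z)]\,;\,F_2(x,[y*z])-F_2(y,[x*z]).$$ The composite of $F:C\to C'$ and $G:C'\to C''$ is $(G_0F_0,\ G_1F_1,\ (GF)_2)$, where $(GF)_2(x,y)$ is $G_2(F_0x,F_0y)$ followed by $G_1F_2(x,y)$; the identity is $(\mathrm{id},\mathrm{id},1_{[x*y]})$. **Theorem.** The categories $\mathbf{Lie2}H$ and $\mathbf{2shLie}H$ are equivalent. More precisely, write $\mathrm{pr}(f)=f-1_{s(f)}$. Then * $S(C)=(t:\ker s\to C_0,\beta_2,\beta_3)$ with $\beta_2(x,y)=[x*y]$, $\beta_2(x,u)=[1_x*u]$, $\beta_3(x,y,z)=\mathrm{pr}\,J_{x,y,z}$, and $S(F)=(F_0,F_1|_{\ker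 s},\mathrm{pr}\,F_2)$, define a functor $S:\mathbf{Lie2}H\to\mathbf{2shLie}H$; * $T(L)=(L_0\oplus L_1\rightrightarrows L_0)$ with $s(x,u)=x$, $t(x,u)=x+\beta_1u$, $1_x=(x,0)$, pseudobracket $\beta_2$ on objects, $[(x,u)*(y,v)]=\big(\beta_2(x,y),\ \beta_2(x,v)+\beta_2(u,y)+\beta_2(\beta_1u,v)\big)$ on arrows, $J_{x,y,z}=\big(\beta_2(\beta_2(x,y),z),\ \beta_3(x,y,z)\big)$, and $T(f)=(f_0,\ f_0\oplus f_1,\ F_2)$ with $F_2(x,y)=\big(\beta_2'(f_0x,f_0y),f_2(x,y)\big)$, define a functor $T:\mathbf{2shLie}H\to\mathbf{Lie2}H$; * $S$ and $T$ are mutually quasi-inverse equivalences of categories. -/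

import Mathlib

open scoped TensorProduct

set_option linter.unusedSectionVars false
set_option linter.unusedVariables false

universe w u v

noncomputable section

namespace HPseudo

section Base

variable (k : Type w) [Field k] (H : Type u) [Ring H] [HopfAlgebra k H]

/-- A `k`-algebra `A` with a structure map `H → A` of `k`-algebras. The examples that matter are the
tensor powers of `H` with the iterated comultiplications. -/
class OverH (A : Type*) [Ring A] [Algebra k A] where
  /-- the structure map -/
  str : H →ₐ[k] A

/-- `H` itself, with the identity. -/
instance instOverHSelf : OverH k H H := ⟨AlgHom.id k H⟩

/-- `A ⊗ B`, with `h ↦ h₍₁₎ ⊗ h₍₂₎`. Starting with `H` this yields all bracketed tensor powers of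
`H`, with the iterated comultiplications as structure maps. -/
instance instOverHTensor (A B : Type*) [Ring A] [Algebra k A] [Ring B] [Algebra k B]
    [OverH k H A] [OverH k H B] : OverH k H (A ⊗[k] B) :=
  ⟨(Algebra.TensorProduct.map (OverH.str (k := k) (H := H) (A := A))
    (OverH.str (k := k) (H := H) (A := B))).comp (Bialgebra.comulAlgHom k H)⟩

/-- Homomorphisms of `k`-algebras under `H`. -/
structure Hm (A B : Type*) [Ring A] [Algebra k A] [Ring B] [Algebra k B]
    [OverH k H A] [OverH k H B] where
  /-- the underlying homomorphism of algebras -/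
  hom : A →ₐ[k] B
  comm : ∀ h : H, hom (OverH.str (k := k) h) = OverH.str (k := k) h

instance instRingTensor (A B : Type*) [Ring A] [Algebra k A] [Ring B] [Algebra k B] :
    Ring (A ⊗[k] B) := inferInstance

instance instAlgebraTensor (A B : Type*) [Ring A] [Algebra k A] [Ring B] [Algebra k B] :
    Algebra k (A ⊗[k] B) := inferInstance

section Tensor

variable (A : Type*) [Ring A] [Algebra k A] [OverH k H A]
variable (M : Type*) [AddCommGroup M] [Module H M]

/-- The relations `a h ⊗ m = a ⊗ h m`. -/
def BCrel : Submodule A (A ⊗[ℤ] M) :=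
  Submodule.span A {x | ∃ (a : A) (h : H) (m : M),
    x = (a * OverH.str (k := k) h) ⊗ₜ[ℤ] m - a ⊗ₜ[ℤ] (h • m)}

/-- The tensor product `A ⊗_H M` over the (noncommutative) ring `H`, where `H` acts on `A` from the
right through the structure map; a left `A`-module. -/
def BC : Type _ := (A ⊗[ℤ] M) ⧸ BCrel k H A M

instance : AddCommGroup (BC k H A M) := inferInstanceAs (AddCommGroup ((A ⊗[ℤ] M) ⧸ BCrel k H A M))
instance : Module A (BC k H A M) := inferInstanceAs (Module A ((A ⊗[ℤ] M) ⧸ BCrel k H A M))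
instance : AddCommMonoid (BC k H A M) := inferInstance
instance : AddGroup (BC k H A M) := inferInstance
instance : AddMonoid (BC k H A M) := inferInstance
instance : AddZeroClass (BC k H A M) := inferInstance
instance : Add (BC k H A M) := inferInstance
instance : Zero (BC k H A M) := inferInstance
instance : Neg (BC k H A M) := inferInstance
instance : Sub (BC k H A M) := inferInstance

end Tensor

end Base

variable {k : Type w} [Field k] {H : Type u} [Ring H] [HopfAlgebra k H]
variable {A : Type*} [Ring A] [Algebra k A] [OverH k H A]
variable {A' : Type*} [Ring A'] [Algebra k A'] [OverH k H A']
variable {B : Type*} [Ring B] [Algebra k B] [OverH k H B]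
variable {B' : Type*} [Ring B'] [Algebra k B'] [OverH k H B']
variable {C : Type*} [Ring C] [Algebra k C] [OverH k H C]
variable {C' : Type*} [Ring C'] [Algebra k C'] [OverH k H C']
variable {L : Type*} [AddCommGroup L] [Module H L]
variable {L' : Type*} [AddCommGroup L'] [Module H L']
variable {M : Type*} [AddCommGroup M] [Module H M]
variable {M' : Type*} [AddCommGroup M'] [Module H M']
variable {N : Type*} [AddCommGroup N] [Module H N]
variable {N' : Type*} [AddCommGroup N'] [Module H N']
variable {Q : Type*} [AddCommGroup Q] [Module H Q]
variable {Q' : Type*} [AddCommGroup Q'] [Module H Q']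

namespace BC

variable (k H A M) in
/-- The quotient map `A ⊗_ℤ M → A ⊗_H M`. -/
def proj : A ⊗[ℤ] M →ₗ[A] BC k H A M := (BCrel k H A M).mkQ

variable (k H) in
/-- The element `a ⊗_H m`. -/
def mk (a : A) (m : M) : BC k H A M := proj k H A M (a ⊗ₜ[ℤ] m)

lemma mk_add_left (a b : A) (m : M) : mk k H (a + b) m = mk k H a m + mk k H b m := by
  rw [mk, TensorProduct.add_tmul, map_add]; rfl

lemma mk_add_right (a : A) (m n : M) : mk k H a (m + n) = mk k H a m + mk k H a n := by
  rw [mk, TensorProduct.tmul_add, map_add]; rfl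

lemma smul_mk (a b : A) (m : M) : a • mk k H b m = mk k H (a * b) m := by
  rw [mk, ← map_smul]; rfl

lemma mk_str (a : A) (h : H) (m : M) :
    mk k H (a * OverH.str (k := k) h) m = mk k H a (h • m) := by
  rw [← sub_eq_zero, mk, mk, ← map_sub]
  exact (Submodule.Quotient.mk_eq_zero _).2 (Submodule.subset_span ⟨a, h, m, rfl⟩)

@[elab_as_elim]
lemma ind {P : BC k H A M → Prop} (x : BC k H A M) (h0 : P 0)
    (hm : ∀ a m, P (mk k H a m)) (ha : ∀ x y, P x → P y → P (x + y)) : P x := by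
  obtain ⟨y, rfl⟩ := Submodule.mkQ_surjective _ x
  induction y using TensorProduct.induction_on with
  | zero => rw [map_zero]; exact h0
  | tmul a m => exact hm a m
  | add x y hx hy => rw [map_add]; exact ha _ _ hx hy

lemma lift_aux {X : Type*} [AddCommGroup X] (f : A →+ M →+ X) (r : ℤ) (a : A) (m : M) :
    f (r • a) m = f a (r • m) := by
  rw [map_zsmul, map_zsmul]; rfl

lemma lift_aux' {X : Type*} [AddCommGroup X] (f : A →+ M →+ X)
    (hf : ∀ a (h : H) m, f (a * OverH.str (k := k) h) m = f a (h • m)) (x : A ⊗[ℤ] M)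
    (hx : x ∈ BCrel k H A M) : TensorProduct.liftAddHom f (lift_aux f) x = 0 := by
  refine Submodule.closure_induction (p := fun x _ =>
    TensorProduct.liftAddHom f (lift_aux f) x = 0) ?_ ?_ ?_ hx
  · exact map_zero _
  · intro x y _ _ hx hy; rw [map_add, hx, hy, add_zero]
  · rintro b x ⟨a, h, m, rfl⟩
    rw [smul_sub, map_sub, TensorProduct.smul_tmul', TensorProduct.smul_tmul', smul_eq_mul,
      smul_eq_mul, TensorProduct.liftAddHom_tmul, TensorProduct.liftAddHom_tmul,
      ← mul_assoc, hf, sub_self]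

/-- A biadditive map, as a homomorphism of homomorphisms. -/
def biHom {X : Type*} [AddCommGroup X] (f : A → M → X)
    (h1 : ∀ a b m, f (a + b) m = f a m + f b m) (h2 : ∀ a m n, f a (m + n) = f a m + f a n) :
    A →+ M →+ X :=
  AddMonoidHom.mk' (fun a => AddMonoidHom.mk' (f a) (h2 a)) (fun a b => by ext m; exact h1 a b m)

/-- The universal property of `A ⊗_H M`: a biadditive balanced map descends to it. -/
def lift {X : Type*} [AddCommGroup X] (f : A → M → X)
    (h1 : ∀ a b m, f (a + b) m = f a m + f b m) (h2 : ∀ a m n, f a (m + n) = f a m + f a n)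
    (h3 : ∀ a (h : H) m, f (a * OverH.str (k := k) h) m = f a (h • m)) : BC k H A M →+ X :=
  QuotientAddGroup.lift (BCrel k H A M).toAddSubgroup
    (TensorProduct.liftAddHom (biHom f h1 h2) (lift_aux (biHom f h1 h2)))
    (fun x hx => lift_aux' (biHom f h1 h2) h3 x hx)

lemma lift_mk {X : Type*} [AddCommGroup X] (f : A → M → X)
    (h1 : ∀ a b m, f (a + b) m = f a m + f b m)
    (h2 : ∀ a m n, f a (m + n) = f a m + f a n)
    (h3 : ∀ a (h : H) m, f (a * OverH.str (k := k) h) m = f a (h • m)) (a : A) (m : M) :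
    lift f h1 h2 h3 (mk k H a m) = f a m :=
  TensorProduct.liftAddHom_tmul (biHom f h1 h2) (lift_aux (biHom f h1 h2)) a m

lemma hom_ext {X : Type*} [AddCommGroup X] {f g : BC k H A M →+ X}
    (h : ∀ a m, f (mk k H a m) = g (mk k H a m)) : f = g := by
  ext x
  induction x using ind with
  | h0 => rw [map_zero, map_zero]
  | hm a m => exact h a m
  | ha x y hx hy => rw [map_add, map_add, hx, hy]

variable (k A) in
/-- `map` as an additive map. -/
def mapAux (φ : M →ₗ[H] N) : BC k H A M →+ BC k H A N :=
  lift (fun a m => mk k H a (φ m)) (fun a b m => mk_add_left _ _ _)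
    (fun a m n => by rw [map_add, mk_add_right]) (fun a h m => by rw [mk_str, map_smul])

lemma mapAux_mk (φ : M →ₗ[H] N) (a : A) (m : M) :
    mapAux k A φ (mk k H a m) = mk k H a (φ m) := lift_mk _ _ _ _ _ _

variable (k A) in
/-- The map `id ⊗_H φ : A ⊗_H M → A ⊗_H N` induced by an `H`-linear map `φ`. -/
def map (φ : M →ₗ[H] N) : BC k H A M →ₗ[A] BC k H A N where
  toFun := mapAux k A φ
  map_add' x y := map_add _ x y
  map_smul' a x := by
    induction x using ind with
    | h0 => rw [smul_zero, map_zero, smul_zero]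
    | hm b m =>
      rw [smul_mk, mapAux_mk, mapAux_mk]
      exact (smul_mk _ _ _).symm
    | ha x y hx hy => rw [smul_add, map_add, hx, hy, map_add, smul_add]

@[simp] lemma map_mk (φ : M →ₗ[H] N) (a : A) (m : M) :
    map k A φ (mk k H a m) = mk k H a (φ m) := mapAux_mk _ _ _

/-- The map `θ ⊗_H id : A ⊗_H M → B ⊗_H M` induced by a homomorphism `θ : A → B` of algebras
under `H`. -/
def push (θ : Hm k H A B) : BC k H A M →+ BC k H B M :=
  lift (fun a m => mk k H (θ.hom a) m) (fun a b m => by rw [map_add, mk_add_left])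
    (fun a m n => mk_add_right _ _ _) (fun a h m => by rw [map_mul, θ.comm, mk_str])

@[simp] lemma push_mk (θ : Hm k H A B) (a : A) (m : M) :
    push θ (mk k H a m) = mk k H (θ.hom a) m := lift_mk _ _ _ _ _ _

lemma push_smul (θ : Hm k H A B) (a : A) (x : BC k H A M) :
    push θ (a • x) = θ.hom a • push θ x := by
  induction x using ind with
  | h0 => simp
  | hm b m => simp [smul_mk]
  | ha x y hx hy => rw [smul_add, map_add, hx, hy, map_add, smul_add]

lemma push_map (θ : Hm k H A B) (φ : M →ₗ[H] N) (x : BC k H A M) :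
    push θ (map k A φ x) = map k B φ (push θ x) := by
  induction x using ind with
  | h0 => simp
  | hm b m => simp
  | ha x y hx hy => simp [hx, hy]

lemma map_map (φ : M →ₗ[H] N) (ψ : N →ₗ[H] Q) (x : BC k H A M) :
    map k A ψ (map k A φ x) = map k A (ψ ∘ₗ φ) x := by
  induction x using ind with
  | h0 => simp
  | hm b m => simp
  | ha x y hx hy => rw [map_add, map_add, map_add, hx, hy]

variable (k H) in
/-- The canonical map `M → H ⊗_H M`, `m ↦ 1 ⊗_H m`. -/
def one (m : M) : BC k H H M := mk k H 1 m

end BC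

namespace Hm

variable (k H A) in
protected def id : Hm k H A A := ⟨AlgHom.id k A, fun _ => rfl⟩

/-- composition, in the diagrammatic order -/
def trans (θ : Hm k H A B) (η : Hm k H B C) : Hm k H A C :=
  ⟨η.hom.comp θ.hom, fun h => by simp [θ.comm, η.comm]⟩

variable (k H A) in
/-- the structure map of `A` -/
def str : Hm k H H A := ⟨OverH.str, fun _ => rfl⟩

/-- `θ ⊗ η` -/
def tensor (θ : Hm k H A A') (η : Hm k H B B') : Hm k H (A ⊗[k] B) (A' ⊗[k] B') where
  hom := Algebra.TensorProduct.map θ.hom η.hom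
  comm h := by
    have h1 : θ.hom.comp (OverH.str (k := k) (H := H)) = OverH.str :=
      AlgHom.ext fun h => θ.comm h
    have h2 : η.hom.comp (OverH.str (k := k) (H := H)) = OverH.str :=
      AlgHom.ext fun h => η.comm h
    change ((Algebra.TensorProduct.map θ.hom η.hom).comp
      ((Algebra.TensorProduct.map _ _).comp (Bialgebra.comulAlgHom k H))) h = _
    rw [← AlgHom.comp_assoc, ← Algebra.TensorProduct.map_comp, h1, h2]
    rfl

lemma tensor_id {θ : Hm k H A A} {η : Hm k H B B} (h : ∀ a, θ.hom a = a) (h' : ∀ b, η.hom b = b)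
    (x : A ⊗[k] B) : (θ.tensor η).hom x = x := by
  induction x using TensorProduct.induction_on with
  | zero => exact map_zero _
  | add x y hx hy => rw [map_add, hx, hy]
  | tmul a b =>
    change θ.hom a ⊗ₜ η.hom b = _
    rw [h, h']

variable (k H A B C) in
/-- `(a ⊗ b) ⊗ c ↦ a ⊗ (b ⊗ c)`; compatible with the structure maps by coassociativity. -/
def assoc : Hm k H ((A ⊗[k] B) ⊗[k] C) (A ⊗[k] (B ⊗[k] C)) where
  hom := (Algebra.TensorProduct.assoc k k k A B C).toAlgHom
  comm h := by
    have hco := Coalgebra.coassoc_apply (R := k) h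
    let fA : H →ₗ[k] A := (OverH.str (k := k) (H := H) (A := A)).toLinearMap
    let fB : H →ₗ[k] B := (OverH.str (k := k) (H := H) (A := B)).toLinearMap
    let fC : H →ₗ[k] C := (OverH.str (k := k) (H := H) (A := C)).toLinearMap
    have e1 : ∀ x : H ⊗[k] H, (Algebra.TensorProduct.assoc k k k A B C)
        (Algebra.TensorProduct.map
          ((Algebra.TensorProduct.map (OverH.str (k := k) (H := H) (A := A))
            (OverH.str (k := k) (H := H) (A := B))).comp (Bialgebra.comulAlgHom k H))
          (OverH.str (k := k) (H := H) (A := C)) x) =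
        TensorProduct.map fA (TensorProduct.map fB fC)
          (TensorProduct.assoc k H H H (Coalgebra.comul.rTensor H x)) := by
      intro x
      induction x using TensorProduct.induction_on with
      | zero => simp
      | add x y hx hy => simp only [map_add, hx, hy]
      | tmul a b =>
        simp only [Algebra.TensorProduct.map_tmul, LinearMap.rTensor_tmul, AlgHom.comp_apply,
          Bialgebra.comulAlgHom_apply]
        generalize (Coalgebra.comul (R := k) a) = y
        induction y using TensorProduct.induction_on with
        | zero => simp
        | add x y hx hy => simp only [map_add, TensorProduct.add_tmul, hx, hy]
        | tmul a c => simp [fA, fB, fC]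
    have e2 : ∀ x : H ⊗[k] H, 
        (Algebra.TensorProduct.map (OverH.str (k := k) (H := H) (A := A))
          ((Algebra.TensorProduct.map (OverH.str (k := k) (H := H) (A := B))
            (OverH.str (k := k) (H := H) (A := C))).comp (Bialgebra.comulAlgHom k H)) x) =
        TensorProduct.map fA (TensorProduct.map fB fC) (Coalgebra.comul.lTensor H x) := by
      intro x
      induction x using TensorProduct.induction_on with
      | zero => simp
      | add x y hx hy => simp only [map_add, hx, hy]
      | tmul a b =>
        simp only [Algebra.TensorProduct.map_tmul, LinearMap.lTensor_tmul, AlgHom.comp_apply,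
          Bialgebra.comulAlgHom_apply]
        rfl
    refine (e1 (Coalgebra.comul h)).trans ?_
    rw [hco]
    exact (e2 (Coalgebra.comul h)).symm

variable (k H A B) in
/-- `a ⊗ b ↦ b ⊗ a`; compatible with the structure maps by cocommutativity. -/
def swap [Coalgebra.IsCocomm k H] : Hm k H (A ⊗[k] B) (B ⊗[k] A) where
  hom := (Algebra.TensorProduct.comm k A B).toAlgHom
  comm h := by
    have e : ∀ x : H ⊗[k] H, Algebra.TensorProduct.comm k A B (Algebra.TensorProduct.map
        (OverH.str (k := k) (H := H) (A := A)) (OverH.str (k := k) (H := H) (A := B)) x) =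
        Algebra.TensorProduct.map
        (OverH.str (k := k) (H := H) (A := B)) (OverH.str (k := k) (H := H) (A := A))
        (TensorProduct.comm k H H x) := by
      intro x
      induction x using TensorProduct.induction_on with
      | zero => simp
      | add x y hx hy => simp only [map_add, hx, hy]
      | tmul a b => simp
    refine (e (Coalgebra.comul h)).trans ?_
    rw [Coalgebra.comm_comul]
    rfl

variable (k H A B C) in
/-- `a ⊗ (b ⊗ c) ↦ b ⊗ (a ⊗ c)` -/
def swap12 [Coalgebra.IsCocomm k H] : Hm k H (A ⊗[k] (B ⊗[k] C)) (B ⊗[k] (A ⊗[k] C)) where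
  hom := (Algebra.TensorProduct.leftComm k A B C).toAlgHom
  comm h := by
    let σ : Hm k H ((A ⊗[k] B) ⊗[k] C) (B ⊗[k] (A ⊗[k] C)) :=
      ((swap k H A B).tensor (Hm.id k H C)).trans (assoc k H B A C)
    have e : ∀ x, Algebra.TensorProduct.leftComm k A B C ((assoc k H A B C).hom x) = σ.hom x := by
      intro x
      induction x using TensorProduct.induction_on with
      | zero => simp only [map_zero]
      | add x y hx hy => simp only [map_add, hx, hy]
      | tmul x c =>
        induction x using TensorProduct.induction_on with
        | zero => simp only [map_zero, TensorProduct.zero_tmul]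
        | add x y hx hy => simp only [map_add, TensorProduct.add_tmul, hx, hy]
        | tmul a b => rfl
    have := e (OverH.str (k := k) h)
    rw [(assoc k H A B C).comm, σ.comm] at this
    exact this

end Hm

section

lemma BC.map_congr {φ ψ : M →ₗ[H] N} (h : ∀ x, φ x = ψ x) (x : BC k H A M) :
    map k A φ x = map k A ψ x := by
  rw [LinearMap.ext h]

lemma BC.map_id (x : BC k H A M) : map k A (LinearMap.id : M →ₗ[H] M) x = x := by
  induction x using ind with
  | h0 => simp
  | hm b m => simp
  | ha x y hx hy => rw [map_add, hx, hy]

lemma BC.map_add_hom (φ ψ : M →ₗ[H] N) (x : BC k H A M) :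
    map k A (φ + ψ) x = map k A φ x + map k A ψ x := by
  induction x using ind with
  | h0 => simp
  | hm b m => simp [mk_add_right]
  | ha x y hx hy => rw [map_add, hx, hy, map_add, map_add]; abel

lemma BC.push_push (θ : Hm k H A B) (η : Hm k H B C) (x : BC k H A M) :
    push η (push θ x) = push (θ.trans η) x := by
  induction x using ind with
  | h0 => simp
  | hm b m => simp [Hm.trans]
  | ha x y hx hy => rw [map_add, map_add, map_add, hx, hy]

lemma BC.push_congr {θ η : Hm k H A B} (h : ∀ a, θ.hom a = η.hom a) (x : BC k H A M) :
    push θ x = push η x := by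
  induction x using ind with
  | h0 => simp
  | hm b m => simp [h]
  | ha x y hx hy => rw [map_add, map_add, hx, hy]

lemma BC.push_id {θ : Hm k H A A} (h : ∀ a, θ.hom a = a) (x : BC k H A M) :
    push θ x = x := by
  induction x using ind with
  | h0 => simp
  | hm b m => simp [h]
  | ha x y hx hy => rw [map_add, hx, hy]

lemma BC.mk_eq (a : A) (m : M) : mk k H a m = a • push (Hm.str k H A) (one k H m) := by
  rw [one, push_mk, smul_mk, map_one, mul_one]

lemma BC.one_add (m n : M) : one k H (m + n) = one k H m + one k H n := mk_add_right _ _ _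

lemma BC.one_smul (h : H) (m : M) : one k H (h • m) = h • one k H m := by
  rw [one, one, smul_mk, ← mk_str, one_mul, mul_one]; rfl

lemma BC.map_one (φ : M →ₗ[H] N) (m : M) : map k H φ (one k H m) = one k H (φ m) := map_mk _ _ _

section Aux

variable {X : Type*} [AddCommGroup X]

lemma tsmul_add_left [Module (A ⊗[k] B) X] (a a' : A) (b : B) (x : X) :
    ((a + a') ⊗ₜ[k] b) • x = (a ⊗ₜ[k] b) • x + (a' ⊗ₜ[k] b) • x := by
  rw [TensorProduct.add_tmul, add_smul]

lemma tsmul_add_right [Module (A ⊗[k] B) X] (a : A) (b b' : B) (x : X) :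
    (a ⊗ₜ[k] (b + b')) • x = (a ⊗ₜ[k] b) • x + (a ⊗ₜ[k] b') • x := by
  rw [TensorProduct.tmul_add, add_smul]

lemma tsmul_smul [Module (A ⊗[k] B) X] (a a' : A) (b b' : B) (x : X) :
    (a ⊗ₜ[k] b) • (a' ⊗ₜ[k] b') • x = ((a * a') ⊗ₜ[k] (b * b')) • x := by
  rw [smul_smul, Algebra.TensorProduct.tmul_mul_tmul]

lemma tsmul3_add_middle [Module (A ⊗[k] (B ⊗[k] C)) X] (a : A) (b b' : B) (c : C) (x : X) :
    (a ⊗ₜ[k] ((b + b') ⊗ₜ[k] c)) • x = (a ⊗ₜ[k] (b ⊗ₜ[k] c)) • x + (a ⊗ₜ[k] (b' ⊗ₜ[k] c)) • x := by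
  rw [TensorProduct.add_tmul, tsmul_add_right]

lemma tsmul3_add_right [Module (A ⊗[k] (B ⊗[k] C)) X] (a : A) (b : B) (c c' : C) (x : X) :
    (a ⊗ₜ[k] (b ⊗ₜ[k] (c + c'))) • x = (a ⊗ₜ[k] (b ⊗ₜ[k] c)) • x + (a ⊗ₜ[k] (b ⊗ₜ[k] c')) • x := by
  rw [TensorProduct.tmul_add, tsmul_add_right]

lemma tsmul3_smul [Module (A ⊗[k] (B ⊗[k] C)) X] (a a' : A) (b b' : B) (c c' : C) (x : X) :
    (a ⊗ₜ[k] (b ⊗ₜ[k] c)) • (a' ⊗ₜ[k] (b' ⊗ₜ[k] c')) • x =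
      ((a * a') ⊗ₜ[k] ((b * b') ⊗ₜ[k] (c * c'))) • x := by
  rw [tsmul_smul, Algebra.TensorProduct.tmul_mul_tmul]

lemma tsmul_one [Module (A ⊗[k] B) X] (x : X) : ((1 : A) ⊗ₜ[k] (1 : B)) • x = x := by
  rw [← Algebra.TensorProduct.one_def, one_smul]

lemma tsmul3_one [Module (A ⊗[k] (B ⊗[k] C)) X] (x : X) :
    ((1 : A) ⊗ₜ[k] ((1 : B) ⊗ₜ[k] (1 : C))) • x = x := by
  rw [← Algebra.TensorProduct.one_def, tsmul_one]

lemma tensor_str_tmul (f g : H) :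
    ((Hm.str k H A).tensor (Hm.str k H B)).hom (f ⊗ₜ[k] g) =
      OverH.str (k := k) f ⊗ₜ[k] OverH.str (k := k) g := rfl

lemma tensor_str_tmul3 (f g h : H) :
    ((Hm.str k H A).tensor ((Hm.str k H B).tensor (Hm.str k H C))).hom (f ⊗ₜ[k] (g ⊗ₜ[k] h)) =
      OverH.str (k := k) f ⊗ₜ[k] (OverH.str (k := k) g ⊗ₜ[k] OverH.str (k := k) h) := rfl

end Aux

/-- The polylinear maps `Hom_{H ⊗ H} (L ⊠ M, (H ⊗ H) ⊗_H N)`, as biadditive maps `β` with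
`β (f x, g y) = (f ⊗ g) β (x, y)`. -/
@[ext]
structure Poly2 (k : Type w) [Field k] (H : Type u) [Ring H] [HopfAlgebra k H]
    (L M N : Type*) [AddCommGroup L] [Module H L] [AddCommGroup M] [Module H M]
    [AddCommGroup N] [Module H N] where
  /-- the underlying map -/
  toFun : L → M → BC k H (H ⊗[k] H) N
  add_left : ∀ x x' y, toFun (x + x') y = toFun x y + toFun x' y
  add_right : ∀ x y y', toFun x (y + y') = toFun x y + toFun x y'
  smul : ∀ (f g : H) x y, toFun (f • x) (g • y) = (f ⊗ₜ[k] g) • toFun x y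

instance : CoeFun (Poly2 k H L M N) (fun _ => L → M → BC k H (H ⊗[k] H) N) := ⟨Poly2.toFun⟩

/-- The polylinear maps `Hom_{H ⊗ H ⊗ H} (L ⊠ M ⊠ N, (H ⊗ H ⊗ H) ⊗_H Q)`, as triadditive maps `γ`
with `γ (f x, g y, h z) = (f ⊗ g ⊗ h) γ (x, y, z)`. -/
@[ext]
structure Poly3 (k : Type w) [Field k] (H : Type u) [Ring H] [HopfAlgebra k H]
    (L M N Q : Type*) [AddCommGroup L] [Module H L] [AddCommGroup M] [Module H M]
    [AddCommGroup N] [Module H N] [AddCommGroup Q] [Module H Q] where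
  /-- the underlying map -/
  toFun : L → M → N → BC k H (H ⊗[k] (H ⊗[k] H)) Q
  add_left : ∀ x x' y z, toFun (x + x') y z = toFun x y z + toFun x' y z
  add_middle : ∀ x y y' z, toFun x (y + y') z = toFun x y z + toFun x y' z
  add_right : ∀ x y z z', toFun x y (z + z') = toFun x y z + toFun x y z'
  smul : ∀ (f g h : H) x y z,
    toFun (f • x) (g • y) (h • z) = (f ⊗ₜ[k] (g ⊗ₜ[k] h)) • toFun x y z

instance : CoeFun (Poly3 k H L M N Q) (fun _ => L → M → N → BC k H (H ⊗[k] (H ⊗[k] H)) Q) :=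
  ⟨Poly3.toFun⟩

namespace Poly2

/-- The composition `β ∘ (φ ⊗ ψ)`. -/
def pre (β : Poly2 k H L M N) (φ : L' →ₗ[H] L) (ψ : M' →ₗ[H] M) : Poly2 k H L' M' N where
  toFun x y := β (φ x) (ψ y)
  add_left x x' y := by rw [φ.map_add, β.add_left]
  add_right x y y' := by rw [ψ.map_add, β.add_right]
  smul f g x y := by rw [φ.map_smul, ψ.map_smul, β.smul]

/-- The composition `(id ⊗_H φ) ∘ β`. -/
def post (β : Poly2 k H L M N) (φ : N →ₗ[H] N') : Poly2 k H L M N' where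
  toFun x y := BC.map k _ φ (β x y)
  add_left x x' y := by rw [β.add_left, (BC.map k _ φ).map_add]
  add_right x y y' := by rw [β.add_right, (BC.map k _ φ).map_add]
  smul f g x y := by rw [β.smul, (BC.map k _ φ).map_smul]

end Poly2

/-- The composition `(id ⊗_H φ) ∘ γ`. -/
def Poly3.post (γ : Poly3 k H L M N Q) (φ : Q →ₗ[H] Q') : Poly3 k H L M N Q' where
  toFun x y z := BC.map k _ φ (γ x y z)
  add_left x x' y z := by rw [γ.add_left, (BC.map k _ φ).map_add]
  add_middle x y y' z := by rw [γ.add_middle, (BC.map k _ φ).map_add]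
  add_right x y z z' := by rw [γ.add_right, (BC.map k _ φ).map_add]
  smul f g h x y z := by rw [γ.smul, (BC.map k _ φ).map_smul]

namespace Poly2

variable (β : Poly2 k H L M N)

/-- The value of the extension of `β` on `(a ⊗_H x, b ⊗_H y)`. -/
def val (a : A) (x : L) (b : B) (y : M) : BC k H (A ⊗[k] B) N :=
  (a ⊗ₜ[k] b) • BC.push ((Hm.str k H A).tensor (Hm.str k H B)) (β x y)

lemma val_add1 (a a' : A) (x : L) (b : B) (y : M) :
    β.val (a + a') x b y = β.val a x b y + β.val a' x b y := tsmul_add_left _ _ _ _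

lemma val_add2 (a : A) (x x' : L) (b : B) (y : M) :
    β.val a (x + x') b y = β.val a x b y + β.val a x' b y :=
  (congrArg _ ((congrArg _ (β.add_left x x' y)).trans (map_add _ _ _))).trans (smul_add _ _ _)

lemma val_add3 (a : A) (x : L) (b b' : B) (y : M) :
    β.val a x (b + b') y = β.val a x b y + β.val a x b' y := tsmul_add_right _ _ _ _

lemma val_add4 (a : A) (x : L) (b : B) (y y' : M) :
    β.val a x b (y + y') = β.val a x b y + β.val a x b y' :=
  (congrArg _ ((congrArg _ (β.add_right x y y')).trans (map_add _ _ _))).trans (smul_add _ _ _)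

lemma val_smul (a : A) (x : L) (b : B) (y : M) (f g : H) :
    β.val a (f • x) b (g • y) =
      β.val (a * OverH.str (k := k) f) x (b * OverH.str (k := k) g) y :=
  (congrArg _ ((congrArg _ (β.smul f g x y)).trans (BC.push_smul _ _ _))).trans (tsmul_smul _ _ _ _ _)

lemma val_bal1 (a : A) (x : L) (b : B) (y : M) (f : H) :
    β.val (a * OverH.str (k := k) f) x b y = β.val a (f • x) b y := by
  have e := β.val_smul a x b y f 1
  rw [one_smul, map_one, mul_one] at e
  exact e.symm

lemma val_bal2 (a : A) (x : L) (b : B) (y : M) (g : H) :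
    β.val a x (b * OverH.str (k := k) g) y = β.val a x b (g • y) := by
  have e := β.val_smul a x b y 1 g
  rw [one_smul, map_one, mul_one] at e
  exact e.symm

variable (A B) in
/-- Auxiliary definition for `ext2`. -/
def extAux (a : A) (x : L) : BC k H B M →+ BC k H (A ⊗[k] B) N :=
  BC.lift (fun b y => β.val a x b y) (β.val_add3 a x) (β.val_add4 a x)
    (fun b g y => β.val_bal2 a x b y g)

lemma extAux_mk (a : A) (x : L) (b : B) (y : M) :
    extAux A B β a x (BC.mk k H b y) = β.val a x b y :=
  BC.lift_mk _ _ _ _ _ _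

end Poly2

/-- The extension of a polylinear map `β` that is used to compose polylinear maps: if
`β (x, y) = ∑ (f ⊗ g) ⊗_H e`, then `(a ⊗_H x, b ⊗_H y)` is sent to `∑ (a Δ(f) ⊗ b Δ(g)) ⊗_H e`, where
`Δ(f)` and `Δ(g)` are the iterated coproducts in the tensor powers `A` and `B` of `H`. -/
def ext2 (β : Poly2 k H L M N) : BC k H A L →+ BC k H B M →+ BC k H (A ⊗[k] B) N :=
  BC.lift (Poly2.extAux A B β)
    (fun a a' x => BC.hom_ext fun b y => (Poly2.extAux_mk _ _ _ _ _).trans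
      ((β.val_add1 a a' x b y).trans (congrArg₂ (· + ·) (Poly2.extAux_mk _ _ _ _ _).symm
        (Poly2.extAux_mk _ _ _ _ _).symm)))
    (fun a x x' => BC.hom_ext fun b y => (Poly2.extAux_mk _ _ _ _ _).trans
      ((β.val_add2 a x x' b y).trans (congrArg₂ (· + ·) (Poly2.extAux_mk _ _ _ _ _).symm
        (Poly2.extAux_mk _ _ _ _ _).symm)))
    (fun a h x => BC.hom_ext fun b y => (Poly2.extAux_mk _ _ _ _ _).trans
      ((β.val_bal1 a x b y h).trans (Poly2.extAux_mk _ _ _ _ _).symm))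

lemma ext2_mk (β : Poly2 k H L M N) (a : A) (x : L) (b : B) (y : M) :
    ext2 β (BC.mk k H a x) (BC.mk k H b y) =
      (a ⊗ₜ[k] b) • BC.push ((Hm.str k H A).tensor (Hm.str k H B)) (β x y) :=
  (DFunLike.congr_fun (BC.lift_mk _ _ _ _ _ _) _).trans (Poly2.extAux_mk _ _ _ _ _)

/-- `ext2 β` extends `β`. -/
lemma ext2_one (β : Poly2 k H L M N) (x : L) (y : M) :
    ext2 β (BC.one k H x) (BC.one k H y) = β x y :=
  (ext2_mk _ _ _ _ _).trans ((tsmul_one _).trans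
    (BC.push_id (Hm.tensor_id (fun _ => rfl) (fun _ => rfl)) _))

namespace Poly3

variable (γ : Poly3 k H L M N Q)

/-- The value of the extension of `γ` on `(a ⊗_H x, b ⊗_H y, c ⊗_H z)`. -/
def val (a : A) (x : L) (b : B) (y : M) (c : C) (z : N) : BC k H (A ⊗[k] (B ⊗[k] C)) Q :=
  (a ⊗ₜ[k] (b ⊗ₜ[k] c)) •
    BC.push ((Hm.str k H A).tensor ((Hm.str k H B).tensor (Hm.str k H C))) (γ x y z)

lemma val_add1 (a a' : A) (x : L) (b : B) (y : M) (c : C) (z : N) :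
    γ.val (a + a') x b y c z = γ.val a x b y c z + γ.val a' x b y c z := tsmul_add_left _ _ _ _

lemma val_add2 (a : A) (x x' : L) (b : B) (y : M) (c : C) (z : N) :
    γ.val a (x + x') b y c z = γ.val a x b y c z + γ.val a x' b y c z :=
  (congrArg _ ((congrArg _ (γ.add_left x x' y z)).trans (map_add _ _ _))).trans (smul_add _ _ _)

lemma val_add3 (a : A) (x : L) (b b' : B) (y : M) (c : C) (z : N) :
    γ.val a x (b + b') y c z = γ.val a x b y c z + γ.val a x b' y c z :=
  tsmul3_add_middle _ _ _ _ _

lemma val_add4 (a : A) (x : L) (b : B) (y y' : M) (c : C) (z : N) :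
    γ.val a x b (y + y') c z = γ.val a x b y c z + γ.val a x b y' c z :=
  (congrArg _ ((congrArg _ (γ.add_middle x y y' z)).trans (map_add _ _ _))).trans (smul_add _ _ _)

lemma val_add5 (a : A) (x : L) (b : B) (y : M) (c c' : C) (z : N) :
    γ.val a x b y (c + c') z = γ.val a x b y c z + γ.val a x b y c' z :=
  tsmul3_add_right _ _ _ _ _

lemma val_add6 (a : A) (x : L) (b : B) (y : M) (c : C) (z z' : N) :
    γ.val a x b y c (z + z') = γ.val a x b y c z + γ.val a x b y c z' :=
  (congrArg _ ((congrArg _ (γ.add_right x y z z')).trans (map_add _ _ _))).trans (smul_add _ _ _)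

lemma val_smul (a : A) (x : L) (b : B) (y : M) (c : C) (z : N) (f g h : H) :
    γ.val a (f • x) b (g • y) c (h • z) = γ.val (a * OverH.str (k := k) f) x
      (b * OverH.str (k := k) g) y (c * OverH.str (k := k) h) z :=
  (congrArg _ ((congrArg _ (γ.smul f g h x y z)).trans (BC.push_smul _ _ _))).trans
    (tsmul3_smul _ _ _ _ _ _ _)

lemma val_bal1 (a : A) (x : L) (b : B) (y : M) (c : C) (z : N) (f : H) :
    γ.val (a * OverH.str (k := k) f) x b y c z = γ.val a (f • x) b y c z := by
  have e := γ.val_smul a x b y c z f 1 1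
  rw [one_smul, one_smul, map_one, map_one, mul_one, mul_one] at e
  exact e.symm

lemma val_bal2 (a : A) (x : L) (b : B) (y : M) (c : C) (z : N) (g : H) :
    γ.val a x (b * OverH.str (k := k) g) y c z = γ.val a x b (g • y) c z := by
  have e := γ.val_smul a x b y c z 1 g 1
  rw [one_smul, one_smul, map_one, map_one, mul_one, mul_one] at e
  exact e.symm

lemma val_bal3 (a : A) (x : L) (b : B) (y : M) (c : C) (z : N) (h : H) :
    γ.val a x b y (c * OverH.str (k := k) h) z = γ.val a x b y c (h • z) := by
  have e := γ.val_smul a x b y c z 1 1 h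
  rw [one_smul, one_smul, map_one, map_one, mul_one, mul_one] at e
  exact e.symm

variable (A B C) in
/-- Auxiliary definition for `ext3`. -/
def extAux (a : A) (x : L) (b : B) (y : M) : BC k H C N →+ BC k H (A ⊗[k] (B ⊗[k] C)) Q :=
  BC.lift (fun c z => γ.val a x b y c z) (γ.val_add5 a x b y) (γ.val_add6 a x b y)
    (fun c g z => γ.val_bal3 a x b y c z g)

lemma extAux_mk (a : A) (x : L) (b : B) (y : M) (c : C) (z : N) :
    extAux A B C γ a x b y (BC.mk k H c z) = γ.val a x b y c z :=
  BC.lift_mk _ _ _ _ _ _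

variable (A B C) in
/-- Auxiliary definition for `ext3`. -/
def extAux' (a : A) (x : L) : BC k H B M →+ BC k H C N →+ BC k H (A ⊗[k] (B ⊗[k] C)) Q :=
  BC.lift (extAux A B C γ a x)
    (fun b b' y => BC.hom_ext fun c z => (extAux_mk _ _ _ _ _ _ _).trans
      ((γ.val_add3 a x b b' y c z).trans (congrArg₂ (· + ·) (extAux_mk _ _ _ _ _ _ _).symm
        (extAux_mk _ _ _ _ _ _ _).symm)))
    (fun b y y' => BC.hom_ext fun c z => (extAux_mk _ _ _ _ _ _ _).trans
      ((γ.val_add4 a x b y y' c z).trans (congrArg₂ (· + ·) (extAux_mk _ _ _ _ _ _ _).symm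
        (extAux_mk _ _ _ _ _ _ _).symm)))
    (fun b h y => BC.hom_ext fun c z => (extAux_mk _ _ _ _ _ _ _).trans
      ((γ.val_bal2 a x b y c z h).trans (extAux_mk _ _ _ _ _ _ _).symm))

lemma extAux'_mk (a : A) (x : L) (b : B) (y : M) (c : C) (z : N) :
    extAux' A B C γ a x (BC.mk k H b y) (BC.mk k H c z) = γ.val a x b y c z :=
  (DFunLike.congr_fun (BC.lift_mk _ _ _ _ _ _) _).trans (extAux_mk _ _ _ _ _ _ _)

end Poly3

/-- The extension of a polylinear map of three arguments that is used to compose polylinear maps,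
as for two arguments. -/
def ext3 (γ : Poly3 k H L M N Q) :
    BC k H A L →+ BC k H B M →+ BC k H C N →+ BC k H (A ⊗[k] (B ⊗[k] C)) Q :=
  BC.lift (Poly3.extAux' A B C γ)
    (fun a a' x => BC.hom_ext fun b y => BC.hom_ext fun c z => (Poly3.extAux'_mk _ _ _ _ _ _ _).trans
      ((γ.val_add1 a a' x b y c z).trans (congrArg₂ (· + ·) (Poly3.extAux'_mk _ _ _ _ _ _ _).symm
        (Poly3.extAux'_mk _ _ _ _ _ _ _).symm)))
    (fun a x x' => BC.hom_ext fun b y => BC.hom_ext fun c z => (Poly3.extAux'_mk _ _ _ _ _ _ _).trans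
      ((γ.val_add2 a x x' b y c z).trans (congrArg₂ (· + ·) (Poly3.extAux'_mk _ _ _ _ _ _ _).symm
        (Poly3.extAux'_mk _ _ _ _ _ _ _).symm)))
    (fun a h x => BC.hom_ext fun b y => BC.hom_ext fun c z => (Poly3.extAux'_mk _ _ _ _ _ _ _).trans
      ((γ.val_bal1 a x b y c z h).trans (Poly3.extAux'_mk _ _ _ _ _ _ _).symm))

lemma ext3_mk (γ : Poly3 k H L M N Q) (a : A) (x : L) (b : B) (y : M) (c : C) (z : N) :
    ext3 γ (BC.mk k H a x) (BC.mk k H b y) (BC.mk k H c z) = (a ⊗ₜ[k] (b ⊗ₜ[k] c)) •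
      BC.push ((Hm.str k H A).tensor ((Hm.str k H B).tensor (Hm.str k H C))) (γ x y z) := by
  rw [ext3, BC.lift_mk]
  exact Poly3.extAux'_mk _ _ _ _ _ _ _

/-- `ext3 γ` extends `γ`. -/
lemma ext3_one (γ : Poly3 k H L M N Q) (x : L) (y : M) (z : N) :
    ext3 γ (BC.one k H x) (BC.one k H y) (BC.one k H z) = γ x y z :=
  (ext3_mk _ _ _ _ _ _ _).trans ((tsmul3_one _).trans
    (BC.push_id (Hm.tensor_id (fun _ => rfl) (Hm.tensor_id (fun _ => rfl) (fun _ => rfl))) _))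

end

section

section ExtLemmas

lemma BC.hom_ext2 {X : Type*} [AddCommGroup X] {F G : BC k H A L →+ BC k H B M →+ X}
    (h : ∀ a x b y, F (mk k H a x) (mk k H b y) = G (mk k H a x) (mk k H b y)) : F = G :=
  BC.hom_ext fun a x => BC.hom_ext fun b y => h a x b y

lemma ext2_push (β : Poly2 k H L M N) (θ : Hm k H A A') (η : Hm k H B B') (p : BC k H A L)
    (q : BC k H B M) :
    ext2 β (BC.push θ p) (BC.push η q) = BC.push (θ.tensor η) (ext2 β p q) := by
  induction p using BC.ind with
  | h0 => simp only [map_zero, AddMonoidHom.zero_apply]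
  | ha p p' hp hp' => simp only [map_add, AddMonoidHom.add_apply, hp, hp']
  | hm a x =>
    induction q using BC.ind with
    | h0 => simp only [map_zero]
    | ha q q' hq hq' => simp only [map_add, hq, hq']
    | hm b y =>
      rw [BC.push_mk, BC.push_mk, ext2_mk, ext2_mk, BC.push_smul, BC.push_push]
      exact congrArg _ (BC.push_congr (fun z => by
        induction z using TensorProduct.induction_on with
        | zero => simp only [map_zero]
        | add x y hx hy => simp only [map_add, hx, hy]
        | tmul f g =>
          change OverH.str f ⊗ₜ OverH.str g = θ.hom (OverH.str f) ⊗ₜ η.hom (OverH.str g)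
          rw [θ.comm, η.comm]) _)

lemma ext2_smul (β : Poly2 k H L M N) (a : A) (b : B) (p : BC k H A L) (q : BC k H B M) :
    ext2 β (a • p) (b • q) = (a ⊗ₜ[k] b) • ext2 β p q := by
  induction p using BC.ind with
  | h0 => simp only [smul_zero, map_zero, AddMonoidHom.zero_apply]
  | ha p p' hp hp' => simp only [smul_add, map_add, AddMonoidHom.add_apply, hp, hp']
  | hm a x =>
    induction q using BC.ind with
    | h0 => simp only [map_zero, smul_zero]
    | ha q q' hq hq' => simp only [map_add, smul_add, hq, hq']
    | hm b y =>
      rw [BC.smul_mk, BC.smul_mk, ext2_mk, ext2_mk, tsmul_smul]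

lemma ext2_pre (β : Poly2 k H L M N) (φ : L' →ₗ[H] L) (ψ : M' →ₗ[H] M) (p : BC k H A L')
    (q : BC k H B M') : ext2 (β.pre φ ψ) p q = ext2 β (BC.map k A φ p) (BC.map k B ψ q) := by
  induction p using BC.ind with
  | h0 => simp only [map_zero, AddMonoidHom.zero_apply]
  | ha p p' hp hp' => simp only [map_add, AddMonoidHom.add_apply, hp, hp']
  | hm a x =>
    induction q using BC.ind with
    | h0 => simp only [map_zero]
    | ha q q' hq hq' => simp only [map_add, hq, hq']
    | hm b y => rw [BC.map_mk, BC.map_mk, ext2_mk, ext2_mk]; rfl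

lemma ext2_post (β : Poly2 k H L M N) (φ : N →ₗ[H] N') (p : BC k H A L)
    (q : BC k H B M) : ext2 (β.post φ) p q = BC.map k _ φ (ext2 β p q) := by
  induction p using BC.ind with
  | h0 => simp only [map_zero, AddMonoidHom.zero_apply]
  | ha p p' hp hp' => simp only [map_add, AddMonoidHom.add_apply, hp, hp']
  | hm a x =>
    induction q using BC.ind with
    | h0 => simp only [map_zero]
    | ha q q' hq hq' => simp only [map_add, hq, hq']
    | hm b y =>
      rw [ext2_mk, ext2_mk, map_smul, ← BC.push_map]; rfl

end ExtLemmas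

/-! ### Categories internal to left modules -/

/-- A category internal to left `R`-modules, with module of objects `C₀` and module of arrows `C₁`. -/
structure IntCat (R : Type*) [Ring R] (C₀ C₁ : Type*) [AddCommGroup C₀] [Module R C₀]
    [AddCommGroup C₁] [Module R C₁] where
  /-- source -/
  s : C₁ →ₗ[R] C₀
  /-- target -/
  t : C₁ →ₗ[R] C₀
  /-- identities -/
  i : C₀ →ₗ[R] C₁
  /-- composition, in the diagrammatic order, defined on the fibre product `C₁ ×_{C₀} C₁` -/
  compMap : LinearMap.eqLocus (t ∘ₗ LinearMap.fst R C₁ C₁) (s ∘ₗ LinearMap.snd R C₁ C₁) →ₗ[R] C₁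
  s_i : ∀ x, s (i x) = x
  t_i : ∀ x, t (i x) = x
  s_comp : ∀ p, s (compMap p) = s p.1.1
  t_comp : ∀ p, t (compMap p) = t p.1.2
  id_comp : ∀ f, compMap ⟨(i (s f), f), t_i (s f)⟩ = f
  comp_id : ∀ f, compMap ⟨(f, i (t f)), (s_i (t f)).symm⟩ = f
  assoc : ∀ (f g h : C₁) (e : t f = s g) (e' : t g = s h),
    compMap ⟨(compMap ⟨(f, g), e⟩, h), (t_comp ⟨(f, g), e⟩).trans e'⟩ =
      compMap ⟨(f, compMap ⟨(g, h), e'⟩), e.trans (s_comp ⟨(g, h), e'⟩).symm⟩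

namespace IntCat

variable {R : Type*} [Ring R] {C₀ C₁ : Type*} [AddCommGroup C₀] [Module R C₀]
  [AddCommGroup C₁] [Module R C₁]

/-- The composite of `f : x → y` and `g : y → z`. -/
def comp (E : IntCat R C₀ C₁) (f g : C₁) (e : E.t f = E.s g) : C₁ := E.compMap ⟨(f, g), e⟩

/-- The arrow `f` is an isomorphism. -/
def IsIso (E : IntCat R C₀ C₁) (f : C₁) : Prop :=
  ∃ (g : C₁) (e : E.t f = E.s g) (e' : E.t g = E.s f),
    E.comp f g e = E.i (E.s f) ∧ E.comp g f e' = E.i (E.t f)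

/-- The arrow part of an arrow: its translate that starts at `0`. -/
def arrow (E : IntCat R C₀ C₁) (f : C₁) : C₁ := f - E.i (E.s f)

/-- The composition is determined by the rest of the structure. -/
lemma comp_eq (E : IntCat R C₀ C₁) (f g : C₁) (e : E.t f = E.s g) :
    E.comp f g e = f + g - E.i (E.t f) := by
  have h0 : E.s (g - E.i (E.t f)) = 0 := by rw [map_sub, E.s_i, e, sub_self]
  have h1 := E.comp_id f
  have h2 := E.id_comp (g - E.i (E.t f))
  have h3 : (⟨(f, g), e⟩ : LinearMap.eqLocus (E.t ∘ₗ LinearMap.fst R C₁ C₁)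
      (E.s ∘ₗ LinearMap.snd R C₁ C₁)) =
      ⟨(f, E.i (E.t f)), (E.s_i (E.t f)).symm⟩ +
      ⟨(E.i (E.s (g - E.i (E.t f))), g - E.i (E.t f)), E.t_i _⟩ := by
    apply Subtype.ext
    change (f, g) = (f + E.i (E.s (g - E.i (E.t f))), E.i (E.t f) + (g - E.i (E.t f)))
    rw [h0, map_zero, add_zero, add_sub_cancel]
  rw [comp, h3, map_add, h1, h2]
  abel

lemma s_comp' (E : IntCat R C₀ C₁) (f g : C₁) (e : E.t f = E.s g) : E.s (E.comp f g e) = E.s f :=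
  E.s_comp _

lemma t_comp' (E : IntCat R C₀ C₁) (f g : C₁) (e : E.t f = E.s g) : E.t (E.comp f g e) = E.t g :=
  E.t_comp _

/-- Every arrow of a category internal to modules is an isomorphism. -/
lemma isIso (E : IntCat R C₀ C₁) (f : C₁) : E.IsIso f := by
  refine ⟨E.i (E.s f) + E.i (E.t f) - f, ?_, ?_, ?_, ?_⟩
  · simp only [map_sub, map_add, E.s_i]; abel
  · simp only [map_sub, map_add, E.t_i]; abel
  · rw [comp_eq]; abel
  · rw [comp_eq]
    simp only [map_sub, map_add, E.t_i]; abel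

/-- A category internal to modules from its source, target and identities; the composition is
determined by them. -/
def ofReflexive (s t : C₁ →ₗ[R] C₀) (i : C₀ →ₗ[R] C₁) (si : ∀ x, s (i x) = x)
    (ti : ∀ x, t (i x) = x) : IntCat R C₀ C₁ where
  s := s
  t := t
  i := i
  compMap := (LinearMap.fst R C₁ C₁ + LinearMap.snd R C₁ C₁ - i ∘ₗ t ∘ₗ LinearMap.fst R C₁ C₁) ∘ₗ
    Submodule.subtype _
  s_i := si
  t_i := ti
  s_comp p := by
    obtain ⟨⟨f, g⟩, e⟩ := p
    replace e : t f = s g := e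
    change s (f + g - i (t f)) = s f
    rw [map_sub, map_add, si, e, add_sub_cancel_right]
  t_comp p := by
    obtain ⟨⟨f, g⟩, e⟩ := p
    change t (f + g - i (t f)) = t g
    rw [map_sub, map_add, ti, add_sub_cancel_left]
  id_comp f := by
    change i (s f) + f - i (t (i (s f))) = f
    rw [ti, add_sub_cancel_left]
  comp_id f := by
    change f + i (t f) - i (t f) = f
    rw [add_sub_cancel_right]
  assoc f g h e e' := by
    change f + g - i (t f) + h - i (t (f + g - i (t f))) = f + (g + h - i (t g)) - i (t f)
    rw [map_sub, map_add, ti]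
    simp only [map_sub, map_add]
    abel

variable {C₀ C₁ : Type*} [AddCommGroup C₀] [Module H C₀] [AddCommGroup C₁] [Module H C₁]

variable (k A) in
/-- The category `A ⊗_H C` internal to left `A`-modules. -/
def bc (E : IntCat H C₀ C₁) : IntCat A (BC k H A C₀) (BC k H A C₁) :=
  ofReflexive (BC.map k A E.s) (BC.map k A E.t) (BC.map k A E.i)
    (fun x => by
      rw [BC.map_map, BC.map_congr (ψ := LinearMap.id) (fun x => E.s_i x), BC.map_id])
    (fun x => by
      rw [BC.map_map, BC.map_congr (ψ := LinearMap.id) (fun x => E.t_i x), BC.map_id])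

lemma bc_s (E : IntCat H C₀ C₁) : (E.bc k A).s = BC.map k A E.s := rfl
lemma bc_t (E : IntCat H C₀ C₁) : (E.bc k A).t = BC.map k A E.t := rfl
lemma bc_i (E : IntCat H C₀ C₁) : (E.bc k A).i = BC.map k A E.i := rfl

/-- The composition of `A ⊗_H C` is induced by the one of `C`. -/
lemma bc_comp (E : IntCat H C₀ C₁) (z : BC k H A
      (LinearMap.eqLocus (E.t ∘ₗ LinearMap.fst H C₁ C₁) (E.s ∘ₗ LinearMap.snd H C₁ C₁)))
    (e : (E.bc k A).t (BC.map k A (LinearMap.fst H C₁ C₁ ∘ₗ Submodule.subtype _) z) =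
      (E.bc k A).s (BC.map k A (LinearMap.snd H C₁ C₁ ∘ₗ Submodule.subtype _) z)) :
    (E.bc k A).comp (BC.map k A (LinearMap.fst H C₁ C₁ ∘ₗ Submodule.subtype _) z)
      (BC.map k A (LinearMap.snd H C₁ C₁ ∘ₗ Submodule.subtype _) z) e = BC.map k A E.compMap z := by
  rw [comp_eq, bc_t, bc_i]
  clear e
  induction z using BC.ind with
  | h0 => simp only [map_zero, add_zero, sub_zero]
  | ha z z' hz hz' => rw [map_add, map_add, map_add, map_add, map_add, ← hz, ← hz']; abel
  | hm a p =>
    rw [BC.map_mk, BC.map_mk, BC.map_mk, BC.map_mk, BC.map_mk, ← BC.mk_add_right, sub_eq_iff_eq_add,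
      ← BC.mk_add_right]
    congr 1
    exact eq_add_of_sub_eq (E.comp_eq p.1.1 p.1.2 p.2).symm

end IntCat

end

section

/-! ### Iterated brackets -/

namespace Hm

variable [Coalgebra.IsCocomm k H]
variable {D : Type*} [Ring D] [Algebra k D] [OverH k H D]
variable (k H A B C D)

/-- `a ⊗ (b ⊗ c) ↦ a ⊗ (c ⊗ b)` -/
def swap23 : Hm k H (A ⊗[k] (B ⊗[k] C)) (A ⊗[k] (C ⊗[k] B)) := (Hm.id k H A).tensor (swap k H B C)

/-! Reordering maps: the digits list the factors in the order of the source; the target is always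
`A ⊗ (B ⊗ (C ⊗ D))`. -/

/-- `a ⊗ ((b ⊗ c) ⊗ d) ↦ a ⊗ b ⊗ c ⊗ d` -/
def ord_1_23_4 : Hm k H (A ⊗[k] ((B ⊗[k] C) ⊗[k] D)) (A ⊗[k] (B ⊗[k] (C ⊗[k] D))) :=
  (Hm.id k H A).tensor (assoc k H B C D)

/-- `(a ⊗ (b ⊗ c)) ⊗ d ↦ a ⊗ b ⊗ c ⊗ d` -/
def ord_123_4 : Hm k H ((A ⊗[k] (B ⊗[k] C)) ⊗[k] D) (A ⊗[k] (B ⊗[k] (C ⊗[k] D))) :=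
  (assoc k H A (B ⊗[k] C) D).trans (ord_1_23_4 k H A B C D)

/-- `b ⊗ (a ⊗ (c ⊗ d)) ↦ a ⊗ b ⊗ c ⊗ d` -/
def ord_2_134 : Hm k H (B ⊗[k] (A ⊗[k] (C ⊗[k] D))) (A ⊗[k] (B ⊗[k] (C ⊗[k] D))) :=
  swap12 k H B A (C ⊗[k] D)

/-- `a ⊗ (c ⊗ (b ⊗ d)) ↦ a ⊗ b ⊗ c ⊗ d` -/
def ord_1_3_24 : Hm k H (A ⊗[k] (C ⊗[k] (B ⊗[k] D))) (A ⊗[k] (B ⊗[k] (C ⊗[k] D))) :=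
  (Hm.id k H A).tensor (swap12 k H C B D)

/-- `c ⊗ (a ⊗ (b ⊗ d)) ↦ a ⊗ b ⊗ c ⊗ d` -/
def ord_3_124 : Hm k H (C ⊗[k] (A ⊗[k] (B ⊗[k] D))) (A ⊗[k] (B ⊗[k] (C ⊗[k] D))) :=
  (swap12 k H C A (B ⊗[k] D)).trans (ord_1_3_24 k H A B C D)

/-- `d ⊗ (a ⊗ (b ⊗ c)) ↦ a ⊗ b ⊗ c ⊗ d` -/
def ord_4_123 : Hm k H (D ⊗[k] (A ⊗[k] (B ⊗[k] C))) (A ⊗[k] (B ⊗[k] (C ⊗[k] D))) :=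
  (swap k H D (A ⊗[k] (B ⊗[k] C))).trans (ord_123_4 k H A B C D)

/-- `b ⊗ ((a ⊗ c) ⊗ d) ↦ a ⊗ b ⊗ c ⊗ d` -/
def ord_2_13_4 : Hm k H (B ⊗[k] ((A ⊗[k] C) ⊗[k] D)) (A ⊗[k] (B ⊗[k] (C ⊗[k] D))) :=
  (ord_1_23_4 k H B A C D).trans (ord_2_134 k H A B C D)

/-- `b ⊗ (c ⊗ (a ⊗ d)) ↦ a ⊗ b ⊗ c ⊗ d` -/
def ord_2_3_14 : Hm k H (B ⊗[k] (C ⊗[k] (A ⊗[k] D))) (A ⊗[k] (B ⊗[k] (C ⊗[k] D))) :=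
  (ord_1_3_24 k H B A C D).trans (ord_2_134 k H A B C D)

/-- `c ⊗ (b ⊗ (a ⊗ d)) ↦ a ⊗ b ⊗ c ⊗ d` -/
def ord_3_2_14 : Hm k H (C ⊗[k] (B ⊗[k] (A ⊗[k] D))) (A ⊗[k] (B ⊗[k] (C ⊗[k] D))) :=
  (ord_1_3_24 k H C A B D).trans (ord_3_124 k H A B C D)

/-- `(a ⊗ b) ⊗ (c ⊗ d) ↦ a ⊗ b ⊗ c ⊗ d` -/
def ord_12_34 : Hm k H ((A ⊗[k] B) ⊗[k] (C ⊗[k] D)) (A ⊗[k] (B ⊗[k] (C ⊗[k] D))) :=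
  assoc k H A B (C ⊗[k] D)

/-- `(a ⊗ c) ⊗ (b ⊗ d) ↦ a ⊗ b ⊗ c ⊗ d` -/
def ord_13_24 : Hm k H ((A ⊗[k] C) ⊗[k] (B ⊗[k] D)) (A ⊗[k] (B ⊗[k] (C ⊗[k] D))) :=
  (assoc k H A C (B ⊗[k] D)).trans (ord_1_3_24 k H A B C D)

/-- `(a ⊗ d) ⊗ (b ⊗ c) ↦ a ⊗ b ⊗ c ⊗ d` -/
def ord_14_23 : Hm k H ((A ⊗[k] D) ⊗[k] (B ⊗[k] C)) (A ⊗[k] (B ⊗[k] (C ⊗[k] D))) :=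
  (assoc k H A D (B ⊗[k] C)).trans
    ((swap23 k H A D (B ⊗[k] C)).trans (ord_1_23_4 k H A B C D))

/-- `(b ⊗ c) ⊗ (a ⊗ d) ↦ a ⊗ b ⊗ c ⊗ d` -/
def ord_23_14 : Hm k H ((B ⊗[k] C) ⊗[k] (A ⊗[k] D)) (A ⊗[k] (B ⊗[k] (C ⊗[k] D))) :=
  (ord_13_24 k H B A C D).trans (ord_2_134 k H A B C D)

/-- `(b ⊗ d) ⊗ (a ⊗ c) ↦ a ⊗ b ⊗ c ⊗ d` -/
def ord_24_13 : Hm k H ((B ⊗[k] D) ⊗[k] (A ⊗[k] C)) (A ⊗[k] (B ⊗[k] (C ⊗[k] D))) :=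
  (ord_14_23 k H B A C D).trans (ord_2_134 k H A B C D)

/-- `(c ⊗ d) ⊗ (a ⊗ b) ↦ a ⊗ b ⊗ c ⊗ d` -/
def ord_34_12 : Hm k H ((C ⊗[k] D) ⊗[k] (A ⊗[k] B)) (A ⊗[k] (B ⊗[k] (C ⊗[k] D))) :=
  (swap k H (C ⊗[k] D) (A ⊗[k] B)).trans (ord_12_34 k H A B C D)

end Hm

section Nest

variable {P : Type*} [AddCommGroup P] [Module H P]

/-- `β' (β (p, q), r)` -/
def nestL (β' : Poly2 k H N P Q) (β : Poly2 k H L M N) (p : BC k H A L) (q : BC k H B M)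
    (r : BC k H C P) : BC k H (A ⊗[k] (B ⊗[k] C)) Q :=
  BC.push (Hm.assoc k H A B C) (ext2 β' (ext2 β p q) r)

/-- `β' (p, β (q, r))` -/
def nestR (β' : Poly2 k H P N Q) (β : Poly2 k H L M N) (p : BC k H A P) (q : BC k H B L)
    (r : BC k H C M) : BC k H (A ⊗[k] (B ⊗[k] C)) Q :=
  ext2 β' p (ext2 β q r)

/-- `β' (q, β (p, r))`, with the tensor factors in the order of `p, q, r` -/
def nestM [Coalgebra.IsCocomm k H] (β' : Poly2 k H P N Q) (β : Poly2 k H L M N) (p : BC k H A L)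
    (q : BC k H B P) (r : BC k H C M) : BC k H (A ⊗[k] (B ⊗[k] C)) Q :=
  BC.push (Hm.swap12 k H B A C) (ext2 β' q (ext2 β p r))

end Nest

open BC (one)

/-! ### 2-term `L_∞` pseudoalgebras -/

variable (k H) in
/-- The data of a 2-term `L_∞` `H`-pseudoalgebra: a complex `d = β₁ : L₁ → L₀` of left `H`-modules and
polylinear maps `β₂` (on `L₀ ⊠ L₀` and `L₀ ⊠ L₁`) and `β₃`. -/
structure TwoTermData where
  /-- degree 0 -/
  L₀ : Type v
  /-- degree 1 -/
  L₁ : Type v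
  [ab₀ : AddCommGroup L₀]
  [ab₁ : AddCommGroup L₁]
  [mod₀ : Module H L₀]
  [mod₁ : Module H L₁]
  /-- `β₁` -/
  d : L₁ →ₗ[H] L₀
  /-- `β₂` on `L₀ ⊠ L₀` -/
  b₀₀ : Poly2 k H L₀ L₀ L₀
  /-- `β₂` on `L₀ ⊠ L₁` -/
  b₀₁ : Poly2 k H L₀ L₁ L₁
  /-- `β₃` -/
  b₃ : Poly3 k H L₀ L₀ L₀ L₁

attribute [instance] TwoTermData.ab₀ TwoTermData.ab₁ TwoTermData.mod₀ TwoTermData.mod₁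

section

variable [Coalgebra.IsCocomm k H]

/-- The polylinear map `(y, x) ↦ -(σ₁₂ ⊗_H id) β (x, y)`. -/
def Poly2.opp (β : Poly2 k H L M N) : Poly2 k H M L N where
  toFun y x := -BC.push (Hm.swap k H H H) (β x y)
  add_left y y' x := by rw [β.add_right, map_add, neg_add]
  add_right y x x' := by rw [β.add_left, map_add, neg_add]
  smul f g y x := by
    rw [β.smul, BC.push_smul, ← smul_neg]; rfl

/-- `β` is skew-symmetric: `β (y, x) = -(σ₁₂ ⊗_H id) β (x, y)`. -/
def Poly2.IsSkew (β : Poly2 k H L L N) : Prop :=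
  ∀ x y, β y x = -BC.push (Hm.swap k H H H) (β x y)

/-- `γ` is skew-symmetric: it changes sign under the transpositions `(1 2)` and `(2 3)`, which
generate the symmetric group. -/
def Poly3.IsSkew (γ : Poly3 k H L L L Q) : Prop :=
  (∀ x y z, γ y x z = -BC.push (Hm.swap12 k H H H H) (γ x y z)) ∧
  (∀ x y z, γ x z y = -BC.push (Hm.swap23 k H H H H) (γ x y z))

namespace TwoTermData

/-- `β₂` on `L₁ ⊠ L₀`, which is determined by the skew-symmetry of `β₂`. -/
def b₁₀ (T : TwoTermData.{w, u, v} k H) : Poly2 k H T.L₁ T.L₀ T.L₁ := T.b₀₁.opp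

/-- The axioms of a 2-term `L_∞` `H`-pseudoalgebra. -/
structure IsTwoTerm (T : TwoTermData.{w, u, v} k H) : Prop where
  skew₂ : T.b₀₀.IsSkew
  skew₃ : T.b₃.IsSkew
  /-- `β₁ β₂ (x, u) = β₂ (x, β₁ u)` -/
  ax1 : ∀ x u, BC.map k _ T.d (T.b₀₁ x u) = T.b₀₀ x (T.d u)
  /-- `β₂ (β₁ u, v) = β₂ (u, β₁ v)` -/
  ax2 : ∀ u v, T.b₀₁ (T.d u) v = T.b₁₀ u (T.d v)
  /-- `β₂ (β₂ (x, y), z) - β₂ (x, β₂ (y, z)) + β₂ (y, β₂ (x, z)) = - β₁ β₃ (x, y, z)` -/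
  ax3 : ∀ x y z, nestL T.b₀₀ T.b₀₀ (one k H x) (one k H y) (one k H z)
    - nestR T.b₀₀ T.b₀₀ (one k H x) (one k H y) (one k H z)
    + nestM T.b₀₀ T.b₀₀ (one k H x) (one k H y) (one k H z) = -BC.map k _ T.d (T.b₃ x y z)
  /-- `β₂ (β₂ (x, y), v) - β₂ (x, β₂ (y, v)) + β₂ (y, β₂ (x, v)) = - β₃ (x, y, β₁ v)` -/
  ax4 : ∀ x y v, nestL T.b₀₁ T.b₀₀ (one k H x) (one k H y) (one k H v)
    - nestR T.b₀₁ T.b₀₁ (one k H x) (one k H y) (one k H v)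
    + nestM T.b₀₁ T.b₀₁ (one k H x) (one k H y) (one k H v) = -T.b₃ x y (T.d v)
  /-- `β₂ (x, β₃ (y, z, w)) - β₂ (y, β₃ (x, z, w)) + β₂ (z, β₃ (x, y, w)) - β₂ (w, β₃ (x, y, z))`
  `- β₃ (β₂ (x, y), z, w) + β₃ (β₂ (x, z), y, w) - β₃ (β₂ (x, w), y, z)`
  `- β₃ (β₂ (y, z), x, w) + β₃ (β₂ (y, w), x, z) - β₃ (β₂ (z, w), x, y) = 0` -/
  ax5 : ∀ x y z w,
    ext2 T.b₀₁ (one k H x) (T.b₃ y z w)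
    - BC.push (Hm.ord_2_134 k H H H H H) (ext2 T.b₀₁ (one k H y) (T.b₃ x z w))
    + BC.push (Hm.ord_3_124 k H H H H H) (ext2 T.b₀₁ (one k H z) (T.b₃ x y w))
    - BC.push (Hm.ord_4_123 k H H H H H) (ext2 T.b₀₁ (one k H w) (T.b₃ x y z))
    - BC.push (Hm.ord_12_34 k H H H H H) (ext3 T.b₃ (T.b₀₀ x y) (one k H z) (one k H w))
    + BC.push (Hm.ord_13_24 k H H H H H) (ext3 T.b₃ (T.b₀₀ x z) (one k H y) (one k H w))
    - BC.push (Hm.ord_14_23 k H H H H H) (ext3 T.b₃ (T.b₀₀ x w) (one k H y) (one k H z))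
    - BC.push (Hm.ord_23_14 k H H H H H) (ext3 T.b₃ (T.b₀₀ y z) (one k H x) (one k H w))
    + BC.push (Hm.ord_24_13 k H H H H H) (ext3 T.b₃ (T.b₀₀ y w) (one k H x) (one k H z))
    - BC.push (Hm.ord_34_12 k H H H H H) (ext3 T.b₃ (T.b₀₀ z w) (one k H x) (one k H y)) = 0

/-- The data of a morphism of 2-term `L_∞` `H`-pseudoalgebras. -/
@[ext]
structure HomData (T T' : TwoTermData.{w, u, v} k H) where
  /-- degree 0 -/
  f₀ : T.L₀ →ₗ[H] T'.L₀
  /-- degree 1 -/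
  f₁ : T.L₁ →ₗ[H] T'.L₁
  /-- the homotopy -/
  f₂ : Poly2 k H T.L₀ T.L₀ T'.L₁

/-- The axioms of a morphism of 2-term `L_∞` `H`-pseudoalgebras. -/
structure IsHom {T T' : TwoTermData.{w, u, v} k H} (f : HomData T T') : Prop where
  skew : f.f₂.IsSkew
  /-- `f₀ β₁ = β₁' f₁` -/
  ax1 : ∀ u, f.f₀ (T.d u) = T'.d (f.f₁ u)
  /-- `f₀ β₂ (x, y) - β₂' (f₀ x, f₀ y) = β₁' f₂ (x, y)` -/
  ax2 : ∀ x y, BC.map k _ f.f₀ (T.b₀₀ x y) - T'.b₀₀ (f.f₀ x) (f.f₀ y) = BC.map k _ T'.d (f.f₂ x y)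
  /-- `f₁ β₂ (x, u) - β₂' (f₀ x, f₁ u) = f₂ (x, β₁ u)` -/
  ax3 : ∀ x u, BC.map k _ f.f₁ (T.b₀₁ x u) - T'.b₀₁ (f.f₀ x) (f.f₁ u) = f.f₂ x (T.d u)
  /-- `β₂' (f₂ (x, y), f₀ z) - β₂' (f₀ x, f₂ (y, z)) + β₂' (f₀ y, f₂ (x, z))`
  `+ f₂ (β₂ (x, y), z) - f₂ (x, β₂ (y, z)) + f₂ (y, β₂ (x, z))`
  `= β₃' (f₀ x, f₀ y, f₀ z) - f₁ β₃ (x, y, z)` -/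
  ax4 : ∀ x y z,
    nestL T'.b₁₀ f.f₂ (one k H x) (one k H y) (one k H (f.f₀ z))
    - nestR T'.b₀₁ f.f₂ (one k H (f.f₀ x)) (one k H y) (one k H z)
    + nestM T'.b₀₁ f.f₂ (one k H x) (one k H (f.f₀ y)) (one k H z)
    + nestL f.f₂ T.b₀₀ (one k H x) (one k H y) (one k H z)
    - nestR f.f₂ T.b₀₀ (one k H x) (one k H y) (one k H z)
    + nestM f.f₂ T.b₀₀ (one k H x) (one k H y) (one k H z)
    = T'.b₃ (f.f₀ x) (f.f₀ y) (f.f₀ z) - BC.map k _ f.f₁ (T.b₃ x y z)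

end TwoTermData

end

end

section

open BC (one)

/-! ### Lemmas on iterated brackets -/

namespace Hm

variable {D : Type*} [Ring D] [Algebra k D] [OverH k H D]
variable {E : Type*} [Ring E] [Algebra k E] [OverH k H E]

lemma ext_tmul {θ η : Hm k H (A ⊗[k] B) E} (h : ∀ a b, θ.hom (a ⊗ₜ b) = η.hom (a ⊗ₜ b))
    (x : A ⊗[k] B) : θ.hom x = η.hom x := by
  induction x using TensorProduct.induction_on with
  | zero => rw [map_zero, map_zero]
  | add x y hx hy => rw [map_add, map_add, hx, hy]
  | tmul a b => exact h a b

lemma ext_tmulL {θ η : Hm k H ((A ⊗[k] B) ⊗[k] C) E}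
    (h : ∀ a b c, θ.hom ((a ⊗ₜ b) ⊗ₜ c) = η.hom ((a ⊗ₜ b) ⊗ₜ c))
    (x : (A ⊗[k] B) ⊗[k] C) : θ.hom x = η.hom x := by
  refine ext_tmul (fun y c => ?_) x
  induction y using TensorProduct.induction_on with
  | zero => rw [TensorProduct.zero_tmul, map_zero, map_zero]
  | add x y hx hy => rw [TensorProduct.add_tmul, map_add, map_add, hx, hy]
  | tmul a b => exact h a b c

lemma ext_tmulR {θ η : Hm k H (A ⊗[k] (B ⊗[k] C)) E}
    (h : ∀ a b c, θ.hom (a ⊗ₜ (b ⊗ₜ c)) = η.hom (a ⊗ₜ (b ⊗ₜ c)))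
    (x : A ⊗[k] (B ⊗[k] C)) : θ.hom x = η.hom x := by
  refine ext_tmul (fun a y => ?_) x
  induction y using TensorProduct.induction_on with
  | zero => rw [TensorProduct.tmul_zero, map_zero, map_zero]
  | add x y hx hy => rw [TensorProduct.tmul_add, map_add, map_add, hx, hy]
  | tmul b c => exact h a b c

lemma ext_tmulRR {θ η : Hm k H (A ⊗[k] (B ⊗[k] (C ⊗[k] D))) E}
    (h : ∀ a b c d, θ.hom (a ⊗ₜ (b ⊗ₜ (c ⊗ₜ d))) = η.hom (a ⊗ₜ (b ⊗ₜ (c ⊗ₜ d))))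
    (x : A ⊗[k] (B ⊗[k] (C ⊗[k] D))) : θ.hom x = η.hom x := by
  refine ext_tmulR (fun a b y => ?_) x
  induction y using TensorProduct.induction_on with
  | zero => rw [TensorProduct.tmul_zero, TensorProduct.tmul_zero, map_zero, map_zero]
  | add x y hx hy =>
    rw [TensorProduct.tmul_add, TensorProduct.tmul_add, map_add, map_add, hx, hy]
  | tmul c d => exact h a b c d

lemma ext_tmulRL {θ η : Hm k H (A ⊗[k] ((B ⊗[k] C) ⊗[k] D)) E}
    (h : ∀ a b c d, θ.hom (a ⊗ₜ ((b ⊗ₜ c) ⊗ₜ d)) = η.hom (a ⊗ₜ ((b ⊗ₜ c) ⊗ₜ d)))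
    (x : A ⊗[k] ((B ⊗[k] C) ⊗[k] D)) : θ.hom x = η.hom x := by
  refine ext_tmulR (fun a y d => ?_) x
  induction y using TensorProduct.induction_on with
  | zero => rw [TensorProduct.zero_tmul, TensorProduct.tmul_zero, map_zero, map_zero]
  | add x y hx hy =>
    rw [TensorProduct.add_tmul, TensorProduct.tmul_add, map_add, map_add, hx, hy]
  | tmul b c => exact h a b c d

lemma ext_tmulLR {θ η : Hm k H ((A ⊗[k] (B ⊗[k] C)) ⊗[k] D) E}
    (h : ∀ a b c d, θ.hom ((a ⊗ₜ (b ⊗ₜ c)) ⊗ₜ d) = η.hom ((a ⊗ₜ (b ⊗ₜ c)) ⊗ₜ d))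
    (x : (A ⊗[k] (B ⊗[k] C)) ⊗[k] D) : θ.hom x = η.hom x := by
  refine ext_tmulL (fun a y d => ?_) x
  induction y using TensorProduct.induction_on with
  | zero => rw [TensorProduct.tmul_zero, TensorProduct.zero_tmul, map_zero, map_zero]
  | add x y hx hy =>
    rw [TensorProduct.tmul_add, TensorProduct.add_tmul, map_add, map_add, hx, hy]
  | tmul b c => exact h a b c d

lemma ext_tmul22 {θ η : Hm k H ((A ⊗[k] B) ⊗[k] (C ⊗[k] D)) E}
    (h : ∀ a b c d, θ.hom ((a ⊗ₜ b) ⊗ₜ (c ⊗ₜ d)) = η.hom ((a ⊗ₜ b) ⊗ₜ (c ⊗ₜ d)))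
    (x : (A ⊗[k] B) ⊗[k] (C ⊗[k] D)) : θ.hom x = η.hom x := by
  refine ext_tmulL (fun a b y => ?_) x
  induction y using TensorProduct.induction_on with
  | zero => rw [TensorProduct.tmul_zero, map_zero, map_zero]
  | add x y hx hy => rw [TensorProduct.tmul_add, map_add, map_add, hx, hy]
  | tmul c d => exact h a b c d

end Hm

lemma BC.map_sub_hom (φ ψ : M →ₗ[H] N) (x : BC k H A M) :
    map k A (φ - ψ) x = map k A φ x - map k A ψ x := by
  rw [eq_sub_iff_add_eq, ← map_add_hom, sub_add_cancel]

lemma ext2_push_left (β : Poly2 k H L M N) (θ : Hm k H A A') (p : BC k H A L) (q : BC k H B M) :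
    ext2 β (BC.push θ p) q = BC.push (θ.tensor (Hm.id k H B)) (ext2 β p q) := by
  rw [← ext2_push, BC.push_id (θ := Hm.id k H B) (fun _ => rfl)]

lemma ext2_push_right (β : Poly2 k H L M N) (η : Hm k H B B') (p : BC k H A L) (q : BC k H B M) :
    ext2 β p (BC.push η q) = BC.push ((Hm.id k H A).tensor η) (ext2 β p q) := by
  rw [← ext2_push, BC.push_id (θ := Hm.id k H A) (fun _ => rfl)]

lemma map_ext2 {β : Poly2 k H L M N} {β' : Poly2 k H L' M' N'} {φ : L →ₗ[H] L'} {ψ : M →ₗ[H] M'}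
    {χ : N →ₗ[H] N'} (h : ∀ x y, BC.map k _ χ (β x y) = β' (φ x) (ψ y)) (p : BC k H A L)
    (q : BC k H B M) :
    BC.map k _ χ (ext2 β p q) = ext2 β' (BC.map k _ φ p) (BC.map k _ ψ q) := by
  rw [← ext2_post, ← ext2_pre]
  congr 3
  ext x y
  exact h x y

section

variable {P : Type*} [AddCommGroup P] [Module H P]

lemma nestL_mk (β' : Poly2 k H N P Q) (β : Poly2 k H L M N) (a : A) (x : L) (b : B) (y : M)
    (c : C) (z : P) : nestL β' β (BC.mk k H a x) (BC.mk k H b y) (BC.mk k H c z) =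
      (a ⊗ₜ[k] (b ⊗ₜ[k] c)) •
        BC.push ((Hm.str k H A).tensor ((Hm.str k H B).tensor (Hm.str k H C)))
          (nestL β' β (BC.one k H x) (BC.one k H y) (BC.one k H z)) := by
  rw [BC.mk_eq a, BC.mk_eq b, BC.mk_eq c, nestL, ext2_smul, ext2_smul, ext2_push, ext2_push,
    BC.push_smul]
  refine congrArg _ ?_
  rw [nestL, BC.push_push, BC.push_push]
  refine BC.push_congr ?_ _
  intro x
  refine Hm.ext_tmulL ?_ x
  intro a b c
  rfl

lemma nestR_mk (β' : Poly2 k H P N Q) (β : Poly2 k H L M N) (a : A) (x : P) (b : B) (y : L)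
    (c : C) (z : M) : nestR β' β (BC.mk k H a x) (BC.mk k H b y) (BC.mk k H c z) =
      (a ⊗ₜ[k] (b ⊗ₜ[k] c)) •
        BC.push ((Hm.str k H A).tensor ((Hm.str k H B).tensor (Hm.str k H C)))
          (nestR β' β (BC.one k H x) (BC.one k H y) (BC.one k H z)) := by
  rw [BC.mk_eq a, BC.mk_eq b, BC.mk_eq c, nestR, ext2_smul, ext2_smul, ext2_push, ext2_push]
  rfl

lemma nestM_mk [Coalgebra.IsCocomm k H] (β' : Poly2 k H P N Q) (β : Poly2 k H L M N) (a : A)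
    (x : L) (b : B) (y : P)
    (c : C) (z : M) : nestM β' β (BC.mk k H a x) (BC.mk k H b y) (BC.mk k H c z) =
      (a ⊗ₜ[k] (b ⊗ₜ[k] c)) •
        BC.push ((Hm.str k H A).tensor ((Hm.str k H B).tensor (Hm.str k H C)))
          (nestM β' β (BC.one k H x) (BC.one k H y) (BC.one k H z)) := by
  rw [BC.mk_eq a, BC.mk_eq b, BC.mk_eq c, nestM, ext2_smul, ext2_smul, ext2_push, ext2_push,
    BC.push_smul]
  refine congrArg _ ?_
  rw [nestM, BC.push_push, BC.push_push]
  refine BC.push_congr ?_ _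
  intro x
  refine Hm.ext_tmulR ?_ x
  intro a b c
  rfl

lemma map_ext3_nestL {γ : Poly3 k H L M P Q} {β' : Poly2 k H N P Q'} {β : Poly2 k H L M N}
    {χ : Q →ₗ[H] Q'}
    (h : ∀ x y z, BC.map k _ χ (γ x y z) = nestL β' β (BC.one k H x) (BC.one k H y) (BC.one k H z))
    (p : BC k H A L) (q : BC k H B M) (r : BC k H C P) :
    BC.map k _ χ (ext3 γ p q r) = nestL β' β p q r := by
  induction p using BC.ind with
  | h0 => simp only [nestL, map_zero, AddMonoidHom.zero_apply]
  | ha p p' hp hp' => simp only [nestL, map_add, AddMonoidHom.add_apply, hp, hp']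
  | hm a x =>
    induction q using BC.ind with
    | h0 => simp only [nestL, map_zero, AddMonoidHom.zero_apply]
    | ha q q' hq hq' => simp only [nestL, map_add, AddMonoidHom.add_apply, hq, hq']
    | hm b y =>
      induction r using BC.ind with
      | h0 => simp only [nestL, map_zero]
      | ha q q' hq hq' => simp only [nestL, map_add, hq, hq']
      | hm c z => rw [ext3_mk, nestL_mk, map_smul, ← BC.push_map, h]

lemma map_ext3_nestRM [Coalgebra.IsCocomm k H] {P' N' : Type*} [AddCommGroup P'] [Module H P']
    [AddCommGroup N'] [Module H N']
    {γ : Poly3 k H L M P Q} {βR' : Poly2 k H L N Q'} {βR : Poly2 k H M P N}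
    {βM' : Poly2 k H M N' Q'} {βM : Poly2 k H L P N'} {χ : Q →ₗ[H] Q'}
    (h : ∀ x y z, BC.map k _ χ (γ x y z) =
      nestR βR' βR (BC.one k H x) (BC.one k H y) (BC.one k H z) -
      nestM βM' βM (BC.one k H x) (BC.one k H y) (BC.one k H z))
    (p : BC k H A L) (q : BC k H B M) (r : BC k H C P) :
    BC.map k _ χ (ext3 γ p q r) = nestR βR' βR p q r - nestM βM' βM p q r := by
  induction p using BC.ind with
  | h0 => simp only [nestR, nestM, map_zero, AddMonoidHom.zero_apply, sub_zero]
  | ha p p' hp hp' =>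
    simp only [nestR, nestM, map_add, AddMonoidHom.add_apply] at hp hp' ⊢
    rw [hp, hp']; abel
  | hm a x =>
    induction q using BC.ind with
    | h0 => simp only [nestR, nestM, map_zero, AddMonoidHom.zero_apply, sub_zero]
    | ha q q' hq hq' =>
      simp only [nestR, nestM, map_add, AddMonoidHom.add_apply] at hq hq' ⊢
      rw [hq, hq']; abel
    | hm b y =>
      induction r using BC.ind with
      | h0 => simp only [nestR, nestM, map_zero, sub_zero]
      | ha q q' hq hq' =>
        simp only [nestR, nestM, map_add] at hq hq' ⊢
        rw [hq, hq']; abel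
      | hm c z => rw [ext3_mk, nestR_mk, nestM_mk, map_smul, ← BC.push_map, h, map_sub, smul_sub]

end

/-! ### Lie-2 pseudoalgebras -/

variable (k H) in
/-- The data of a Lie-2 `H`-pseudoalgebra. -/
structure Lie2Data where
  /-- the module of objects -/
  C₀ : Type v
  /-- the module of arrows -/
  C₁ : Type v
  [ab₀ : AddCommGroup C₀]
  [ab₁ : AddCommGroup C₁]
  [mod₀ : Module H C₀]
  [mod₁ : Module H C₁]
  /-- the left-2 module -/
  cat : IntCat H C₀ C₁
  /-- the pseudobracket on objects -/
  br₀ : Poly2 k H C₀ C₀ C₀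
  /-- the pseudobracket on arrows -/
  br₁ : Poly2 k H C₁ C₁ C₁
  /-- the Jacobiator -/
  J : Poly3 k H C₀ C₀ C₀ C₁

attribute [instance] Lie2Data.ab₀ Lie2Data.ab₁ Lie2Data.mod₀ Lie2Data.mod₁

namespace Lie2Data

variable (D : Lie2Data.{w, u, v} k H)

/-- The identity of an object `x` of `A ⊗_H C`. -/
def idn (x : BC k H A D.C₀) : BC k H A D.C₁ := BC.map k A D.cat.i x

lemma s_idn (x : BC k H A D.C₀) : BC.map k A D.cat.s (D.idn x) = x := (D.cat.bc k A).s_i x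

lemma t_idn (x : BC k H A D.C₀) : BC.map k A D.cat.t (D.idn x) = x := (D.cat.bc k A).t_i x

end Lie2Data

variable [Coalgebra.IsCocomm k H]

namespace Lie2Data

variable (D : Lie2Data.{w, u, v} k H)

/-- The category `H^{⊗ 2} ⊗_H C`. -/
def E2 : IntCat (H ⊗[k] H) (BC k H (H ⊗[k] H) D.C₀) (BC k H (H ⊗[k] H) D.C₁) := D.cat.bc k _

/-- The category `H^{⊗ 3} ⊗_H C`. -/
def E3 : IntCat (H ⊗[k] (H ⊗[k] H)) (BC k H (H ⊗[k] (H ⊗[k] H)) D.C₀)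
    (BC k H (H ⊗[k] (H ⊗[k] H)) D.C₁) := D.cat.bc k _

/-- The category `H^{⊗ 4} ⊗_H C`. -/
def E4 : IntCat (H ⊗[k] (H ⊗[k] (H ⊗[k] H))) (BC k H (H ⊗[k] (H ⊗[k] (H ⊗[k] H))) D.C₀)
    (BC k H (H ⊗[k] (H ⊗[k] (H ⊗[k] H))) D.C₁) := D.cat.bc k _

/-- Sources and targets: the bracket is a morphism of graphs, and the Jacobiator `J x y z` is an arrow
`[[x * y] * z] → [x * [y * z]] - [y * [x * z]]`. -/
structure IsGraph : Prop where
  s_br : ∀ f g, D.E2.s (D.br₁ f g) = D.br₀ (D.cat.s f) (D.cat.s g)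
  t_br : ∀ f g, D.E2.t (D.br₁ f g) = D.br₀ (D.cat.t f) (D.cat.t g)
  s_J : ∀ x y z, D.E3.s (D.J x y z) = nestL D.br₀ D.br₀ (one k H x) (one k H y) (one k H z)
  t_J : ∀ x y z, D.E3.t (D.J x y z) = nestR D.br₀ D.br₀ (one k H x) (one k H y) (one k H z) -
    nestM D.br₀ D.br₀ (one k H x) (one k H y) (one k H z)

/-! The arrows in the coherence diagram of the Jacobiator, for four objects `x, y, z, w` of categories
`A ⊗_H C`; the tensor factors are always put in the order of `x, y, z, w`. -/

section Hexagon

variable {A₄ : Type*} [Ring A₄] [Algebra k A₄] [OverH k H A₄]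
variable (x : BC k H A D.C₀) (y : BC k H B D.C₀) (z : BC k H C D.C₀) (w : BC k H A₄ D.C₀)

/-- `[J_{x,y,z} * w]` -/
def hexL1 : BC k H (A ⊗[k] (B ⊗[k] (C ⊗[k] A₄))) D.C₁ :=
  BC.push (Hm.ord_123_4 k H A B C A₄) (ext2 D.br₁ (ext3 D.J x y z) (D.idn w))

/-- `J_{x,[y*z],w} - J_{y,[x*z],w}` -/
def hexL2 : BC k H (A ⊗[k] (B ⊗[k] (C ⊗[k] A₄))) D.C₁ :=
  BC.push (Hm.ord_1_23_4 k H A B C A₄) (ext3 D.J x (ext2 D.br₀ y z) w) -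
  BC.push (Hm.ord_2_13_4 k H A B C A₄) (ext3 D.J y (ext2 D.br₀ x z) w)

/-- `[x * J_{y,z,w}] - J_{y,z,[x*w]} - [y * J_{x,z,w}] + J_{x,z,[y*w]}` -/
def hexL3 : BC k H (A ⊗[k] (B ⊗[k] (C ⊗[k] A₄))) D.C₁ :=
  ext2 D.br₁ (D.idn x) (ext3 D.J y z w) -
  BC.push (Hm.ord_2_3_14 k H A B C A₄) (ext3 D.J y z (ext2 D.br₀ x w)) -
  BC.push (Hm.ord_2_134 k H A B C A₄) (ext2 D.br₁ (D.idn y) (ext3 D.J x z w)) +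
  BC.push (Hm.ord_1_3_24 k H A B C A₄) (ext3 D.J x z (ext2 D.br₀ y w))

/-- `J_{[x*y],z,w}` -/
def hexR1 : BC k H (A ⊗[k] (B ⊗[k] (C ⊗[k] A₄))) D.C₁ :=
  BC.push (Hm.ord_12_34 k H A B C A₄) (ext3 D.J (ext2 D.br₀ x y) z w)

/-- `1 - [z * J_{x,y,w}]`, where `1` is the identity of `[[x * y] * [z * w]]` -/
def hexR2 : BC k H (A ⊗[k] (B ⊗[k] (C ⊗[k] A₄))) D.C₁ :=
  D.idn (BC.push (Hm.ord_12_34 k H A B C A₄) (ext2 D.br₀ (ext2 D.br₀ x y) (ext2 D.br₀ z w))) -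
  BC.push (Hm.ord_3_124 k H A B C A₄) (ext2 D.br₁ (D.idn z) (ext3 D.J x y w))

/-- `J_{x,y,[z*w]} - 1 + 1`, where the `1` are the identities of `[z * [x * [y * w]]]` and of
`[z * [y * [x * w]]]` -/
def hexR3 : BC k H (A ⊗[k] (B ⊗[k] (C ⊗[k] A₄))) D.C₁ :=
  ext3 D.J x y (ext2 D.br₀ z w) -
  D.idn (BC.push (Hm.ord_3_124 k H A B C A₄)
    (ext2 D.br₀ z (ext2 D.br₀ x (ext2 D.br₀ y w)))) +
  D.idn (BC.push (Hm.ord_3_2_14 k H A B C A₄)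
    (ext2 D.br₀ z (ext2 D.br₀ y (ext2 D.br₀ x w))))

end Hexagon

namespace IsGraph

variable {D}

lemma s_ext2 (hD : D.IsGraph) (p : BC k H A D.C₁) (q : BC k H B D.C₁) :
    BC.map k _ D.cat.s (ext2 D.br₁ p q) =
    ext2 D.br₀ (BC.map k _ D.cat.s p) (BC.map k _ D.cat.s q) :=
  map_ext2 (β := D.br₁) (β' := D.br₀) (φ := D.cat.s) (ψ := D.cat.s) (χ := D.cat.s) hD.s_br p q

lemma t_ext2 (hD : D.IsGraph) (p : BC k H A D.C₁) (q : BC k H B D.C₁) :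
    BC.map k _ D.cat.t (ext2 D.br₁ p q) =
    ext2 D.br₀ (BC.map k _ D.cat.t p) (BC.map k _ D.cat.t q) :=
  map_ext2 (β := D.br₁) (β' := D.br₀) (φ := D.cat.t) (ψ := D.cat.t) (χ := D.cat.t) hD.t_br p q

lemma s_ext3 (hD : D.IsGraph) (p : BC k H A D.C₀) (q : BC k H B D.C₀) (r : BC k H C D.C₀) :
    BC.map k _ D.cat.s (ext3 D.J p q r) = nestL D.br₀ D.br₀ p q r :=
  map_ext3_nestL (L := D.C₀) (M := D.C₀) (N := D.C₀) (P := D.C₀) (Q := D.C₁) (Q' := D.C₀) (γ := D.J) (β' := D.br₀) (β := D.br₀) (χ := D.cat.s) hD.s_J p q r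

lemma t_ext3 (hD : D.IsGraph) (p : BC k H A D.C₀) (q : BC k H B D.C₀) (r : BC k H C D.C₀) :
    BC.map k _ D.cat.t (ext3 D.J p q r) = nestR D.br₀ D.br₀ p q r - nestM D.br₀ D.br₀ p q r :=
  map_ext3_nestRM (L := D.C₀) (M := D.C₀) (N := D.C₀) (P := D.C₀) (Q := D.C₁) (Q' := D.C₀)
    (P' := D.C₀) (N' := D.C₀) (γ := D.J) (βR' := D.br₀) (βR := D.br₀) (βM' := D.br₀) (βM := D.br₀)
    (χ := D.cat.t) hD.t_J p q r

end IsGraph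

end Lie2Data

end

section

open BC (one)

lemma BC.map_sub (φ : M →ₗ[H] N) (x y : BC k H A M) :
    map k A φ (x - y) = map k A φ x - map k A φ y := (map k A φ).map_sub x y

lemma BC.map_add (φ : M →ₗ[H] N) (x y : BC k H A M) :
    map k A φ (x + y) = map k A φ x + map k A φ y := (map k A φ).map_add x y

lemma BC.push_sub (θ : Hm k H A B) (x y : BC k H A M) : push θ (x - y) = push θ x - push θ y :=
  (push θ).map_sub x y

lemma BC.push_add (θ : Hm k H A B) (x y : BC k H A M) : push θ (x + y) = push θ x + push θ y :=
  (push θ).map_add x y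

lemma ext2_sub_left (β : Poly2 k H L M N) (p p' : BC k H A L) (q : BC k H B M) :
    ext2 β (p - p') q = ext2 β p q - ext2 β p' q :=
  DFunLike.congr_fun ((ext2 β).map_sub p p') q

lemma ext2_sub_right (β : Poly2 k H L M N) (p : BC k H A L) (q q' : BC k H B M) :
    ext2 β p (q - q') = ext2 β p q - ext2 β p q' := (ext2 β p).map_sub q q'

lemma ext2_add_left (β : Poly2 k H L M N) (p p' : BC k H A L) (q : BC k H B M) :
    ext2 β (p + p') q = ext2 β p q + ext2 β p' q :=
  DFunLike.congr_fun ((ext2 β).map_add p p') q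

lemma ext2_add_right (β : Poly2 k H L M N) (p : BC k H A L) (q q' : BC k H B M) :
    ext2 β p (q + q') = ext2 β p q + ext2 β p q' := (ext2 β p).map_add q q'

namespace Lie2Data

namespace IsGraph

variable [Coalgebra.IsCocomm k H] {D : Lie2Data.{w, u, v} k H}
variable {A₄ : Type*} [Ring A₄] [Algebra k A₄] [OverH k H A₄]
variable (x : BC k H A D.C₀) (y : BC k H B D.C₀) (z : BC k H C D.C₀) (w : BC k H A₄ D.C₀)

variable {E : Type*} [Ring E] [Algebra k E] [OverH k H E]

lemma s_J' (hD : D.IsGraph) (θ : Hm k H (A ⊗[k] (B ⊗[k] C)) E) :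
    BC.map k E D.cat.s (BC.push θ (ext3 D.J x y z)) =
      BC.push ((Hm.assoc k H A B C).trans θ) (ext2 D.br₀ (ext2 D.br₀ x y) z) :=
  (BC.push_map θ D.cat.s _).symm.trans ((congrArg (BC.push θ) (hD.s_ext3 x y z)).trans
    (BC.push_push _ _ _))

lemma t_J' (hD : D.IsGraph) (θ : Hm k H (A ⊗[k] (B ⊗[k] C)) E) :
    BC.map k E D.cat.t (BC.push θ (ext3 D.J x y z)) =
      BC.push θ (ext2 D.br₀ x (ext2 D.br₀ y z)) -
      BC.push ((Hm.swap12 k H B A C).trans θ) (ext2 D.br₀ y (ext2 D.br₀ x z)) :=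
  (BC.push_map θ D.cat.t _).symm.trans ((congrArg (BC.push θ) (hD.t_ext3 x y z)).trans
    ((BC.push_sub θ _ _).trans (congrArg (_ - ·) (BC.push_push _ _ _))))

lemma s_br' (hD : D.IsGraph) (p : BC k H A D.C₁) (q : BC k H B D.C₁) (θ : Hm k H (A ⊗[k] B) E) :
    BC.map k E D.cat.s (BC.push θ (ext2 D.br₁ p q)) =
      BC.push θ (ext2 D.br₀ (BC.map k A D.cat.s p) (BC.map k B D.cat.s q)) :=
  (BC.push_map θ D.cat.s _).symm.trans (congrArg (BC.push θ) (hD.s_ext2 p q))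

lemma t_br' (hD : D.IsGraph) (p : BC k H A D.C₁) (q : BC k H B D.C₁) (θ : Hm k H (A ⊗[k] B) E) :
    BC.map k E D.cat.t (BC.push θ (ext2 D.br₁ p q)) =
      BC.push θ (ext2 D.br₀ (BC.map k A D.cat.t p) (BC.map k B D.cat.t q)) :=
  (BC.push_map θ D.cat.t _).symm.trans (congrArg (BC.push θ) (hD.t_ext2 p q))

/-- Left whiskering -/
lemma s_brJ (hD : D.IsGraph) (θ : Hm k H (A₄ ⊗[k] (A ⊗[k] (B ⊗[k] C))) E) :
    BC.map k E D.cat.s (BC.push θ (ext2 D.br₁ (D.idn w) (ext3 D.J x y z))) =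
      BC.push (((Hm.id k H A₄).tensor (Hm.assoc k H A B C)).trans θ)
        (ext2 D.br₀ w (ext2 D.br₀ (ext2 D.br₀ x y) z)) := by
  refine (hD.s_br' (D.idn w) (ext3 D.J x y z) θ).trans ?_
  rw [D.s_idn w, hD.s_ext3 x y z, nestL, ext2_push_right D.br₀, BC.push_push]

lemma t_brJ (hD : D.IsGraph) (θ : Hm k H (A₄ ⊗[k] (A ⊗[k] (B ⊗[k] C))) E) :
    BC.map k E D.cat.t (BC.push θ (ext2 D.br₁ (D.idn w) (ext3 D.J x y z))) =
      BC.push θ (ext2 D.br₀ w (ext2 D.br₀ x (ext2 D.br₀ y z))) -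
      BC.push (((Hm.id k H A₄).tensor (Hm.swap12 k H B A C)).trans θ)
        (ext2 D.br₀ w (ext2 D.br₀ y (ext2 D.br₀ x z))) := by
  refine (hD.t_br' (D.idn w) (ext3 D.J x y z) θ).trans ?_
  rw [D.t_idn w, hD.t_ext3 x y z, nestR, nestM, ext2_sub_right D.br₀, BC.push_sub θ,
    ext2_push_right D.br₀, BC.push_push]

lemma t_Jbr (hD : D.IsGraph) (θ : Hm k H ((A ⊗[k] (B ⊗[k] C)) ⊗[k] A₄) E) :
    BC.map k E D.cat.t (BC.push θ (ext2 D.br₁ (ext3 D.J x y z) (D.idn w))) =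
      BC.push θ (ext2 D.br₀ (ext2 D.br₀ x (ext2 D.br₀ y z)) w) -
      BC.push (((Hm.swap12 k H B A C).tensor (Hm.id k H A₄)).trans θ)
        (ext2 D.br₀ (ext2 D.br₀ y (ext2 D.br₀ x z)) w) := by
  refine (hD.t_br' (ext3 D.J x y z) (D.idn w) θ).trans ?_
  rw [D.t_idn w, hD.t_ext3 x y z, nestR, nestM, ext2_sub_left D.br₀, BC.push_sub θ,
    ext2_push_left D.br₀, BC.push_push]

lemma hexL12 (hD : D.IsGraph) :
    (D.cat.bc k _).t (D.hexL1 x y z w) = (D.cat.bc k _).s (D.hexL2 x y z w) := by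
  refine (hD.t_Jbr x y z w _).trans (Eq.symm ((BC.map_sub _ _ _).trans ?_))
  rw [hD.s_J' x (ext2 D.br₀ y z) w, hD.s_J' y (ext2 D.br₀ x z) w]
  exact congrArg₂ (· - ·)
    (by refine BC.push_congr ?_ _; intro a; refine Hm.ext_tmulLR ?_ a; intro _ _ _ _; rfl)
    (by refine BC.push_congr ?_ _; intro a; refine Hm.ext_tmulLR ?_ a; intro _ _ _ _; rfl)

lemma hexR12 (hD : D.IsGraph) :
    (D.cat.bc k _).t (D.hexR1 x y z w) = (D.cat.bc k _).s (D.hexR2 x y z w) := by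
  refine (hD.t_J' (ext2 D.br₀ x y) z w _).trans (Eq.symm ((BC.map_sub _ _ _).trans ?_))
  rw [D.s_idn, hD.s_brJ x y w z]
  exact congrArg₂ (· - ·) rfl
    (by refine BC.push_congr ?_ _; intro a; refine Hm.ext_tmulRL ?_ a; intro _ _ _ _; rfl)

lemma hexR23 (hD : D.IsGraph) :
    (D.cat.bc k _).t (D.hexR2 x y z w) = (D.cat.bc k _).s (D.hexR3 x y z w) := by
  have e1 : BC.map k _ D.cat.s (ext3 D.J x y (ext2 D.br₀ z w)) =
      BC.push (Hm.ord_12_34 k H A B C A₄) (ext2 D.br₀ (ext2 D.br₀ x y) (ext2 D.br₀ z w)) :=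
    hD.s_ext3 x y (ext2 D.br₀ z w)
  have e2 : BC.push (((Hm.id k H C).tensor (Hm.swap12 k H B A A₄)).trans
        (Hm.ord_3_124 k H A B C A₄)) (ext2 D.br₀ z (ext2 D.br₀ y (ext2 D.br₀ x w))) =
      BC.push (Hm.ord_3_2_14 k H A B C A₄) (ext2 D.br₀ z (ext2 D.br₀ y (ext2 D.br₀ x w))) :=
    (by refine BC.push_congr ?_ _; intro a; refine Hm.ext_tmulRR ?_ a; intro _ _ _ _; rfl)
  have e3 := (hD.t_brJ x y w z (Hm.ord_3_124 k H A B C A₄)).trans (congrArg (_ - ·) e2)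
  refine (BC.map_sub _ _ _).trans ((congrArg₂ (· - ·) (D.t_idn _) e3).trans ?_)
  refine Eq.symm ((BC.map_add _ _ _).trans ?_)
  exact (congrArg₂ (· + ·) ((BC.map_sub _ _ _).trans (congrArg₂ (· - ·) e1 (D.s_idn _)))
    (D.s_idn _)).trans (sub_add _ _ _)

lemma hexL23 (hD : D.IsGraph) :
    (D.cat.bc k _).t (D.hexL2 x y z w) = (D.cat.bc k _).s (D.hexL3 x y z w) := by
  have e1 : BC.map k _ D.cat.s (ext2 D.br₁ (D.idn x) (ext3 D.J y z w)) =
      BC.push (Hm.ord_1_23_4 k H A B C A₄) (ext2 D.br₀ x (ext2 D.br₀ (ext2 D.br₀ y z) w)) := by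
    rw [hD.s_ext2 (D.idn x) (ext3 D.J y z w), D.s_idn x, hD.s_ext3 y z w, nestL,
      ext2_push_right D.br₀]
    rfl
  have e2 : BC.map k _ D.cat.s (BC.push (Hm.ord_2_3_14 k H A B C A₄)
        (ext3 D.J y z (ext2 D.br₀ x w))) =
      BC.push ((Hm.swap12 k H (B ⊗[k] C) A A₄).trans (Hm.ord_1_23_4 k H A B C A₄))
        (ext2 D.br₀ (ext2 D.br₀ y z) (ext2 D.br₀ x w)) :=
    (hD.s_J' y z (ext2 D.br₀ x w) (Hm.ord_2_3_14 k H A B C A₄)).trans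
    (by refine BC.push_congr ?_ _; intro a; refine Hm.ext_tmul22 ?_ a; intro _ _ _ _; rfl)
  have e3 : BC.map k _ D.cat.s (BC.push (Hm.ord_2_134 k H A B C A₄)
        (ext2 D.br₁ (D.idn y) (ext3 D.J x z w))) =
      BC.push (Hm.ord_2_13_4 k H A B C A₄) (ext2 D.br₀ y (ext2 D.br₀ (ext2 D.br₀ x z) w)) :=
    (hD.s_brJ x z w y (Hm.ord_2_134 k H A B C A₄)).trans rfl
  have e4 : BC.map k _ D.cat.s (BC.push (Hm.ord_1_3_24 k H A B C A₄)
        (ext3 D.J x z (ext2 D.br₀ y w))) =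
      BC.push ((Hm.swap12 k H (A ⊗[k] C) B A₄).trans (Hm.ord_2_13_4 k H A B C A₄))
        (ext2 D.br₀ (ext2 D.br₀ x z) (ext2 D.br₀ y w)) :=
    (hD.s_J' x z (ext2 D.br₀ y w) (Hm.ord_1_3_24 k H A B C A₄)).trans
    (by refine BC.push_congr ?_ _; intro a; refine Hm.ext_tmul22 ?_ a; intro _ _ _ _; rfl)
  have e5 := hD.t_J' x (ext2 D.br₀ y z) w (Hm.ord_1_23_4 k H A B C A₄)
  have e6 := hD.t_J' y (ext2 D.br₀ x z) w (Hm.ord_2_13_4 k H A B C A₄)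
  refine (BC.map_sub _ _ _).trans ((congrArg₂ (· - ·) e5 e6).trans ?_)
  refine Eq.symm ((BC.map_add _ _ _).trans ?_)
  refine (congrArg₂ (· + ·) ((BC.map_sub _ _ _).trans (congrArg₂ (· - ·)
    ((BC.map_sub _ _ _).trans (congrArg₂ (· - ·) e1 e2)) e3)) e4).trans (sub_add _ _ _)

end IsGraph

end Lie2Data

end

section

open BC (one)

lemma BC.push_map' (θ : Hm k H A B) (φ : M →ₗ[H] N) (x : BC k H A M) :
    map k B φ (push θ x) = push θ (map k A φ x) := (push_map θ φ x).symm

lemma map_ext2_map {β : Poly2 k H L M N} {β' : Poly2 k H L M N'} {χ : N →ₗ[H] Q} {χ' : N' →ₗ[H] Q}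
    (h : ∀ x y, BC.map k _ χ (β x y) = BC.map k _ χ' (β' x y)) (p : BC k H A L)
    (q : BC k H B M) : BC.map k _ χ (ext2 β p q) = BC.map k _ χ' (ext2 β' p q) := by
  rw [← ext2_post, ← ext2_post]
  congr 3
  ext x y
  exact h x y

namespace Lie2Data

variable [Coalgebra.IsCocomm k H]

section

variable {D : Lie2Data.{w, u, v} k H}

namespace IsGraph

lemma t_br_comp (hD : D.IsGraph) (f f' g g' : D.C₁) (e : D.cat.t f = D.cat.s f')
    (e' : D.cat.t g = D.cat.s g') : D.E2.t (D.br₁ f g) = D.E2.s (D.br₁ f' g') := by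
  rw [hD.t_br, hD.s_br, e, e']

/-- The two paths in the naturality square of the Jacobiator -/
lemma nat₁ (hD : D.IsGraph) (f g h : D.C₁) :
    D.E3.t (nestL D.br₁ D.br₁ (one k H f) (one k H g) (one k H h)) =
      D.E3.s (D.J (D.cat.t f) (D.cat.t g) (D.cat.t h)) := by
  refine Eq.trans ?_ (hD.s_J _ _ _).symm
  refine (hD.t_br' (ext2 D.br₁ (one k H f) (one k H g)) (one k H h) (Hm.assoc k H H H H)).trans ?_
  rw [hD.t_ext2, BC.map_one, BC.map_one, BC.map_one, nestL]

lemma nat₂ (hD : D.IsGraph) (f g h : D.C₁) :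
    D.E3.t (D.J (D.cat.s f) (D.cat.s g) (D.cat.s h)) =
      D.E3.s (nestR D.br₁ D.br₁ (one k H f) (one k H g) (one k H h) -
        nestM D.br₁ D.br₁ (one k H f) (one k H g) (one k H h)) := by
  refine (hD.t_J _ _ _).trans (Eq.symm ((BC.map_sub _ _ _).trans (congrArg₂ (· - ·) ?_ ?_)))
  · refine (hD.s_ext2 (one k H f) (ext2 D.br₁ (one k H g) (one k H h))).trans ?_
    rw [hD.s_ext2, BC.map_one, BC.map_one, BC.map_one, nestR]
  · refine (hD.s_br' (one k H g) (ext2 D.br₁ (one k H f) (one k H h))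
      (Hm.swap12 k H H H H)).trans ?_
    rw [hD.s_ext2, BC.map_one, BC.map_one, BC.map_one, nestM]

end IsGraph

/-- One side of the coherence law of the Jacobiator. -/
def IsGraph.hexL (hD : D.IsGraph) (x y z w : BC k H H D.C₀) :
    BC k H (H ⊗[k] (H ⊗[k] (H ⊗[k] H))) D.C₁ :=
  D.E4.comp (D.E4.comp (D.hexL1 x y z w) (D.hexL2 x y z w) (hD.hexL12 x y z w))
    (D.hexL3 x y z w) ((D.E4.t_comp' _ _ _).trans (hD.hexL23 x y z w))

/-- The other side of the coherence law of the Jacobiator. -/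
def IsGraph.hexR (hD : D.IsGraph) (x y z w : BC k H H D.C₀) :
    BC k H (H ⊗[k] (H ⊗[k] (H ⊗[k] H))) D.C₁ :=
  D.E4.comp (D.E4.comp (D.hexR1 x y z w) (D.hexR2 x y z w) (hD.hexR12 x y z w))
    (D.hexR3 x y z w) ((D.E4.t_comp' _ _ _).trans (hD.hexR23 x y z w))

variable (D) in
/-- The axioms of a Lie-2 `H`-pseudoalgebra. -/
structure IsLie2 : Prop extends D.IsGraph where
  /-- the pseudobracket preserves identities -/
  br_id : ∀ x y, D.br₁ (D.cat.i x) (D.cat.i y) = D.E2.i (D.br₀ x y)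
  /-- the pseudobracket preserves composition -/
  br_comp : ∀ (f f' g g' : D.C₁) (e : D.cat.t f = D.cat.s f') (e' : D.cat.t g = D.cat.s g'),
    D.br₁ (D.cat.comp f f' e) (D.cat.comp g g' e') =
      D.E2.comp (D.br₁ f g) (D.br₁ f' g') (toIsGraph.t_br_comp f f' g g' e e')
  /-- the pseudobracket is skew-symmetric on objects -/
  skew₀ : D.br₀.IsSkew
  /-- the pseudobracket is skew-symmetric on arrows -/
  skew₁ : D.br₁.IsSkew
  /-- the Jacobiator is natural -/
  J_nat : ∀ f g h : D.C₁,
    D.E3.comp (nestL D.br₁ D.br₁ (one k H f) (one k H g) (one k H h))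
        (D.J (D.cat.t f) (D.cat.t g) (D.cat.t h)) (toIsGraph.nat₁ f g h) =
      D.E3.comp (D.J (D.cat.s f) (D.cat.s g) (D.cat.s h))
        (nestR D.br₁ D.br₁ (one k H f) (one k H g) (one k H h) -
          nestM D.br₁ D.br₁ (one k H f) (one k H g) (one k H h)) (toIsGraph.nat₂ f g h)
  /-- the Jacobiator is an isomorphism -/
  J_iso : ∀ x y z, D.E3.IsIso (D.J x y z)
  /-- the Jacobiator is skew-symmetric in the first two arguments -/
  J_skew₁₂ : ∀ x y z,
    D.E3.arrow (D.J y x z) = -BC.push (Hm.swap12 k H H H H) (D.E3.arrow (D.J x y z))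
  /-- the Jacobiator is skew-symmetric in the last two arguments -/
  J_skew₂₃ : ∀ x y z,
    D.E3.arrow (D.J x z y) = -BC.push (Hm.swap23 k H H H H) (D.E3.arrow (D.J x y z))
  /-- the coherence law of the Jacobiator -/
  hexagon : ∀ x y z w : D.C₀,
    toIsGraph.hexL (one k H x) (one k H y) (one k H z) (one k H w) =
      toIsGraph.hexR (one k H x) (one k H y) (one k H z) (one k H w)

end

/-- The data of a homomorphism of Lie-2 `H`-pseudoalgebras. -/
@[ext]
structure HomData (D D' : Lie2Data.{w, u, v} k H) where
  /-- the functor on objects -/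
  F₀ : D.C₀ →ₗ[H] D'.C₀
  /-- the functor on arrows -/
  F₁ : D.C₁ →ₗ[H] D'.C₁
  /-- the transformation `[F₀ x * F₀ y] → F₀ [x * y]` -/
  F₂ : Poly2 k H D.C₀ D.C₀ D'.C₁

variable {D D' : Lie2Data.{w, u, v} k H}

/-- Sources and targets: `(F₀, F₁)` is a morphism of graphs, and `F₂ x y` is an arrow
`[F₀ x * F₀ y] → F₀ [x * y]`. -/
structure IsGraphHom (F : HomData D D') : Prop where
  s_F : ∀ f, D'.cat.s (F.F₁ f) = F.F₀ (D.cat.s f)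
  t_F : ∀ f, D'.cat.t (F.F₁ f) = F.F₀ (D.cat.t f)
  s_F₂ : ∀ x y, D'.E2.s (F.F₂ x y) = D'.br₀ (F.F₀ x) (F.F₀ y)
  t_F₂ : ∀ x y, D'.E2.t (F.F₂ x y) = BC.map k _ F.F₀ (D.br₀ x y)

namespace HomData

variable (F : HomData D D')

/-! The arrows in the coherence diagram of a homomorphism, for three objects `x, y, z` of categories
`A ⊗_H C`. -/

section

variable (x : BC k H A D.C₀) (y : BC k H B D.C₀) (z : BC k H C D.C₀)

/-- `F₀ x` -/
abbrev ob (x : BC k H A D.C₀) : BC k H A D'.C₀ := BC.map k A F.F₀ x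

/-- `[F₂ (x, y) * F₀ z] : [[F₀ x * F₀ y] * F₀ z] → [F₀ [x * y] * F₀ z]` -/
def cohL1 : BC k H (A ⊗[k] (B ⊗[k] C)) D'.C₁ := nestL D'.br₁ F.F₂ x y (D'.idn (F.ob z))

/-- `F₂ ([x * y], z) : [F₀ [x * y] * F₀ z] → F₀ [[x * y] * z]` -/
def cohL2 : BC k H (A ⊗[k] (B ⊗[k] C)) D'.C₁ := nestL F.F₂ D.br₀ x y z

/-- `F₁ J_{x,y,z} : F₀ [[x * y] * z] → F₀ [x * [y * z]] - F₀ [y * [x * z]]` -/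
def cohL3 : BC k H (A ⊗[k] (B ⊗[k] C)) D'.C₁ := BC.map k _ F.F₁ (ext3 D.J x y z)

/-- `J'_{F₀ x, F₀ y, F₀ z}` -/
def cohR1 : BC k H (A ⊗[k] (B ⊗[k] C)) D'.C₁ := ext3 D'.J (F.ob x) (F.ob y) (F.ob z)

/-- `[F₀ x * F₂ (y, z)] - [F₀ y * F₂ (x, z)]` -/
def cohR2 : BC k H (A ⊗[k] (B ⊗[k] C)) D'.C₁ :=
  nestR D'.br₁ F.F₂ (D'.idn (F.ob x)) y z - nestM D'.br₁ F.F₂ x (D'.idn (F.ob y)) z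

/-- `F₂ (x, [y * z]) - F₂ (y, [x * z])` -/
def cohR3 : BC k H (A ⊗[k] (B ⊗[k] C)) D'.C₁ :=
  nestR F.F₂ D.br₀ x y z - nestM F.F₂ D.br₀ x y z

end

end HomData

namespace IsGraphHom

variable {F : HomData D D'}

lemma s_F₂' (hF : IsGraphHom F) (p : BC k H A D.C₀) (q : BC k H B D.C₀) :
    BC.map k _ D'.cat.s (ext2 F.F₂ p q) = ext2 D'.br₀ (F.ob p) (F.ob q) :=
  map_ext2 (β := F.F₂) (β' := D'.br₀) (φ := F.F₀) (ψ := F.F₀) (χ := D'.cat.s) hF.s_F₂ p q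

lemma t_F₂' (hF : IsGraphHom F) (p : BC k H A D.C₀) (q : BC k H B D.C₀) :
    BC.map k _ D'.cat.t (ext2 F.F₂ p q) = F.ob (ext2 D.br₀ p q) :=
  map_ext2_map (β := F.F₂) (β' := D.br₀) (χ := D'.cat.t) (χ' := F.F₀) hF.t_F₂ p q

lemma s_F' (hF : IsGraphHom F) (p : BC k H A D.C₁) :
    BC.map k _ D'.cat.s (BC.map k _ F.F₁ p) = F.ob (BC.map k _ D.cat.s p) :=
  (BC.map_map _ _ _).trans ((BC.map_congr hF.s_F p).trans (BC.map_map _ _ _).symm)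

lemma t_F' (hF : IsGraphHom F) (p : BC k H A D.C₁) :
    BC.map k _ D'.cat.t (BC.map k _ F.F₁ p) = F.ob (BC.map k _ D.cat.t p) :=
  (BC.map_map _ _ _).trans ((BC.map_congr hF.t_F p).trans (BC.map_map _ _ _).symm)

lemma comp_F (hF : IsGraphHom F) (f g : D.C₁) (e : D.cat.t f = D.cat.s g) :
    D'.cat.t (F.F₁ f) = D'.cat.s (F.F₁ g) := by rw [hF.t_F, hF.s_F, e]

lemma nat₁ (hF : IsGraphHom F) (hD' : D'.IsGraph) (f g : D.C₁) :
    D'.E2.t (D'.br₁ (F.F₁ f) (F.F₁ g)) = D'.E2.s (F.F₂ (D.cat.t f) (D.cat.t g)) := by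
  rw [hD'.t_br, hF.s_F₂, hF.t_F, hF.t_F]

lemma nat₂ (hF : IsGraphHom F) (hD : D.IsGraph) (f g : D.C₁) :
    D'.E2.t (F.F₂ (D.cat.s f) (D.cat.s g)) = D'.E2.s (BC.map k _ F.F₁ (D.br₁ f g)) := by
  refine (hF.t_F₂ _ _).trans (Eq.symm ((hF.s_F' (D.br₁ f g)).trans ?_))
  exact congrArg _ (hD.s_br f g)

variable (x : BC k H A D.C₀) (y : BC k H B D.C₀) (z : BC k H C D.C₀)

lemma cohL12 (hF : IsGraphHom F) (hD' : D'.IsGraph) :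
    (D'.cat.bc k _).t (F.cohL1 x y z) = (D'.cat.bc k _).s (F.cohL2 x y z) := by
  refine (hD'.t_br' (ext2 F.F₂ x y) (D'.idn (F.ob z)) (Hm.assoc k H A B C)).trans ?_
  rw [hF.t_F₂', D'.t_idn]
  refine Eq.symm ((BC.push_map' _ _ _).trans ?_)
  rw [hF.s_F₂']

lemma cohL23 (hF : IsGraphHom F) (hD : D.IsGraph) :
    (D'.cat.bc k _).t (F.cohL2 x y z) = (D'.cat.bc k _).s (F.cohL3 x y z) := by
  refine Eq.trans ?_ (hF.s_F' (ext3 D.J x y z)).symm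
  rw [hD.s_ext3 x y z]
  refine (BC.push_map' _ _ _).trans ?_
  rw [hF.t_F₂']
  exact BC.push_map _ _ _

lemma cohR12 (hF : IsGraphHom F) (hD' : D'.IsGraph) :
    (D'.cat.bc k _).t (F.cohR1 x y z) = (D'.cat.bc k _).s (F.cohR2 x y z) := by
  refine (hD'.t_ext3 _ _ _).trans (Eq.symm ((BC.map_sub _ _ _).trans (congrArg₂ (· - ·) ?_ ?_)))
  · refine (hD'.s_ext2 (D'.idn (F.ob x)) (ext2 F.F₂ y z)).trans ?_
    rw [hF.s_F₂', D'.s_idn, nestR]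
  · refine (hD'.s_br' (D'.idn (F.ob y)) (ext2 F.F₂ x z) (Hm.swap12 k H B A C)).trans ?_
    rw [hF.s_F₂', D'.s_idn, nestM]

lemma cohR23 (hF : IsGraphHom F) (hD' : D'.IsGraph) :
    (D'.cat.bc k _).t (F.cohR2 x y z) = (D'.cat.bc k _).s (F.cohR3 x y z) := by
  refine (BC.map_sub _ _ _).trans (Eq.symm ((BC.map_sub _ _ _).trans (congrArg₂ (· - ·) ?_ ?_)))
  · refine Eq.symm ((hD'.t_ext2 (D'.idn (F.ob x)) (ext2 F.F₂ y z)).trans ?_)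
    rw [hF.t_F₂', D'.t_idn]
    exact (hF.s_F₂' x (ext2 D.br₀ y z)).symm
  · refine Eq.symm ((hD'.t_br' (D'.idn (F.ob y)) (ext2 F.F₂ x z) (Hm.swap12 k H B A C)).trans ?_)
    rw [hF.t_F₂', D'.t_idn]
    refine Eq.symm ((BC.push_map' _ _ _).trans ?_)
    rw [hF.s_F₂']

/-- One side of the compatibility with the Jacobiators. -/
def cohL (hF : IsGraphHom F) (hD : D.IsGraph) (hD' : D'.IsGraph) (x y z : BC k H H D.C₀) :
    BC k H (H ⊗[k] (H ⊗[k] H)) D'.C₁ :=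
  D'.E3.comp (D'.E3.comp (F.cohL1 x y z) (F.cohL2 x y z) (hF.cohL12 x y z hD'))
    (F.cohL3 x y z) ((D'.E3.t_comp' _ _ _).trans (hF.cohL23 x y z hD))

/-- The other side of the compatibility with the Jacobiators. -/
def cohR (hF : IsGraphHom F) (hD' : D'.IsGraph) (x y z : BC k H H D.C₀) :
    BC k H (H ⊗[k] (H ⊗[k] H)) D'.C₁ :=
  D'.E3.comp (D'.E3.comp (F.cohR1 x y z) (F.cohR2 x y z) (hF.cohR12 x y z hD'))
    (F.cohR3 x y z) ((D'.E3.t_comp' _ _ _).trans (hF.cohR23 x y z hD'))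

end IsGraphHom

/-- The axioms of a homomorphism of Lie-2 `H`-pseudoalgebras. -/
structure IsHom (hD : D.IsGraph) (hD' : D'.IsGraph) (F : HomData D D') : Prop extends
    IsGraphHom F where
  F_id : ∀ x, F.F₁ (D.cat.i x) = D'.cat.i (F.F₀ x)
  F_comp : ∀ (f g : D.C₁) (e : D.cat.t f = D.cat.s g),
    F.F₁ (D.cat.comp f g e) = D'.cat.comp (F.F₁ f) (F.F₁ g) (toIsGraphHom.comp_F f g e)
  /-- the transformation `F₂` is natural -/
  F₂_nat : ∀ f g : D.C₁,
    D'.E2.comp (D'.br₁ (F.F₁ f) (F.F₁ g)) (F.F₂ (D.cat.t f) (D.cat.t g))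
        (toIsGraphHom.nat₁ hD' f g) =
      D'.E2.comp (F.F₂ (D.cat.s f) (D.cat.s g)) (BC.map k _ F.F₁ (D.br₁ f g))
        (toIsGraphHom.nat₂ hD f g)
  /-- the transformation `F₂` is an isomorphism -/
  F₂_iso : ∀ x y, D'.E2.IsIso (F.F₂ x y)
  /-- the transformation `F₂` is skew-symmetric -/
  F₂_skew : F.F₂.IsSkew
  /-- compatibility with the Jacobiators -/
  coh : ∀ x y z : D.C₀, toIsGraphHom.cohL hD hD' (one k H x) (one k H y) (one k H z) =
    toIsGraphHom.cohR hD' (one k H x) (one k H y) (one k H z)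

end Lie2Data

end

section

open BC (one)

/-! ### The category of 2-term `L_∞` pseudoalgebras -/

instance : Add (Poly2 k H L M N) :=
  ⟨fun β β' =>
    { toFun := fun x y => β x y + β' x y
      add_left := fun x x' y => by rw [β.add_left, β'.add_left, add_add_add_comm]
      add_right := fun x y y' => by rw [β.add_right, β'.add_right, add_add_add_comm]
      smul := fun f g x y => by rw [β.smul, β'.smul, smul_add] }⟩

instance : Zero (Poly2 k H L M N) :=
  ⟨{  toFun := fun _ _ => 0
      add_left := fun _ _ _ => (add_zero _).symm
      add_right := fun _ _ _ => (add_zero _).symm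
      smul := fun _ _ _ _ => (smul_zero _).symm }⟩

lemma ext2_add_hom (β β' : Poly2 k H L M N) (p : BC k H A L) (q : BC k H B M) :
    ext2 (β + β') p q = ext2 β p q + ext2 β' p q := by
  refine DFunLike.congr_fun (DFunLike.congr_fun (BC.hom_ext2 (F := ext2 (β + β'))
    (G := ext2 β + ext2 β') fun a x b y => ?_) p) q
  refine (ext2_mk _ _ _ _ _).trans (Eq.trans ?_
    (congrArg₂ (· + ·) (ext2_mk _ _ _ _ _) (ext2_mk _ _ _ _ _)).symm)
  exact (congrArg _ (map_add _ _ _)).trans (smul_add _ _ _)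

lemma ext2_zero_hom (p : BC k H A L) (q : BC k H B M) :
    ext2 (0 : Poly2 k H L M N) p q = 0 := by
  refine DFunLike.congr_fun (DFunLike.congr_fun (BC.hom_ext2 (F := ext2 (0 : Poly2 k H L M N))
    (G := 0) fun a x b y => ?_) p) q
  refine (ext2_mk _ _ _ _ _).trans ?_
  exact (congrArg _ (map_zero _)).trans (smul_zero _)

namespace TwoTermData

variable [Coalgebra.IsCocomm k H] {T T' T'' : TwoTermData.{w, u, v} k H}

/-- The identity -/
def HomData.id (T : TwoTermData.{w, u, v} k H) : HomData T T := ⟨LinearMap.id, LinearMap.id, 0⟩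

/-- The composite of `f` and `g`, with `(g f)₂ (x, y) = g₂ (f₀ x, f₀ y) + g₁ f₂ (x, y)` -/
def HomData.comp (f : HomData T T') (g : HomData T' T'') : HomData T T'' :=
  ⟨g.f₀ ∘ₗ f.f₀, g.f₁ ∘ₗ f.f₁, g.f₂.pre f.f₀ f.f₀ + f.f₂.post g.f₁⟩

lemma IsHom.id (T : TwoTermData.{w, u, v} k H) : IsHom (HomData.id T) where
  skew x y := by
    change 0 = -BC.push _ 0
    rw [map_zero, neg_zero]
  ax1 u := rfl
  ax2 x y := by
    change BC.map k _ LinearMap.id _ - T.b₀₀ x y = BC.map k _ T.d 0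
    rw [BC.map_id, sub_self, map_zero]
  ax3 x u := by
    change BC.map k _ LinearMap.id _ - T.b₀₁ x u = 0
    rw [BC.map_id, sub_self]
  ax4 x y z := by
    change nestL T.b₁₀ (0 : Poly2 k H T.L₀ T.L₀ T.L₁) (one k H x) (one k H y) (one k H z)
      - nestR T.b₀₁ (0 : Poly2 k H T.L₀ T.L₀ T.L₁) (one k H x) (one k H y) (one k H z)
      + nestM T.b₀₁ (0 : Poly2 k H T.L₀ T.L₀ T.L₁) (one k H x) (one k H y) (one k H z)
      + nestL (0 : Poly2 k H T.L₀ T.L₀ T.L₁) T.b₀₀ (one k H x) (one k H y) (one k H z)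
      - nestR (0 : Poly2 k H T.L₀ T.L₀ T.L₁) T.b₀₀ (one k H x) (one k H y) (one k H z)
      + nestM (0 : Poly2 k H T.L₀ T.L₀ T.L₁) T.b₀₀ (one k H x) (one k H y) (one k H z)
      = T.b₃ x y z - BC.map k _ LinearMap.id (T.b₃ x y z)
    rw [BC.map_id, sub_self, nestL, nestR, nestM, nestL, nestR, nestM, ext2_zero_hom,
      ext2_zero_hom, ext2_zero_hom, ext2_zero_hom, ext2_zero_hom, ext2_zero_hom, map_zero, map_zero,
      map_zero, map_zero, map_zero, AddMonoidHom.zero_apply, map_zero]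
    simp only [add_zero, sub_zero]

lemma HomData.ext2_comp (f : HomData T T') (g : HomData T' T'') (p : BC k H A T.L₀)
    (q : BC k H B T.L₀) : ext2 (f.comp g).f₂ p q =
      ext2 g.f₂ (BC.map k A f.f₀ p) (BC.map k B f.f₀ q) + BC.map k _ g.f₁ (ext2 f.f₂ p q) :=
  (ext2_add_hom _ _ p q).trans (congrArg₂ (· + ·) (ext2_pre _ _ _ _ _) (ext2_post _ _ _ _))

namespace IsHom

variable {f : HomData T T'} {g : HomData T' T''}

lemma ext_ax2 (hf : IsHom f) (p : BC k H A T.L₀) (q : BC k H B T.L₀) :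
    BC.map k _ T'.d (ext2 f.f₂ p q) = BC.map k _ f.f₀ (ext2 T.b₀₀ p q) -
      ext2 T'.b₀₀ (BC.map k A f.f₀ p) (BC.map k B f.f₀ q) := by
  have e : f.f₂.post T'.d + T'.b₀₀.pre f.f₀ f.f₀ = T.b₀₀.post f.f₀ := by
    ext x y
    exact eq_sub_iff_add_eq.1 (hf.ax2 x y).symm
  have e' := DFunLike.congr_fun (DFunLike.congr_fun (congrArg ext2 e) p) q
  rw [ext2_add_hom, ext2_post, ext2_post, ext2_pre] at e'
  exact eq_sub_of_add_eq e'

lemma ext_ax3 (hf : IsHom f) (p : BC k H A T.L₀) (q : BC k H B T.L₁) :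
    ext2 T'.b₀₁ (BC.map k A f.f₀ p) (BC.map k B f.f₁ q) = BC.map k _ f.f₁ (ext2 T.b₀₁ p q) -
      ext2 f.f₂ p (BC.map k B T.d q) := by
  have e : T'.b₀₁.pre f.f₀ f.f₁ + f.f₂.pre LinearMap.id T.d = T.b₀₁.post f.f₁ := by
    ext x y
    exact (add_comm _ _).trans (eq_sub_iff_add_eq.1 (hf.ax3 x y).symm)
  have e' := DFunLike.congr_fun (DFunLike.congr_fun (congrArg ext2 e) p) q
  rw [ext2_add_hom, ext2_post, ext2_pre, ext2_pre, BC.map_id] at e'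
  exact eq_sub_of_add_eq e'

lemma ax3' (hf : IsHom f) (u : T.L₁) (x : T.L₀) :
    BC.map k _ f.f₁ (T.b₁₀ u x) - T'.b₁₀ (f.f₁ u) (f.f₀ x) = f.f₂ (T.d u) x := by
  rw [hf.skew x (T.d u), ← hf.ax3 x u, map_sub, BC.push_map]
  change BC.map k _ f.f₁ (-_) - -_ = _
  rw [map_neg, neg_sub_neg, neg_sub]

lemma ext_ax3' (hf : IsHom f) (p : BC k H A T.L₁) (q : BC k H B T.L₀) :
    ext2 T'.b₁₀ (BC.map k A f.f₁ p) (BC.map k B f.f₀ q) = BC.map k _ f.f₁ (ext2 T.b₁₀ p q) -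
      ext2 f.f₂ (BC.map k A T.d p) q := by
  have e : T'.b₁₀.pre f.f₁ f.f₀ + f.f₂.pre T.d LinearMap.id = T.b₁₀.post f.f₁ := by
    ext x y
    exact (add_comm _ _).trans (eq_sub_iff_add_eq.1 (hf.ax3' x y).symm)
  have e' := DFunLike.congr_fun (DFunLike.congr_fun (congrArg ext2 e) p) q
  rw [ext2_add_hom, ext2_post, ext2_pre, ext2_pre, BC.map_id] at e'
  exact eq_sub_of_add_eq e'

end IsHom

/-- The terms in the coherence law of a homomorphism -/
def HomData.UL (f : HomData T T') (p : BC k H A T.L₀)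
    (q : BC k H B T.L₀) (r : BC k H C T.L₀) : BC k H ((A ⊗[k] B) ⊗[k] C) T'.L₁ :=
  ext2 T'.b₁₀ (ext2 f.f₂ p q) (BC.map k C f.f₀ r) + ext2 f.f₂ (ext2 T.b₀₀ p q) r

/-- The terms in the coherence law of a homomorphism -/
def HomData.UR (f : HomData T T') (p : BC k H A T.L₀)
    (q : BC k H B T.L₀) (r : BC k H C T.L₀) : BC k H (A ⊗[k] (B ⊗[k] C)) T'.L₁ :=
  ext2 T'.b₀₁ (BC.map k A f.f₀ p) (ext2 f.f₂ q r) + ext2 f.f₂ p (ext2 T.b₀₀ q r)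

namespace IsHom

variable {f : HomData T T'} {g : HomData T' T''}

lemma compL (hf : IsHom f) (hg : IsHom g) (p : BC k H A T.L₀) (q : BC k H B T.L₀)
    (r : BC k H C T.L₀) : (f.comp g).UL p q r =
      g.UL (BC.map k A f.f₀ p) (BC.map k B f.f₀ q) (BC.map k C f.f₀ r) +
      BC.map k _ g.f₁ (f.UL p q r) := by
  have e : BC.map k C (f.comp g).f₀ r = BC.map k C g.f₀ (BC.map k C f.f₀ r) :=
    (BC.map_map _ _ _).symm
  rw [HomData.UL, HomData.UL, HomData.UL, e, f.ext2_comp g p q, f.ext2_comp g (ext2 T.b₀₀ p q) r,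
    ext2_add_left T''.b₁₀, hg.ext_ax3' (ext2 f.f₂ p q) (BC.map k C f.f₀ r), hf.ext_ax2 p q,
    ext2_sub_left g.f₂, BC.map_add]
  abel

lemma compR (hf : IsHom f) (hg : IsHom g) (p : BC k H A T.L₀) (q : BC k H B T.L₀)
    (r : BC k H C T.L₀) : (f.comp g).UR p q r =
      g.UR (BC.map k A f.f₀ p) (BC.map k B f.f₀ q) (BC.map k C f.f₀ r) +
      BC.map k _ g.f₁ (f.UR p q r) := by
  have e : BC.map k A (f.comp g).f₀ p = BC.map k A g.f₀ (BC.map k A f.f₀ p) :=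
    (BC.map_map _ _ _).symm
  rw [HomData.UR, HomData.UR, HomData.UR, e, f.ext2_comp g q r, f.ext2_comp g p (ext2 T.b₀₀ q r),
    ext2_add_right T''.b₀₁, hg.ext_ax3 (BC.map k A f.f₀ p) (ext2 f.f₂ q r), hf.ext_ax2 q r,
    ext2_sub_right g.f₂, BC.map_add]
  abel

lemma aux {X : Type*} [AddCommGroup X] (a b c a' b' c' : X) :
    a + a' - (b + b') + (c + c') = a - b + c + (a' - b' + c') := by abel

lemma aux' {X : Type*} [AddCommGroup X] (a b c a' b' c' : X) :
    a + a' - (b + b') + (c + c') = a - b + c + a' - b' + c' := by abel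

lemma ax4_iff (f : HomData T T') (x y z : T.L₀) :
    (nestL T'.b₁₀ f.f₂ (one k H x) (one k H y) (one k H (f.f₀ z))
    - nestR T'.b₀₁ f.f₂ (one k H (f.f₀ x)) (one k H y) (one k H z)
    + nestM T'.b₀₁ f.f₂ (one k H x) (one k H (f.f₀ y)) (one k H z)
    + nestL f.f₂ T.b₀₀ (one k H x) (one k H y) (one k H z)
    - nestR f.f₂ T.b₀₀ (one k H x) (one k H y) (one k H z)
    + nestM f.f₂ T.b₀₀ (one k H x) (one k H y) (one k H z)
    = T'.b₃ (f.f₀ x) (f.f₀ y) (f.f₀ z) - BC.map k _ f.f₁ (T.b₃ x y z)) ↔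
    BC.push (Hm.assoc k H H H H) (f.UL (one k H x) (one k H y) (one k H z))
    - f.UR (one k H x) (one k H y) (one k H z)
    + BC.push (Hm.swap12 k H H H H) (f.UR (one k H y) (one k H x) (one k H z))
    = T'.b₃ (f.f₀ x) (f.f₀ y) (f.f₀ z) - BC.map k _ f.f₁ (T.b₃ x y z) := by
  have h1 : f.UL (one k H x) (one k H y) (one k H z) =
      ext2 T'.b₁₀ (ext2 f.f₂ (one k H x) (one k H y)) (one k H (f.f₀ z)) +
      ext2 f.f₂ (ext2 T.b₀₀ (one k H x) (one k H y)) (one k H z) := by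
    rw [HomData.UL, BC.map_one f.f₀ z]
  have h2 : ∀ x y, f.UR (one k H x) (one k H y) (one k H z) =
      ext2 T'.b₀₁ (one k H (f.f₀ x)) (ext2 f.f₂ (one k H y) (one k H z)) +
      ext2 f.f₂ (one k H x) (ext2 T.b₀₀ (one k H y) (one k H z)) := by
    intro x y
    rw [HomData.UR, BC.map_one f.f₀ x]
  rw [h1, h2 x y, h2 y x]
  refine Eq.congr (Eq.symm ((congrArg₂ (· + ·) (congrArg (· - _) (BC.push_add _ _ _))
    (BC.push_add _ _ _)).trans ?_)) rfl
  exact aux' _ _ _ _ _ _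

lemma comp (hf : IsHom f) (hg : IsHom g) : IsHom (f.comp g) where
  skew x y := by
    change g.f₂ (f.f₀ y) (f.f₀ x) + BC.map k _ g.f₁ (f.f₂ y x) =
      -BC.push _ (g.f₂ (f.f₀ x) (f.f₀ y) + BC.map k _ g.f₁ (f.f₂ x y))
    rw [hg.skew (f.f₀ x) (f.f₀ y), hf.skew x y, map_neg, ← BC.push_map, BC.push_add, neg_add]
  ax1 u := by
    change g.f₀ (f.f₀ (T.d u)) = T''.d (g.f₁ (f.f₁ u))
    rw [hf.ax1, hg.ax1]
  ax2 x y := by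
    change BC.map k _ (g.f₀ ∘ₗ f.f₀) (T.b₀₀ x y) - T''.b₀₀ (g.f₀ (f.f₀ x)) (g.f₀ (f.f₀ y)) =
      BC.map k _ T''.d (g.f₂ (f.f₀ x) (f.f₀ y) + BC.map k _ g.f₁ (f.f₂ x y))
    have e : BC.map k _ T''.d (BC.map k _ g.f₁ (f.f₂ x y)) =
        BC.map k _ g.f₀ (BC.map k _ T'.d (f.f₂ x y)) :=
      (BC.map_map _ _ _).trans ((BC.map_congr (fun u => (hg.ax1 u).symm) _).trans
        (BC.map_map _ _ _).symm)
    rw [BC.map_add, e, ← hg.ax2, ← hf.ax2, BC.map_sub, BC.map_map]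
    abel
  ax3 x u := by
    change BC.map k _ (g.f₁ ∘ₗ f.f₁) (T.b₀₁ x u) - T''.b₀₁ (g.f₀ (f.f₀ x)) (g.f₁ (f.f₁ u)) =
      g.f₂ (f.f₀ x) (f.f₀ (T.d u)) + BC.map k _ g.f₁ (f.f₂ x (T.d u))
    rw [← hf.ax3, hf.ax1, ← hg.ax3, BC.map_sub, BC.map_map]
    abel
  ax4 x y z := by
    have c1 := hf.compL hg (one k H x) (one k H y) (one k H z)
    have c2 := hf.compR hg (one k H x) (one k H y) (one k H z)
    have c3 := hf.compR hg (one k H y) (one k H x) (one k H z)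
    rw [BC.map_one, BC.map_one, BC.map_one] at c1 c2 c3
    replace c1 := (congrArg (BC.push (Hm.assoc k H H H H)) c1).trans ((BC.push_add _ _ _).trans
      (congrArg (_ + ·) (BC.push_map _ _ _)))
    replace c3 := (congrArg (BC.push (Hm.swap12 k H H H H)) c3).trans ((BC.push_add _ _ _).trans
      (congrArg (_ + ·) (BC.push_map _ _ _)))
    refine (ax4_iff (f.comp g) x y z).2 ((congrArg₂ (· + ·) (congrArg₂ (· - ·) c1 c2) c3).trans ?_)
    have e1 := (ax4_iff g (f.f₀ x) (f.f₀ y) (f.f₀ z)).1 (hg.ax4 _ _ _)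
    have e2 := congrArg (BC.map k (H ⊗[k] (H ⊗[k] H)) g.f₁) ((ax4_iff f x y z).1 (hf.ax4 _ _ _))
    have e3 : ∀ a b c d e : BC k H (H ⊗[k] (H ⊗[k] H)) T'.L₁,
        BC.map k _ g.f₁ (a - b + c) = BC.map k _ g.f₁ (d - e) →
        BC.map k _ g.f₁ a - BC.map k _ g.f₁ b + BC.map k _ g.f₁ c =
          BC.map k _ g.f₁ d - BC.map k _ g.f₁ e := by
      intro a b c d e h
      rw [← BC.map_sub, ← BC.map_sub, ← BC.map_add]
      exact h
    replace e2 := (e3 _ _ _ _ _ e2).trans (congrArg (_ - ·) (BC.map_map _ _ _))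
    refine (aux _ _ _ _ _ _).trans ((congrArg₂ (· + ·) e1 e2).trans ?_)
    exact sub_add_sub_cancel _ _ _

end IsHom

end TwoTermData

section

variable (k : Type w) [Field k] (H : Type u) [Ring H] [HopfAlgebra k H] [Coalgebra.IsCocomm k H]

/-- The 2-term `L_∞` `H`-pseudoalgebras. -/
structure TwoTerm extends TwoTermData.{w, u, v} k H where
  ax : toTwoTermData.IsTwoTerm

end

namespace TwoTerm

variable [Coalgebra.IsCocomm k H]

/-- Homomorphisms of 2-term `L_∞` `H`-pseudoalgebras. -/
@[ext]
structure Hom (T T' : TwoTerm.{w, u, v} k H) extends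
    TwoTermData.HomData T.toTwoTermData T'.toTwoTermData where
  isHom : TwoTermData.IsHom toHomData

lemma Hom.ext' {T T' : TwoTerm.{w, u, v} k H} {f g : Hom T T'}
    (h : f.toHomData = g.toHomData) : f = g := by
  cases f
  cases g
  cases h
  rfl

/-- The category of 2-term `L_∞` `H`-pseudoalgebras. -/
instance : CategoryTheory.Category (TwoTerm.{w, u, v} k H) where
  Hom := Hom
  id T := ⟨.id _, .id _⟩
  comp f g := ⟨f.toHomData.comp g.toHomData, f.isHom.comp g.isHom⟩
  id_comp {T T'} f := by
    refine Hom.ext ?_ ?_ ?_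
    · rfl
    · rfl
    · ext x y
      change f.f₂ x y + BC.map k _ f.f₁ 0 = f.f₂ x y
      rw [map_zero, add_zero]
  comp_id {T T'} f := by
    refine Hom.ext ?_ ?_ ?_
    · rfl
    · rfl
    · ext x y
      change 0 + BC.map k _ LinearMap.id (f.f₂ x y) = f.f₂ x y
      rw [BC.map_id, zero_add]
  assoc {T T₁ T₂ T₃} f g h := by
    refine Hom.ext ?_ ?_ ?_
    · rfl
    · rfl
    · ext x y
      change h.f₂ (g.f₀ (f.f₀ x)) (g.f₀ (f.f₀ y)) +
          BC.map k _ (h.f₁) (g.f₂ (f.f₀ x) (f.f₀ y) + BC.map k _ g.f₁ (f.f₂ x y)) =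
        h.f₂ (g.f₀ (f.f₀ x)) (g.f₀ (f.f₀ y)) + BC.map k _ (h.f₁) (g.f₂ (f.f₀ x) (f.f₀ y)) +
          BC.map k _ (h.f₁ ∘ₗ g.f₁) (f.f₂ x y)
      rw [BC.map_add, BC.map_map, add_assoc]

end TwoTerm

end

section

open BC (one)

/-! ### The category of Lie-2 pseudoalgebras -/

namespace IntCat

variable {R : Type*} [Ring R] {C₀ C₁ : Type*} [AddCommGroup C₀] [Module R C₀]
  [AddCommGroup C₁] [Module R C₁]

lemma comp_congr (E : IntCat R C₀ C₁) {f f' g g' : C₁} (hf : f = f') (hg : g = g')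
    (e : E.t f = E.s g) (e' : E.t f' = E.s g') : E.comp f g e = E.comp f' g' e' := by
  subst hf hg
  rfl

lemma comp_add (E : IntCat R C₀ C₁) (f f' g g' : C₁) (e : E.t f = E.s g) (e' : E.t f' = E.s g')
    (e'' : E.t (f + f') = E.s (g + g')) :
    E.comp (f + f') (g + g') e'' = E.comp f g e + E.comp f' g' e' :=
  E.compMap.map_add ⟨(f, g), e⟩ ⟨(f', g'), e'⟩

lemma comp_smul (E : IntCat R C₀ C₁) (r : R) (f g : C₁) (e : E.t f = E.s g)
    (e'' : E.t (r • f) = E.s (r • g)) : E.comp (r • f) (r • g) e'' = r • E.comp f g e :=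
  E.compMap.map_smul r ⟨(f, g), e⟩

/-- `arrow` as a linear map -/
def pr (E : IntCat R C₀ C₁) : C₁ →ₗ[R] C₁ := LinearMap.id - E.i ∘ₗ E.s

lemma pr_apply (E : IntCat R C₀ C₁) (f : C₁) : E.pr f = f - E.i (E.s f) := rfl

lemma arrow_eq (E : IntCat R C₀ C₁) (f : C₁) : E.arrow f = E.pr f := rfl

lemma pr_comp (E : IntCat R C₀ C₁) (f g : C₁) (e : E.t f = E.s g) :
    E.pr (E.comp f g e) = E.pr f + E.pr g := by
  rw [pr_apply, E.s_comp', comp_eq, pr_apply, pr_apply, e]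
  abel

lemma ext_pr (E : IntCat R C₀ C₁) {f g : C₁} (h : E.s f = E.s g) : f = g ↔ E.pr f = E.pr g := by
  rw [pr_apply, pr_apply, h]
  exact sub_left_inj.symm

lemma s_pr (E : IntCat R C₀ C₁) (f : C₁) : E.s (E.pr f) = 0 := by
  rw [pr_apply, map_sub, E.s_i, sub_self]

lemma t_pr (E : IntCat R C₀ C₁) (f : C₁) : E.t (E.pr f) = E.t f - E.s f := by
  rw [pr_apply, map_sub, E.t_i]

lemma pr_i (E : IntCat R C₀ C₁) (x : C₀) : E.pr (E.i x) = 0 := by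
  rw [pr_apply, E.s_i, sub_self]

lemma bc_pr {C₀ C₁ : Type*} [AddCommGroup C₀] [Module H C₀] [AddCommGroup C₁] [Module H C₁]
    (E : IntCat H C₀ C₁) (x : BC k H A C₁) : (E.bc k A).pr x = BC.map k A E.pr x := by
  rw [pr_apply, bc_i, bc_s, BC.map_map, pr, BC.map_sub_hom, BC.map_id]

end IntCat

namespace Lie2Data

variable [Coalgebra.IsCocomm k H] {D D' D'' : Lie2Data.{w, u, v} k H}

variable (D) in
/-- The arrow part of `[1 * f]` -/
def a₀₁ : Poly2 k H D.C₀ D.C₁ D.C₁ := D.br₁.pre D.cat.i D.cat.pr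

variable (D) in
/-- The arrow part of `[f * 1]` -/
def a₁₀ : Poly2 k H D.C₁ D.C₀ D.C₁ := D.a₀₁.opp

variable (D) in
/-- The structure on the arrow parts -/
abbrev arr : TwoTermData.{w, u, v} k H where
  L₀ := D.C₀
  L₁ := D.C₁
  d := D.cat.t - D.cat.s
  b₀₀ := D.br₀
  b₀₁ := D.a₀₁
  b₃ := D.J.post D.cat.pr

/-- The homomorphism on the arrow parts -/
abbrev HomData.arr (F : HomData D D') : TwoTermData.HomData D.arr D'.arr :=
  ⟨F.F₀, F.F₁, F.F₂.post D'.cat.pr⟩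

lemma IsLie2.a₁₀_eq (hD : D.IsLie2) (f : D.C₁) (x : D.C₀) :
    D.a₁₀ f x = D.br₁ (D.cat.pr f) (D.cat.i x) := (hD.skew₁ _ _).symm

lemma IsLie2.pr_br_left (hD : D.IsLie2) (f : D.C₁) (x : D.C₀) :
    BC.map k _ D.cat.pr (D.br₁ f (D.cat.i x)) = D.a₁₀ f x := by
  rw [hD.a₁₀_eq, ← IntCat.bc_pr, IntCat.pr_apply]
  have e : D.br₁ f (D.cat.i x) = D.br₁ (D.cat.pr f) (D.cat.i x) +
      D.br₁ (D.cat.i (D.cat.s f)) (D.cat.i x) := by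
    rw [← D.br₁.add_left, IntCat.pr_apply, sub_add_cancel]
  have e' : (D.cat.bc k (H ⊗[k] H)).s (D.br₁ f (D.cat.i x)) = D.br₀ (D.cat.s f) x :=
    (hD.s_br f (D.cat.i x)).trans (by rw [D.cat.s_i])
  rw [e', sub_eq_iff_eq_add, e, hD.br_id]
  rfl

lemma IsLie2.pr_br_right (hD : D.IsLie2) (x : D.C₀) (f : D.C₁) :
    BC.map k _ D.cat.pr (D.br₁ (D.cat.i x) f) = D.a₀₁ x f := by
  rw [hD.skew₁ f (D.cat.i x), map_neg, ← BC.push_map, hD.pr_br_left, hD.a₁₀_eq, ← hD.skew₁]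
  rfl

lemma IsLie2.ext_pr_br_left (hD : D.IsLie2) (p : BC k H A D.C₁) (q : BC k H B D.C₀) :
    BC.map k _ D.cat.pr (ext2 D.br₁ p (D.idn q)) = ext2 D.a₁₀ p q := by
  have e : (D.br₁.pre LinearMap.id D.cat.i).post D.cat.pr = D.a₁₀ := by
    ext f x
    exact hD.pr_br_left f x
  rw [← e, ext2_post, ext2_pre, BC.map_id]
  rfl

lemma IsLie2.ext_pr_br_right (hD : D.IsLie2) (p : BC k H A D.C₀) (q : BC k H B D.C₁) :
    BC.map k _ D.cat.pr (ext2 D.br₁ (D.idn p) q) = ext2 D.a₀₁ p q := by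
  have e : (D.br₁.pre D.cat.i LinearMap.id).post D.cat.pr = D.a₀₁ := by
    ext f x
    exact hD.pr_br_right f x
  rw [← e, ext2_post, ext2_pre, BC.map_id]
  rfl

section Coh

variable {F : HomData D D'}

lemma IsLie2.a₁₀_pr (hD : D.IsLie2) (p : BC k H A D.C₁) (q : BC k H B D.C₀) :
    ext2 D.a₁₀ (BC.map k A D.cat.pr p) q = ext2 D.a₁₀ p q := by
  have e : D.a₁₀.pre D.cat.pr LinearMap.id = D.a₁₀ := by
    ext f x
    change D.a₁₀ (D.cat.pr f) x = D.a₁₀ f x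
    rw [hD.a₁₀_eq, hD.a₁₀_eq, D.cat.pr_apply (D.cat.pr f), D.cat.s_pr, map_zero, sub_zero]
  have e' := DFunLike.congr_fun (DFunLike.congr_fun (congrArg ext2 e) p) q
  rwa [ext2_pre, BC.map_id] at e'

lemma a₀₁_pr (p : BC k H A D.C₀) (q : BC k H B D.C₁) :
    ext2 D.a₀₁ p (BC.map k B D.cat.pr q) = ext2 D.a₀₁ p q := by
  have e : D.a₀₁.pre LinearMap.id D.cat.pr = D.a₀₁ := by
    ext x f
    change D.br₁ (D.cat.i x) (D.cat.pr (D.cat.pr f)) = D.br₁ (D.cat.i x) (D.cat.pr f)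
    rw [D.cat.pr_apply (D.cat.pr f), D.cat.s_pr, map_zero, sub_zero]
  have e' := DFunLike.congr_fun (DFunLike.congr_fun (congrArg ext2 e) p) q
  rwa [ext2_pre, BC.map_id] at e'

variable (x : BC k H A D.C₀) (y : BC k H B D.C₀) (z : BC k H C D.C₀)

lemma pr_cohL (hD' : D'.IsLie2) :
    (D'.cat.bc k _).pr (F.cohL1 x y z) + (D'.cat.bc k _).pr (F.cohL2 x y z) =
      BC.push (Hm.assoc k H A B C) (F.arr.UL x y z) := by
  rw [IntCat.bc_pr, IntCat.bc_pr]
  refine Eq.trans (congrArg₂ (· + ·) (BC.push_map' _ _ _) (BC.push_map' _ _ _))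
    ((BC.push_add _ _ _).symm.trans (congrArg _ ?_))
  rw [hD'.ext_pr_br_left (ext2 F.F₂ x y) (F.ob z), ← hD'.a₁₀_pr, ← ext2_post, ← ext2_post]
  rfl

lemma pr_cohR_aux (hD' : D'.IsLie2) :
    BC.map k _ D'.cat.pr (ext2 D'.br₁ (D'.idn (F.ob x)) (ext2 F.F₂ y z)) +
      BC.map k _ D'.cat.pr (ext2 F.F₂ x (ext2 D.br₀ y z)) = F.arr.UR x y z := by
  rw [hD'.ext_pr_br_right (F.ob x) (ext2 F.F₂ y z), ← a₀₁_pr, ← ext2_post, ← ext2_post]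
  rfl

lemma pr_cohR (hD' : D'.IsLie2) :
    (D'.cat.bc k _).pr (F.cohR2 x y z) + (D'.cat.bc k _).pr (F.cohR3 x y z) =
      F.arr.UR x y z - BC.push (Hm.swap12 k H B A C) (F.arr.UR y x z) := by
  rw [IntCat.bc_pr, IntCat.bc_pr]
  have r1 : BC.map k _ D'.cat.pr (F.cohR2 x y z) =
      BC.map k _ D'.cat.pr (ext2 D'.br₁ (D'.idn (F.ob x)) (ext2 F.F₂ y z)) -
      BC.push (Hm.swap12 k H B A C)
        (BC.map k _ D'.cat.pr (ext2 D'.br₁ (D'.idn (F.ob y)) (ext2 F.F₂ x z))) :=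
    (BC.map_sub _ _ _).trans (congrArg (_ - ·) (BC.push_map' _ _ _))
  have r2 : BC.map k _ D'.cat.pr (F.cohR3 x y z) =
      BC.map k _ D'.cat.pr (ext2 F.F₂ x (ext2 D.br₀ y z)) -
      BC.push (Hm.swap12 k H B A C) (BC.map k _ D'.cat.pr (ext2 F.F₂ y (ext2 D.br₀ x z))) :=
    (BC.map_sub _ _ _).trans (congrArg (_ - ·) (BC.push_map' _ _ _))
  exact (congrArg₂ (· + ·) r1 r2).trans ((sub_add_sub_comm _ _ _ _).trans
    (congrArg₂ (· - ·) (pr_cohR_aux x y z hD') ((BC.push_add _ _ _).symm.trans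
      (congrArg _ (pr_cohR_aux y x z hD')))))

lemma s_cohL1 (hD' : D'.IsGraph) (hF : IsGraphHom F) :
    (D'.cat.bc k _).s (F.cohL1 x y z) = (D'.cat.bc k _).s (F.cohR1 x y z) := by
  refine (hD'.s_br' (ext2 F.F₂ x y) (D'.idn (F.ob z)) (Hm.assoc k H A B C)).trans ?_
  rw [hF.s_F₂', D'.s_idn]
  exact (hD'.s_ext3 _ _ _).symm

lemma pr_F₁ (hF : IsGraphHom F) (hF' : ∀ x, F.F₁ (D.cat.i x) = D'.cat.i (F.F₀ x)) (f : D.C₁) :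
    D'.cat.pr (F.F₁ f) = F.F₁ (D.cat.pr f) := by
  rw [IntCat.pr_apply, IntCat.pr_apply, map_sub, hF', hF.s_F]

lemma pr_map_F₁ (hF : IsGraphHom F) (hF' : ∀ x, F.F₁ (D.cat.i x) = D'.cat.i (F.F₀ x))
    (f : BC k H A D.C₁) : BC.map k A D'.cat.pr (BC.map k A F.F₁ f) =
      BC.map k A F.F₁ (BC.map k A D.cat.pr f) := by
  rw [BC.map_map, BC.map_map]
  exact BC.map_congr (fun f => pr_F₁ hF hF' f) f

lemma coh_aux {X : Type*} [AddCommGroup X] (a b c d e : X) :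
    a + e = d + (b - c) ↔ a - b + c = d - e := by
  constructor
  · intro h
    have : a = d + (b - c) - e := eq_sub_of_add_eq h
    rw [this]; abel
  · intro h
    have : a = d - e - c + b := by rw [← h]; abel
    rw [this]; abel

lemma coh_iff (hD : D.IsLie2) (hD' : D'.IsLie2) (hF : IsGraphHom F)
    (hF' : ∀ x, F.F₁ (D.cat.i x) = D'.cat.i (F.F₀ x)) (x y z : D.C₀) :
    hF.cohL hD.toIsGraph hD'.toIsGraph (one k H x) (one k H y) (one k H z) =
      hF.cohR hD'.toIsGraph (one k H x) (one k H y) (one k H z) ↔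
    BC.push (Hm.assoc k H H H H) (F.arr.UL (one k H x) (one k H y) (one k H z))
    - F.arr.UR (one k H x) (one k H y) (one k H z)
    + BC.push (Hm.swap12 k H H H H) (F.arr.UR (one k H y) (one k H x) (one k H z))
    = D'.arr.b₃ (F.F₀ x) (F.F₀ y) (F.F₀ z) - BC.map k _ F.F₁ (D.arr.b₃ x y z) := by
  have e3 : D'.E3.pr (F.cohL3 (one k H x) (one k H y) (one k H z)) =
      BC.map k _ F.F₁ (D.arr.b₃ x y z) := by
    refine (IntCat.bc_pr D'.cat _).trans ((pr_map_F₁ hF hF' _).trans ?_)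
    exact congrArg _ (congrArg _ (ext3_one _ _ _ _))
  have e4 : D'.E3.pr (F.cohR1 (one k H x) (one k H y) (one k H z)) =
      D'.arr.b₃ (F.F₀ x) (F.F₀ y) (F.F₀ z) := by
    refine (IntCat.bc_pr D'.cat _).trans ?_
    rw [HomData.cohR1, HomData.ob, HomData.ob, HomData.ob, BC.map_one, BC.map_one, BC.map_one,
      ext3_one]
    rfl
  have e5 := pr_cohL (F := F) (one k H x) (one k H y) (one k H z) hD'
  have e6 := pr_cohR (F := F) (one k H x) (one k H y) (one k H z) hD'
  have e7 : D'.E3.pr (hF.cohL hD.toIsGraph hD'.toIsGraph (one k H x) (one k H y) (one k H z)) =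
      BC.push (Hm.assoc k H H H H) (F.arr.UL (one k H x) (one k H y) (one k H z)) +
        BC.map k _ F.F₁ (D.arr.b₃ x y z) :=
    (D'.E3.pr_comp _ _ _).trans (congrArg₂ (· + ·) ((D'.E3.pr_comp _ _ _).trans e5) e3)
  have e8 : D'.E3.pr (hF.cohR hD'.toIsGraph (one k H x) (one k H y) (one k H z)) =
      D'.arr.b₃ (F.F₀ x) (F.F₀ y) (F.F₀ z) +
        (F.arr.UR (one k H x) (one k H y) (one k H z) -
        BC.push (Hm.swap12 k H H H H) (F.arr.UR (one k H y) (one k H x) (one k H z))) :=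
    (D'.E3.pr_comp _ _ _).trans ((congrArg (· + _) (D'.E3.pr_comp _ _ _)).trans
      ((add_assoc _ _ _).trans (congrArg₂ (· + ·) e4 e6)))
  have e9 : D'.E3.s (hF.cohL hD.toIsGraph hD'.toIsGraph (one k H x) (one k H y) (one k H z)) =
      D'.E3.s (hF.cohR hD'.toIsGraph (one k H x) (one k H y) (one k H z)) :=
    (D'.E3.s_comp' _ _ _).trans ((D'.E3.s_comp' _ _ _).trans
    ((s_cohL1 _ _ _ hD'.toIsGraph hF).trans
      ((D'.E3.s_comp' _ _ _).trans (D'.E3.s_comp' _ _ _)).symm))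
  rw [D'.E3.ext_pr e9, e7, e8]
  exact coh_aux _ _ _ _ _

/-- The naturality of `F₂` on arrow parts -/
lemma nat_iff (hD : D.IsGraph) (hD' : D'.IsGraph) (hF : IsGraphHom F)
    (hF' : ∀ x, F.F₁ (D.cat.i x) = D'.cat.i (F.F₀ x)) (f g : D.C₁) :
    D'.E2.comp (D'.br₁ (F.F₁ f) (F.F₁ g)) (F.F₂ (D.cat.t f) (D.cat.t g)) (hF.nat₁ hD' f g) =
      D'.E2.comp (F.F₂ (D.cat.s f) (D.cat.s g)) (BC.map k _ F.F₁ (D.br₁ f g)) (hF.nat₂ hD f g) ↔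
    BC.map k _ D'.cat.pr (D'.br₁ (F.F₁ f) (F.F₁ g)) + F.arr.f₂ (D.cat.t f) (D.cat.t g) =
      F.arr.f₂ (D.cat.s f) (D.cat.s g) + BC.map k _ F.F₁ (BC.map k _ D.cat.pr (D.br₁ f g)) := by
  have e : D'.E2.s (D'.E2.comp (D'.br₁ (F.F₁ f) (F.F₁ g)) (F.F₂ (D.cat.t f) (D.cat.t g))
      (hF.nat₁ hD' f g)) = D'.E2.s (D'.E2.comp (F.F₂ (D.cat.s f) (D.cat.s g))
      (BC.map k _ F.F₁ (D.br₁ f g)) (hF.nat₂ hD f g)) := by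
    rw [D'.E2.s_comp', D'.E2.s_comp', hD'.s_br, hF.s_F₂, hF.s_F, hF.s_F]
  rw [D'.E2.ext_pr e, D'.E2.pr_comp, D'.E2.pr_comp]
  have e' : ∀ x, D'.E2.pr x = BC.map k _ D'.cat.pr x := fun x => IntCat.bc_pr D'.cat x
  rw [e', e', e', e', pr_map_F₁ hF hF']
  rfl

lemma IsHom.arr (hD : D.IsLie2) (hD' : D'.IsLie2)
    (hF : IsHom hD.toIsGraph hD'.toIsGraph F) : TwoTermData.IsHom F.arr where
  skew x y := by
    change BC.map k _ D'.cat.pr (F.F₂ y x) = -BC.push _ (BC.map k _ D'.cat.pr (F.F₂ x y))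
    rw [hF.F₂_skew x y, map_neg, BC.push_map]
  ax1 f := by
    change F.F₀ (D.cat.t f - D.cat.s f) = D'.cat.t (F.F₁ f) - D'.cat.s (F.F₁ f)
    rw [map_sub, hF.s_F, hF.t_F]
  ax2 x y := by
    change BC.map k _ F.F₀ (D.br₀ x y) - D'.br₀ (F.F₀ x) (F.F₀ y) =
      BC.map k _ (D'.cat.t - D'.cat.s) (BC.map k _ D'.cat.pr (F.F₂ x y))
    rw [← hF.s_F₂, ← hF.t_F₂, BC.map_map]
    have e : ∀ f, ((D'.cat.t - D'.cat.s) ∘ₗ D'.cat.pr) f = (D'.cat.t - D'.cat.s) f := by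
      intro f
      change D'.cat.t (D'.cat.pr f) - D'.cat.s (D'.cat.pr f) = D'.cat.t f - D'.cat.s f
      rw [D'.cat.s_pr, D'.cat.t_pr, sub_zero]
    rw [BC.map_congr e, BC.map_sub_hom]
    rfl
  ax3 x u := by
    have e := (nat_iff hD.toIsGraph hD'.toIsGraph hF.toIsGraphHom hF.F_id (D.cat.i x)
      (D.cat.pr u)).1 (hF.F₂_nat _ _)
    rw [hF.F_id, ← pr_F₁ hF.toIsGraphHom hF.F_id, hD.pr_br_right, hD'.pr_br_right, D.cat.s_i,
      D.cat.t_i, D.cat.s_pr, D.cat.t_pr] at e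
    have e0 : F.arr.f₂ x 0 = 0 := by
      have := F.arr.f₂.add_right x 0 0
      rw [add_zero] at this
      exact left_eq_add.1 this
    rw [e0, zero_add] at e
    have e1 : ∀ (D : Lie2Data.{w, u, v} k H) (x : D.C₀) (u : D.C₁),
        D.a₀₁ x (D.cat.pr u) = D.a₀₁ x u := by
      intro D x u
      change D.br₁ (D.cat.i x) (D.cat.pr (D.cat.pr u)) = D.br₁ (D.cat.i x) (D.cat.pr u)
      rw [D.cat.pr_apply (D.cat.pr u), D.cat.s_pr, map_zero, sub_zero]
    rw [e1, e1] at e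
    exact sub_eq_of_eq_add' e.symm
  ax4 x y z := (TwoTermData.IsHom.ax4_iff F.arr x y z).2
    ((coh_iff hD hD' hF.toIsGraphHom hF.F_id x y z).1 (hF.coh x y z))

end Coh

/-! Identities and composites -/

variable (D) in
/-- The identity, with `F₂` the identity transformation -/
def HomData.id : HomData D D := ⟨LinearMap.id, LinearMap.id, D.br₀.post D.cat.i⟩

/-- The transformation `[G₀ F₀ x * G₀ F₀ y] → G₀ [F₀ x * F₀ y] → G₀ F₀ [x * y]` of a composite. -/
def compF₂ {F : HomData D D'} {G : HomData D' D''} (hF : IsGraphHom F) (hG : IsGraphHom G) :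
    Poly2 k H D.C₀ D.C₀ D''.C₁ :=
  have e x y : D''.E2.t (G.F₂ (F.F₀ x) (F.F₀ y)) = D''.E2.s (BC.map k _ G.F₁ (F.F₂ x y)) :=
    (hG.t_F₂ _ _).trans ((congrArg G.ob (hF.s_F₂ x y)).symm.trans (hG.s_F' _).symm)
  { toFun x y := D''.E2.comp (G.F₂ (F.F₀ x) (F.F₀ y)) (BC.map k _ G.F₁ (F.F₂ x y)) (e x y)
    add_left x x' y := by
      rw [← D''.E2.comp_add _ _ _ _ _ _ (by rw [map_add, map_add, e, e])]
      refine D''.E2.comp_congr ?_ ?_ _ _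
      · rw [map_add, G.F₂.add_left]
      · rw [F.F₂.add_left, BC.map_add]
    add_right x y y' := by
      rw [← D''.E2.comp_add _ _ _ _ _ _ (by rw [map_add, map_add, e, e])]
      refine D''.E2.comp_congr ?_ ?_ _ _
      · rw [map_add, G.F₂.add_right]
      · rw [F.F₂.add_right, BC.map_add]
    smul f g x y := by
      rw [← D''.E2.comp_smul _ _ _ _ (by rw [map_smul, map_smul, e])]
      refine D''.E2.comp_congr ?_ ?_ _ _
      · rw [map_smul, map_smul, G.F₂.smul]
      · rw [F.F₂.smul, map_smul] }

/-- The composite of `F` and `G` -/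
def compHom {F : HomData D D'} {G : HomData D' D''} (hF : IsGraphHom F) (hG : IsGraphHom G) :
    HomData D D'' := ⟨G.F₀ ∘ₗ F.F₀, G.F₁ ∘ₗ F.F₁, compF₂ hF hG⟩

lemma compF₂_eq {F : HomData D D'} {G : HomData D' D''} (hF : IsGraphHom F) (hG : IsGraphHom G)
    (x y : D.C₀) : compF₂ hF hG x y = G.F₂ (F.F₀ x) (F.F₀ y) + BC.map k _ G.F₁ (F.F₂ x y) -
      BC.map k _ (D''.cat.i ∘ₗ G.F₀) (D'.br₀ (F.F₀ x) (F.F₀ y)) := by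
  refine (D''.E2.comp_eq _ _ _).trans (congrArg₂ (· - ·) rfl ?_)
  rw [hG.t_F₂, ← BC.map_map]
  rfl

lemma IsGraphHom.id (hD : D.IsGraph) : IsGraphHom (HomData.id D) where
  s_F f := rfl
  t_F f := rfl
  s_F₂ x y := D.E2.s_i _
  t_F₂ x y := (D.E2.t_i _).trans (BC.map_id _).symm

lemma IsGraphHom.comp {F : HomData D D'} {G : HomData D' D''} (hF : IsGraphHom F)
    (hG : IsGraphHom G) : IsGraphHom (compHom hF hG) where
  s_F f := (hG.s_F _).trans (congrArg _ (hF.s_F f))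
  t_F f := (hG.t_F _).trans (congrArg _ (hF.t_F f))
  s_F₂ x y := (D''.E2.s_comp' _ _ _).trans (hG.s_F₂ _ _)
  t_F₂ x y := (D''.E2.t_comp' _ _ _).trans ((hG.t_F' _).trans
    ((congrArg _ (hF.t_F₂ x y)).trans (BC.map_map _ _ _)))

lemma arr_id : (HomData.id D).arr = TwoTermData.HomData.id D.arr := by
  refine TwoTermData.HomData.ext rfl rfl ?_
  ext x y
  change BC.map k _ D.cat.pr (BC.map k _ D.cat.i (D.br₀ x y)) = 0
  exact (IntCat.bc_pr D.cat _).symm.trans (D.E2.pr_i _)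

lemma arr_comp {F : HomData D D'} {G : HomData D' D''} (hF : IsGraphHom F)
    (hG : IsGraphHom G) (hG' : ∀ x, G.F₁ (D'.cat.i x) = D''.cat.i (G.F₀ x)) :
    (compHom hF hG).arr = F.arr.comp G.arr := by
  refine TwoTermData.HomData.ext rfl rfl ?_
  ext x y
  change BC.map k _ D''.cat.pr (D''.E2.comp _ _ _) = BC.map k _ D''.cat.pr _ +
    BC.map k _ G.F₁ (BC.map k _ D'.cat.pr _)
  rw [← IntCat.bc_pr]
  refine (D''.E2.pr_comp _ _ _).trans (congrArg₂ (· + ·) (IntCat.bc_pr _ _)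
    ((IntCat.bc_pr _ _).trans (pr_map_F₁ hG hG' _)))

lemma id_compHom (hD : D.IsGraph) {F : HomData D D'} (hF : IsGraphHom F)
    (hF' : ∀ x, F.F₁ (D.cat.i x) = D'.cat.i (F.F₀ x)) : compHom (.id hD) hF = F := by
  refine HomData.ext rfl rfl ?_
  ext x y
  refine (compF₂_eq (.id hD) hF x y).trans ?_
  have e : BC.map k _ F.F₁ (BC.map k _ D.cat.i (D.br₀ x y)) =
      BC.map k _ (D'.cat.i ∘ₗ F.F₀) (D.br₀ x y) :=
    (BC.map_map _ _ _).trans (BC.map_congr hF' _)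
  exact sub_eq_of_eq_add (congrArg (_ + ·) e)

lemma compHom_id (hD' : D'.IsGraph) {F : HomData D D'} (hF : IsGraphHom F) :
    compHom hF (.id hD') = F := by
  refine HomData.ext rfl rfl ?_
  ext x y
  refine (compF₂_eq hF (.id hD') x y).trans ?_
  change BC.map k _ D'.cat.i (D'.br₀ (F.F₀ x) (F.F₀ y)) + BC.map k _ LinearMap.id (F.F₂ x y) -
    BC.map k _ D'.cat.i (D'.br₀ (F.F₀ x) (F.F₀ y)) = F.F₂ x y
  rw [BC.map_id, add_sub_cancel_left]

lemma compHom_assoc {D₃ : Lie2Data.{w, u, v} k H} {F : HomData D D'} {G : HomData D' D''}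
    {K : HomData D'' D₃} (hF : IsGraphHom F) (hG : IsGraphHom G) (hK : IsGraphHom K)
    (hK' : ∀ x, K.F₁ (D''.cat.i x) = D₃.cat.i (K.F₀ x)) :
    compHom (hF.comp hG) hK = compHom hF (hG.comp hK) := by
  refine HomData.ext rfl rfl ?_
  ext x y
  have e0 := compF₂_eq (hF.comp hG) hK x y
  have e1 := compF₂_eq hF hG x y
  have e2 := compF₂_eq hG hK (F.F₀ x) (F.F₀ y)
  have e4 := compF₂_eq hF (hG.comp hK) x y
  have e3 : BC.map k _ K.F₁ (BC.map k _ (D''.cat.i ∘ₗ G.F₀) (D'.br₀ (F.F₀ x) (F.F₀ y))) =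
      BC.map k _ (D₃.cat.i ∘ₗ K.F₀ ∘ₗ G.F₀) (D'.br₀ (F.F₀ x) (F.F₀ y)) :=
    (BC.map_map _ _ _).trans (BC.map_congr (fun x => hK' (G.F₀ x)) _)
  refine e0.trans (Eq.trans ?_ e4.symm)
  change K.F₂ (G.F₀ (F.F₀ x)) (G.F₀ (F.F₀ y)) + BC.map k _ K.F₁ (compF₂ hF hG x y) -
      BC.map k _ (D₃.cat.i ∘ₗ K.F₀) (D''.br₀ (G.F₀ (F.F₀ x)) (G.F₀ (F.F₀ y))) =
    compF₂ hG hK (F.F₀ x) (F.F₀ y) + BC.map k _ (K.F₁ ∘ₗ G.F₁) (F.F₂ x y) -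
      BC.map k _ (D₃.cat.i ∘ₗ K.F₀ ∘ₗ G.F₀) (D'.br₀ (F.F₀ x) (F.F₀ y))
  rw [e1, e2, BC.map_sub, BC.map_add, e3, ← BC.map_map G.F₁ K.F₁]
  abel

lemma IsHom.id (hD : D.IsLie2) : IsHom hD.toIsGraph hD.toIsGraph (HomData.id D) where
  toIsGraphHom := .id hD.toIsGraph
  F_id x := rfl
  F_comp f g e := rfl
  F₂_nat f g := by
    rw [nat_iff hD.toIsGraph hD.toIsGraph (.id hD.toIsGraph) (fun _ => rfl), arr_id]
    change _ + 0 = 0 + BC.map k _ LinearMap.id _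
    rw [BC.map_id, add_zero, zero_add]
    rfl
  F₂_iso x y := D.E2.isIso _
  F₂_skew x y := by
    change BC.map k _ D.cat.i (D.br₀ y x) = -BC.push _ (BC.map k _ D.cat.i (D.br₀ x y))
    rw [hD.skew₀ x y, map_neg, BC.push_map]
  coh x y z := by
    rw [coh_iff hD hD (.id hD.toIsGraph) (fun _ => rfl), arr_id]
    exact (TwoTermData.IsHom.ax4_iff (TwoTermData.HomData.id D.arr) x y z).1
      ((TwoTermData.IsHom.id D.arr).ax4 x y z)

lemma IsHom.comp {F : HomData D D'} {G : HomData D' D''} {hD : D.IsLie2} {hD' : D'.IsLie2}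
    {hD'' : D''.IsLie2} (hF : IsHom hD.toIsGraph hD'.toIsGraph F)
    (hG : IsHom hD'.toIsGraph hD''.toIsGraph G) :
    IsHom hD.toIsGraph hD''.toIsGraph (compHom hF.toIsGraphHom hG.toIsGraphHom) where
  toIsGraphHom := hF.toIsGraphHom.comp hG.toIsGraphHom
  F_id x := (congrArg G.F₁ (hF.F_id x)).trans (hG.F_id _)
  F_comp f g e := (congrArg G.F₁ (hF.F_comp f g e)).trans (hG.F_comp _ _ _)
  F₂_nat f g := by
    rw [nat_iff hD.toIsGraph hD''.toIsGraph (hF.toIsGraphHom.comp hG.toIsGraphHom)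
      (fun x => (congrArg G.F₁ (hF.F_id x)).trans (hG.F_id _)),
      arr_comp hF.toIsGraphHom hG.toIsGraphHom hG.F_id]
    have e1 := (nat_iff hD.toIsGraph hD'.toIsGraph hF.toIsGraphHom hF.F_id f g).1 (hF.F₂_nat f g)
    have e2 := (nat_iff hD'.toIsGraph hD''.toIsGraph hG.toIsGraphHom hG.F_id (F.F₁ f) (F.F₁ g)).1
      (hG.F₂_nat _ _)
    rw [hF.s_F, hF.t_F, hF.s_F, hF.t_F] at e2
    have e3 := congrArg (BC.map k _ G.F₁) e1
    rw [BC.map_add, BC.map_add, BC.map_map F.F₁ G.F₁] at e3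
    change BC.map k _ D''.cat.pr (D''.br₁ (G.F₁ (F.F₁ f)) (G.F₁ (F.F₁ g))) +
      (G.arr.f₂ (F.F₀ (D.cat.t f)) (F.F₀ (D.cat.t g)) +
        BC.map k _ G.F₁ (F.arr.f₂ (D.cat.t f) (D.cat.t g))) =
      G.arr.f₂ (F.F₀ (D.cat.s f)) (F.F₀ (D.cat.s g)) +
        BC.map k _ G.F₁ (F.arr.f₂ (D.cat.s f) (D.cat.s g)) +
      BC.map k _ (G.F₁ ∘ₗ F.F₁) (BC.map k _ D.cat.pr (D.br₁ f g))
    rw [← add_assoc, e2, add_assoc, e3, add_assoc]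
  F₂_iso x y := D''.E2.isIso _
  F₂_skew x y := by
    change compF₂ hF.toIsGraphHom hG.toIsGraphHom y x =
      -BC.push _ (compF₂ hF.toIsGraphHom hG.toIsGraphHom x y)
    have h1 := hG.F₂_skew (F.F₀ x) (F.F₀ y)
    have h2 : BC.map k _ G.F₁ (F.F₂ y x) =
        -BC.push (Hm.swap k H H H) (BC.map k _ G.F₁ (F.F₂ x y)) := by
      rw [hF.F₂_skew x y, map_neg, BC.push_map]
    have h3 : BC.map k _ (D''.cat.i ∘ₗ G.F₀) (D'.br₀ (F.F₀ y) (F.F₀ x)) =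
        -BC.push (Hm.swap k H H H) (BC.map k _ (D''.cat.i ∘ₗ G.F₀) (D'.br₀ (F.F₀ x) (F.F₀ y))) := by
      rw [hD'.skew₀ (F.F₀ x) (F.F₀ y), map_neg, BC.push_map]
    rw [compF₂_eq, compF₂_eq, h1, h2, h3, BC.push_sub, BC.push_add]
    abel
  coh x y z := by
    rw [coh_iff hD hD'' (hF.toIsGraphHom.comp hG.toIsGraphHom)
      (fun x => (congrArg G.F₁ (hF.F_id x)).trans (hG.F_id _)),
      arr_comp hF.toIsGraphHom hG.toIsGraphHom hG.F_id]
    exact (TwoTermData.IsHom.ax4_iff (F.arr.comp G.arr) x y z).1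
      (((hF.arr hD hD').comp (hG.arr hD' hD'')).ax4 x y z)

end Lie2Data

section

variable (k : Type w) [Field k] (H : Type u) [Ring H] [HopfAlgebra k H] [Coalgebra.IsCocomm k H]

/-- The Lie-2 `H`-pseudoalgebras. -/
structure Lie2 extends Lie2Data.{w, u, v} k H where
  ax : toLie2Data.IsLie2

end

namespace Lie2

variable [Coalgebra.IsCocomm k H]

/-- Homomorphisms of Lie-2 `H`-pseudoalgebras. -/
@[ext]
structure Hom (D D' : Lie2.{w, u, v} k H) extends
    Lie2Data.HomData D.toLie2Data D'.toLie2Data where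
  isHom : Lie2Data.IsHom D.ax.toIsGraph D'.ax.toIsGraph toHomData

lemma Hom.ext' {D D' : Lie2.{w, u, v} k H} {f g : Hom D D'} (h : f.toHomData = g.toHomData) :
    f = g := by
  cases f
  cases g
  cases h
  rfl

/-- The composite of homomorphisms -/
def Hom.comp {D D' D'' : Lie2.{w, u, v} k H} (f : Hom D D') (g : Hom D' D'') : Hom D D'' :=
  ⟨Lie2Data.compHom f.isHom.toIsGraphHom g.isHom.toIsGraphHom,
    Lie2Data.IsHom.comp (hD := D.ax) (hD' := D'.ax) (hD'' := D''.ax) f.isHom g.isHom⟩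

/-- The category of Lie-2 `H`-pseudoalgebras. -/
instance : CategoryTheory.Category (Lie2.{w, u, v} k H) where
  Hom := Hom
  id D := ⟨.id _, .id D.ax⟩
  comp := Hom.comp
  id_comp {D D'} f := Hom.ext' (Lie2Data.id_compHom D.ax.toIsGraph f.isHom.toIsGraphHom f.isHom.F_id)
  comp_id {D D'} f := Hom.ext' (Lie2Data.compHom_id D'.ax.toIsGraph f.isHom.toIsGraphHom)
  assoc {D D₁ D₂ D₃} f g h := Hom.ext' (Lie2Data.compHom_assoc f.isHom.toIsGraphHom
    g.isHom.toIsGraphHom h.isHom.toIsGraphHom h.isHom.F_id)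

end Lie2

end

section

open BC (one)

/-! ### The functors between the two categories -/

/-- `(x, y, z) ↦ β' (β (x, y), z)` as a polylinear map -/
def nestLPoly {P : Type*} [AddCommGroup P] [Module H P] (β' : Poly2 k H N P Q)
    (β : Poly2 k H L M N) : Poly3 k H L M P Q where
  toFun x y z := nestL β' β (one k H x) (one k H y) (one k H z)
  add_left x x' y z := by
    rw [nestL, BC.one_add, ext2_add_left, ext2_add_left, BC.push_add]
    rfl
  add_middle x y y' z := by
    rw [nestL, BC.one_add, ext2_add_right, ext2_add_left, BC.push_add]
    rfl
  add_right x y z z' := by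
    rw [nestL, BC.one_add, ext2_add_right, BC.push_add]
    rfl
  smul f g h x y z := by
    rw [nestL, BC.one_smul, BC.one_smul, BC.one_smul, ext2_smul, ext2_smul, BC.push_smul]
    rfl

section

variable [Coalgebra.IsCocomm k H]

namespace Lie2Data

variable (D : Lie2Data.{w, u, v} k H) {D' : Lie2Data.{w, u, v} k H}

/-- The projection `f ↦ f - 1_{s f}` of `C₁` onto the kernel of the source map. -/
def prKer : D.C₁ →ₗ[H] LinearMap.ker D.cat.s :=
  LinearMap.codRestrict _ D.cat.pr D.cat.s_pr

/-- The data of `S(C)`: the complex `t : ker s → C₀`, with `β₂ (x, y) = [x * y]`,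
`β₂ (x, u) = [1_x * u]`, and `β₃ (x, y, z)` the arrow part of `J_{x,y,z}`. -/
def S : TwoTermData.{w, u, v} k H where
  L₀ := D.C₀
  L₁ := LinearMap.ker D.cat.s
  d := D.cat.t ∘ₗ (LinearMap.ker D.cat.s).subtype
  b₀₀ := D.br₀
  b₀₁ := (D.br₁.pre D.cat.i (LinearMap.ker D.cat.s).subtype).post D.prKer
  b₃ := D.J.post D.prKer

variable {D}

/-- The data of `S(F)`: the restrictions of `F₀` and `F₁`, and `f₂ (x, y)` is the arrow part of
`F₂ (x, y)`. -/
def IsGraphHom.S {F : HomData D D'} (hF : IsGraphHom F) : TwoTermData.HomData D.S D'.S where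
  f₀ := F.F₀
  f₁ := F.F₁.restrict (p := LinearMap.ker D.cat.s) (q := LinearMap.ker D'.cat.s) (fun u hu => by
    rw [LinearMap.mem_ker] at hu ⊢
    rw [hF.s_F, hu, map_zero])
  f₂ := F.F₂.post D'.prKer

end Lie2Data

instance : Add (Poly3 k H L M N Q) :=
  ⟨fun γ γ' =>
    { toFun := fun x y z => γ x y z + γ' x y z
      add_left := fun x x' y z => by rw [γ.add_left, γ'.add_left, add_add_add_comm]
      add_middle := fun x y y' z => by rw [γ.add_middle, γ'.add_middle, add_add_add_comm]
      add_right := fun x y z z' => by rw [γ.add_right, γ'.add_right, add_add_add_comm]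
      smul := fun f g h x y z => by rw [γ.smul, γ'.smul, smul_add] }⟩

namespace TwoTermData

variable (K : TwoTermData.{w, u, v} k H) {K' : TwoTermData.{w, u, v} k H}

/-- The data of `T(L)`: the objects are `L₀`, the arrows are `L₀ ⊕ L₁`, where `(x, u)` is an arrow
`x → x + d u`; the bracket of the arrows `(x, u)` and `(y, v)` is
`([x * y], [x * v] + [u * y] + [d u * v])`, and `J_{x,y,z} = ([[x * y] * z], β₃ (x, y, z))`. -/
def T : Lie2Data.{w, u, v} k H where
  C₀ := K.L₀
  C₁ := K.L₀ × K.L₁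
  cat := IntCat.ofReflexive (LinearMap.fst H K.L₀ K.L₁)
    (LinearMap.fst H K.L₀ K.L₁ + K.d ∘ₗ LinearMap.snd H K.L₀ K.L₁) (LinearMap.inl H K.L₀ K.L₁)
    (fun _ => rfl) (fun x => (congrArg (x + ·) (map_zero K.d)).trans (add_zero x))
  br₀ := K.b₀₀
  br₁ := (K.b₀₀.pre (LinearMap.fst H K.L₀ K.L₁) (LinearMap.fst H K.L₀ K.L₁)).post
      (LinearMap.inl H K.L₀ K.L₁) +
    (K.b₀₁.pre (LinearMap.fst H K.L₀ K.L₁) (LinearMap.snd H K.L₀ K.L₁) +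
      K.b₁₀.pre (LinearMap.snd H K.L₀ K.L₁) (LinearMap.fst H K.L₀ K.L₁) +
      K.b₀₁.pre (K.d ∘ₗ LinearMap.snd H K.L₀ K.L₁) (LinearMap.snd H K.L₀ K.L₁)).post
      (LinearMap.inr H K.L₀ K.L₁)
  J := (nestLPoly K.b₀₀ K.b₀₀).post (LinearMap.inl H K.L₀ K.L₁) +
    K.b₃.post (LinearMap.inr H K.L₀ K.L₁)

variable {K}

/-- The data of `T(f)`: `f₀` on objects, `f₀ ⊕ f₁` on arrows, and
`F₂ (x, y) = ([f₀ x * f₀ y], f₂ (x, y))`. -/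
def HomData.T (f : HomData K K') : Lie2Data.HomData K.T K'.T where
  F₀ := f.f₀
  F₁ := f.f₀.prodMap f.f₁
  F₂ := (K'.b₀₀.pre f.f₀ f.f₀).post (LinearMap.inl H K'.L₀ K'.L₁) +
    f.f₂.post (LinearMap.inr H K'.L₀ K'.L₁)

end TwoTermData

end

section

variable (k : Type w) [Field k] (H : Type u) [Ring H] [HopfAlgebra k H] [Coalgebra.IsCocomm k H]

/-- The construction `S` is a functor from Lie-2 `H`-pseudoalgebras to 2-term `L_∞`
`H`-pseudoalgebras. -/
structure IsFunctorS : Prop where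
  obj : ∀ D : Lie2.{w, u, v} k H, D.S.IsTwoTerm
  map : ∀ {D D' : Lie2.{w, u, v} k H} (F : D ⟶ D'), TwoTermData.IsHom F.isHom.S
  map_id : ∀ D : Lie2.{w, u, v} k H,
    (CategoryTheory.CategoryStruct.id D).isHom.S = TwoTermData.HomData.id D.S
  map_comp : ∀ {D D' D'' : Lie2.{w, u, v} k H} (F : D ⟶ D') (G : D' ⟶ D''),
    (CategoryTheory.CategoryStruct.comp F G).isHom.S = F.isHom.S.comp G.isHom.S

/-- The construction `T` is a functor from 2-term `L_∞` `H`-pseudoalgebras to Lie-2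
`H`-pseudoalgebras. -/
structure IsFunctorT : Prop where
  obj : ∀ L : TwoTerm.{w, u, v} k H, L.T.IsLie2
  map : ∀ {L L' : TwoTerm.{w, u, v} k H} (f : L ⟶ L'),
    Lie2Data.IsHom (obj L).toIsGraph (obj L').toIsGraph f.T
  map_id : ∀ L : TwoTerm.{w, u, v} k H,
    (CategoryTheory.CategoryStruct.id L).T = Lie2Data.HomData.id L.T
  map_comp : ∀ {L L' L'' : TwoTerm.{w, u, v} k H} (f : L ⟶ L') (g : L' ⟶ L''),
    (CategoryTheory.CategoryStruct.comp f g).T =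
      Lie2Data.compHom (map f).toIsGraphHom (map g).toIsGraphHom

variable {k H}

/-- The functor `S`. -/
def IsFunctorS.functor (h : IsFunctorS.{w, u, v} k H) :
    CategoryTheory.Functor (Lie2.{w, u, v} k H) (TwoTerm.{w, u, v} k H) where
  obj D := ⟨D.S, h.obj D⟩
  map F := ⟨F.isHom.S, h.map F⟩
  map_id D := TwoTerm.Hom.ext' (h.map_id D)
  map_comp F G := TwoTerm.Hom.ext' (h.map_comp F G)

/-- The functor `T`. -/
def IsFunctorT.functor (h : IsFunctorT.{w, u, v} k H) :
    CategoryTheory.Functor (TwoTerm.{w, u, v} k H) (Lie2.{w, u, v} k H) where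
  obj L := ⟨L.T, h.obj L⟩
  map f := ⟨f.T, h.map f⟩
  map_id L := Lie2.Hom.ext' (h.map_id L)
  map_comp f g := Lie2.Hom.ext' (h.map_comp f g)

end

end

end HPseudo

end

noncomputable section

namespace HPseudo

open BC (one)

variable {k : Type w} [Field k] {H : Type u} [Ring H] [HopfAlgebra k H]
variable {A : Type*} [Ring A] [Algebra k A] [OverH k H A]
variable {B : Type*} [Ring B] [Algebra k B] [OverH k H B]
variable {C : Type*} [Ring C] [Algebra k C] [OverH k H C]
variable {L : Type*} [AddCommGroup L] [Module H L]
variable {L' : Type*} [AddCommGroup L'] [Module H L']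
variable {M : Type*} [AddCommGroup M] [Module H M]
variable {M' : Type*} [AddCommGroup M'] [Module H M']
variable {N : Type*} [AddCommGroup N] [Module H N]
variable {N' : Type*} [AddCommGroup N'] [Module H N']
variable {Q : Type*} [AddCommGroup Q] [Module H Q]
variable {Q' : Type*} [AddCommGroup Q'] [Module H Q']

/-! ### Additivity of `A ⊗_H -` and symmetries of extended polylinear maps. -/

section General

/-! A category internal to modules splits. Every arrow `f` is the sum of the identity at its source
and of its arrow part `f - 1_{s f}`, so `C₁ ≅ C₀ ⊕ ker s`, and the composition is forced to be `f ;
g = f + g - 1_{t f}` (`IntCat.comp_eq`). The splitting is linear, hence it survives `H^{⊗n} ⊗_H -`.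
Two consequences drive the proof: a linear map `ρ` on `C₁` that kills identities turns composites
into sums (`IntCat.map_comp_of_map_i`), and two arrows agree as soon as their sources and their
arrow parts agree. So each categorical axiom, an equation between composites, becomes an identity
between sums of arrow parts.

Under this dictionary the source and target of `J` give axiom 3, its naturality gives axiom 4, and
its coherence law gives axiom 5. The bifunctoriality of the bracket gives axioms 1 and 2: for `u`
and `v` starting at `0`, the interchange law evaluates `[u * v]` both as `[1_{t u} * v]` and as `[u
* 1_{t v}]`. For general arrows it gives `[f * g] = [f * 1_{s g}] ; [1_{t f} * g]`, so that the
bracket on arrows is determined by its values on objects and by brackets with identities; this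
explains the formula used for `T`.

The coherence law of the Jacobiator is treated once for both directions. For an abstract `ρ`,
`map_hexL_sub_hexR` shows that the images of its two sides differ by the left hand side of axiom 5;
then `ρ` is `prKer` for `S` and the second coordinate for `T`. For a homomorphism, `coh_iff`
expresses the coherence law through arrow parts in the whole of `C₁`, and `HomData.map_coh`
transports that expression, along `prKer` for `S` and along `inr` for `T`.

Axiom 4 is stated with its degree 1 element in the last place. Skew-symmetry provides the other two
places (`ax4_middle`, `ax4_left`), and naturality of the Jacobiator of `T(L)` telescopes into the
sum of the three forms (`pair_J_nat`).

Finally `(0, u) ↦ u` identifies `S(T(L))` with `L`, and `f ↦ (s f, f - 1_{s f})` identifies `C` with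
`T(S(C))`. Both maps preserve all structure strictly, hence so do their inverses, and naturality is
checked on components. -/

lemma BC.push_neg (θ : Hm k H A B) (x : BC k H A M) : push θ (-x) = -push θ x :=
  (push θ).map_neg x

lemma BC.map_neg (φ : M →ₗ[H] N) (x : BC k H A M) : map k A φ (-x) = -map k A φ x :=
  (map k A φ).map_neg x

lemma BC.map_zero (φ : M →ₗ[H] N) : map k A φ 0 = 0 := (map k A φ).map_zero

lemma BC.map_zero_hom (x : BC k H A M) : map k A (0 : M →ₗ[H] N) x = 0 := by
  have e := map_add_hom (k := k) (A := A) (0 : M →ₗ[H] N) 0 x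
  rw [add_zero] at e
  exact left_eq_add.1 e

lemma BC.map_comp_id {ι : M →ₗ[H] N} {ρ : N →ₗ[H] M} (h : ∀ x, ρ (ι x) = x) (x : BC k H A M) :
    map k A ρ (map k A ι x) = x :=
  (map_map _ _ _).trans ((map_congr (ψ := LinearMap.id) h x).trans (map_id x))

lemma BC.map_comp_zero {φ : L →ₗ[H] M} {ψ : M →ₗ[H] N} (h : ∀ x, ψ (φ x) = 0) (x : BC k H A L) :
    map k A ψ (map k A φ x) = 0 :=
  (map_map _ _ _).trans ((map_congr (ψ := 0) h x).trans (map_zero_hom x))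

lemma BC.map_comp_congr {φ : L →ₗ[H] M} {ψ : M →ₗ[H] N} {φ' : L →ₗ[H] M'} {ψ' : M' →ₗ[H] N}
    (h : ∀ x, ψ (φ x) = ψ' (φ' x)) (x : BC k H A L) :
    map k A ψ (map k A φ x) = map k A ψ' (map k A φ' x) :=
  (map_map _ _ _).trans ((map_congr (ψ := ψ' ∘ₗ φ') h x).trans (map_map _ _ _).symm)

lemma BC.map_comp_eq {φ : L →ₗ[H] M} {ψ : M →ₗ[H] N} {χ : L →ₗ[H] N}
    (h : ∀ x, ψ (φ x) = χ x) (x : BC k H A L) : map k A ψ (map k A φ x) = map k A χ x :=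
  (map_map _ _ _).trans (map_congr h x)

/-- No flatness is needed: a retraction of `ι` induces a retraction of `A ⊗_H ι`. The case of
interest is the inclusion of `ker s`, which is split by `prKer`. -/
lemma BC.map_injective {ι : M →ₗ[H] N} {ρ : N →ₗ[H] M} (h : ∀ x, ρ (ι x) = x) :
    Function.Injective (map k A ι) :=
  Function.LeftInverse.injective (g := map k A ρ) (map_comp_id h)

/-- The identity of `M × N` is `inl ∘ fst + inr ∘ snd`, and `A ⊗_H -` is an additive functor. Arrows
of `T(L)`, with coefficients in tensor powers of `H`, are compared in this way. -/
lemma BC.prod_ext {x y : BC k H A (M × N)}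
    (h₁ : map k A (LinearMap.fst H M N) x = map k A (LinearMap.fst H M N) y)
    (h₂ : map k A (LinearMap.snd H M N) x = map k A (LinearMap.snd H M N) y) : x = y := by
  have e : ∀ z : BC k H A (M × N), z = map k A (LinearMap.inl H M N) (map k A (LinearMap.fst H M N) z) +
      map k A (LinearMap.inr H M N) (map k A (LinearMap.snd H M N) z) := by
    intro z
    rw [map_map, map_map, ← map_add_hom]
    refine (map_id z).symm.trans (map_congr (fun p => ?_) z)
    exact Prod.ext (add_zero p.1).symm (zero_add p.2).symm
  rw [e x, e y, h₁, h₂]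

namespace Poly2

variable (β : Poly2 k H L M N)

lemma zero_left (y : M) : β 0 y = 0 := by
  have e := β.add_left 0 0 y
  rw [add_zero] at e
  exact left_eq_add.1 e

lemma zero_right (x : L) : β x 0 = 0 := by
  have e := β.add_right x 0 0
  rw [add_zero] at e
  exact left_eq_add.1 e

end Poly2

lemma Poly3.zero_right (γ : Poly3 k H L M N Q) (x : L) (y : M) : γ x y 0 = 0 := by
  have e := γ.add_right x y 0 0
  rw [add_zero] at e
  exact left_eq_add.1 e

/-- Both sides are additive in each argument, so generators suffice. This replaces the Jacobiator by
its arrow part when its arguments are themselves brackets. -/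
lemma map_ext3 {γ : Poly3 k H L M N Q} {γ' : Poly3 k H L M N Q'} {χ : Q →ₗ[H] Q'}
    (h : ∀ x y z, BC.map k _ χ (γ x y z) = γ' x y z) (p : BC k H A L) (q : BC k H B M)
    (r : BC k H C N) : BC.map k _ χ (ext3 γ p q r) = ext3 γ' p q r := by
  induction p using BC.ind with
  | h0 => simp only [map_zero, AddMonoidHom.zero_apply]
  | ha p p' hp hp' => simp only [map_add, AddMonoidHom.add_apply, hp, hp']
  | hm a x =>
    induction q using BC.ind with
    | h0 => simp only [map_zero, AddMonoidHom.zero_apply]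
    | ha q q' hq hq' => simp only [map_add, AddMonoidHom.add_apply, hq, hq']
    | hm b y =>
      induction r using BC.ind with
      | h0 => simp only [map_zero]
      | ha q q' hq hq' => simp only [map_add, hq, hq']
      | hm c z => rw [ext3_mk, ext3_mk, map_smul, ← BC.push_map, h]

variable [Coalgebra.IsCocomm k H]

/-- On generators this reduces to the fact that the flip commutes with applying structure maps
factorwise. The flip moves whole blocks `A` and `B`, as is needed when an argument is an iterated
bracket. -/
lemma ext2_opp (β : Poly2 k H L M N) (p : BC k H A L) (q : BC k H B M) :
    ext2 β.opp q p = -BC.push (Hm.swap k H A B) (ext2 β p q) := by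
  induction p using BC.ind with
  | h0 => simp only [map_zero, AddMonoidHom.zero_apply, neg_zero]
  | ha p p' hp hp' => simp only [map_add, AddMonoidHom.add_apply, hp, hp', neg_add]
  | hm a x =>
    induction q using BC.ind with
    | h0 => simp only [map_zero, AddMonoidHom.zero_apply, neg_zero]
    | ha q q' hq hq' => simp only [map_add, AddMonoidHom.add_apply, hq, hq', neg_add]
    | hm b y =>
      rw [ext2_mk, ext2_mk, BC.push_smul, ← smul_neg]
      refine congrArg _ ((BC.push_neg _ _).trans (congrArg _ ?_))
      rw [BC.push_push, BC.push_push]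
      -- The two composite homomorphisms agree by definition on pure tensors, and these determine
      -- them.
      refine BC.push_congr ?_ _; intro e; refine Hm.ext_tmul ?_ e; intro _ _; rfl

/-- Skew-symmetry on elements propagates to coefficients in arbitrary `A`, `B`, `C`, the
transposition now moving blocks. The coherence law needs this because one argument of the Jacobiator
is a bracket there. -/
lemma Poly3.IsSkew.ext3_12 {γ : Poly3 k H L L L Q} (hγ : γ.IsSkew) (p : BC k H A L)
    (q : BC k H B L) (r : BC k H C L) :
    ext3 γ q p r = -BC.push (Hm.swap12 k H A B C) (ext3 γ p q r) := by
  induction p using BC.ind with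
  | h0 => simp only [map_zero, AddMonoidHom.zero_apply, neg_zero]
  | ha p p' hp hp' => simp only [map_add, AddMonoidHom.add_apply, hp, hp', neg_add]
  | hm a x =>
    induction q using BC.ind with
    | h0 => simp only [map_zero, AddMonoidHom.zero_apply, neg_zero]
    | ha q q' hq hq' => simp only [map_add, AddMonoidHom.add_apply, hq, hq', neg_add]
    | hm b y =>
      induction r using BC.ind with
      | h0 => simp only [map_zero, neg_zero]
      | ha q q' hq hq' => simp only [map_add, hq, hq', neg_add]
      | hm c z =>
        rw [ext3_mk, ext3_mk, BC.push_smul, ← smul_neg, hγ.1 x y z]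
        refine congrArg _ ((BC.push_neg _ _).trans (congrArg _ ?_))
        rw [BC.push_push, BC.push_push]
        refine BC.push_congr ?_ _; intro e; refine Hm.ext_tmulR ?_ e; intro _ _ _; rfl

lemma Poly3.IsSkew.ext3_23 {γ : Poly3 k H L L L Q} (hγ : γ.IsSkew) (p : BC k H A L)
    (q : BC k H B L) (r : BC k H C L) :
    ext3 γ p r q = -BC.push (Hm.swap23 k H A B C) (ext3 γ p q r) := by
  induction p using BC.ind with
  | h0 => simp only [map_zero, AddMonoidHom.zero_apply, neg_zero]
  | ha p p' hp hp' => simp only [map_add, AddMonoidHom.add_apply, hp, hp', neg_add]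
  | hm a x =>
    induction q using BC.ind with
    | h0 => simp only [map_zero, AddMonoidHom.zero_apply, neg_zero]
    | ha q q' hq hq' => simp only [map_add, AddMonoidHom.add_apply, hq, hq', neg_add]
    | hm b y =>
      induction r using BC.ind with
      | h0 => simp only [map_zero, AddMonoidHom.zero_apply, neg_zero]
      | ha q q' hq hq' => simp only [map_add, AddMonoidHom.add_apply, hq, hq', neg_add]
      | hm c z =>
        rw [ext3_mk, ext3_mk, BC.push_smul, ← smul_neg, hγ.2 x y z]
        refine congrArg _ ((BC.push_neg _ _).trans (congrArg _ ?_))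
        rw [BC.push_push, BC.push_push]
        refine BC.push_congr ?_ _; intro e; refine Hm.ext_tmulR ?_ e; intro _ _ _; rfl

end General

/-! ### The coherence law of the Jacobiator, seen through a linear map that kills identities. -/

section Hexagon

variable [Coalgebra.IsCocomm k H] {D : Lie2Data.{w, u, v} k H}
variable {X : Type*} [AddCommGroup X] [Module H X]

namespace IntCat

/-- The composite is `f + g - 1_{t f}`, and the correction term is an identity. -/
lemma map_comp_of_map_i {C₀ C₁ : Type*} [AddCommGroup C₀] [Module H C₀] [AddCommGroup C₁]
    [Module H C₁] (E : IntCat H C₀ C₁) {ρ : C₁ →ₗ[H] X} (hρ : ∀ x, ρ (E.i x) = 0)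
    (f g : BC k H A C₁) (e : (E.bc k A).t f = (E.bc k A).s g) :
    BC.map k A ρ ((E.bc k A).comp f g e) = BC.map k A ρ f + BC.map k A ρ g := by
  rw [IntCat.comp_eq, BC.map_sub, BC.map_add, bc_i, BC.map_comp_zero hρ, sub_zero]

end IntCat

namespace Lie2Data

variable {ρ : D.C₁ →ₗ[H] X} {b : Poly2 k H D.C₀ X X} {c : Poly3 k H D.C₀ D.C₀ D.C₀ X}

lemma map_idn (hρ : ∀ x, ρ (D.cat.i x) = 0) (p : BC k H A D.C₀) :
    BC.map k A ρ (D.idn p) = 0 := BC.map_comp_zero hρ p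

/-- The hypothesis is an equality of two polylinear maps, so their extensions agree as well. The
pair `(ρ, b)` will be `prKer` with `kerBr` for `S`, and the second coordinate with `b₀₁` for `T`. -/
lemma ext_br_left (hl : ∀ f x, BC.map k _ ρ (D.br₁ f (D.cat.i x)) = b.opp (ρ f) x)
    (p : BC k H A D.C₁) (q : BC k H B D.C₀) :
    BC.map k _ ρ (ext2 D.br₁ p (D.idn q)) = ext2 b.opp (BC.map k _ ρ p) q := by
  have e : (D.br₁.pre LinearMap.id D.cat.i).post ρ = b.opp.pre ρ LinearMap.id := by
    ext f x
    exact hl f x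
  have e' := DFunLike.congr_fun (DFunLike.congr_fun (congrArg ext2 e) p) q
  rw [ext2_post, ext2_pre, ext2_pre, BC.map_id, BC.map_id] at e'
  exact e'

lemma ext_br_right (hr : ∀ x f, BC.map k _ ρ (D.br₁ (D.cat.i x) f) = b x (ρ f))
    (p : BC k H A D.C₀) (q : BC k H B D.C₁) :
    BC.map k _ ρ (ext2 D.br₁ (D.idn p) q) = ext2 b p (BC.map k _ ρ q) := by
  have e : (D.br₁.pre D.cat.i LinearMap.id).post ρ = b.pre LinearMap.id ρ := by
    ext f x
    exact hr f x
  have e' := DFunLike.congr_fun (DFunLike.congr_fun (congrArg ext2 e) p) q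
  rw [ext2_post, ext2_pre, ext2_pre, BC.map_id, BC.map_id] at e'
  exact e'

variable (b c) in
/-- The difference of the arrow parts of the two sides of the coherence law of the Jacobiator. -/
def hexDiff (x y z w : D.C₀) : BC k H (H ⊗[k] (H ⊗[k] (H ⊗[k] H))) X :=
  ext2 b (one k H x) (c y z w)
    - BC.push (Hm.ord_2_134 k H H H H H) (ext2 b (one k H y) (c x z w))
    + BC.push (Hm.ord_3_124 k H H H H H) (ext2 b (one k H z) (c x y w))
    - BC.push (Hm.ord_4_123 k H H H H H) (ext2 b (one k H w) (c x y z))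
    - BC.push (Hm.ord_12_34 k H H H H H) (ext3 c (D.br₀ x y) (one k H z) (one k H w))
    + BC.push (Hm.ord_13_24 k H H H H H) (ext3 c (D.br₀ x z) (one k H y) (one k H w))
    - BC.push (Hm.ord_14_23 k H H H H H) (ext3 c (D.br₀ x w) (one k H y) (one k H z))
    - BC.push (Hm.ord_23_14 k H H H H H) (ext3 c (D.br₀ y z) (one k H x) (one k H w))
    + BC.push (Hm.ord_24_13 k H H H H H) (ext3 c (D.br₀ y w) (one k H x) (one k H z))
    - BC.push (Hm.ord_34_12 k H H H H H) (ext3 c (D.br₀ z w) (one k H x) (one k H y))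

/-- `c (y, z, p) = c (p, y, z)` up to the order of the tensor factors. -/
lemma skew_rot (hc : c.IsSkew) (p : BC k H A D.C₀) (q : BC k H B D.C₀) (r : BC k H C D.C₀) :
    ext3 c q r p = BC.push ((Hm.swap12 k H A B C).trans (Hm.swap23 k H B A C)) (ext3 c p q r) := by
  rw [hc.ext3_23 q p r, hc.ext3_12 p q r, BC.push_neg, neg_neg, BC.push_push]

section Parts

variable (x y z w : D.C₀)

/-- The degree 1 entry of `[J * w]` is on the left, while `b` expects it on the right; the flip
produces the sign and the order `ord_4_123`. -/
lemma map_hexL1 (hl : ∀ f x, BC.map k _ ρ (D.br₁ f (D.cat.i x)) = b.opp (ρ f) x)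
    (hJ : ∀ x y z, BC.map k _ ρ (D.J x y z) = c x y z) :
    BC.map k _ ρ (D.hexL1 (one k H x) (one k H y) (one k H z) (one k H w)) =
      -BC.push (Hm.ord_4_123 k H H H H H) (ext2 b (one k H w) (c x y z)) := by
  refine (BC.push_map' _ _ _).trans ((congrArg _ (ext_br_left hl _ _)).trans ?_)
  rw [map_ext3 hJ, ext3_one, ext2_opp, BC.push_neg, BC.push_push]
  rfl

/-- The inner bracket is in the second slot of the Jacobiator. One transposition brings it to the
first slot and costs a sign. -/
lemma map_hexL2 (hJ : ∀ x y z, BC.map k _ ρ (D.J x y z) = c x y z) (hc : c.IsSkew) :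
    BC.map k _ ρ (D.hexL2 (one k H x) (one k H y) (one k H z) (one k H w)) =
      -BC.push (Hm.ord_23_14 k H H H H H) (ext3 c (D.br₀ y z) (one k H x) (one k H w)) -
      -BC.push (Hm.ord_13_24 k H H H H H) (ext3 c (D.br₀ x z) (one k H y) (one k H w)) := by
  refine (BC.map_sub _ _ _).trans (congrArg₂ (· - ·) ((BC.push_map' _ _ _).trans ?_)
    ((BC.push_map' _ _ _).trans ?_))
  · rw [map_ext3 hJ, ext2_one, hc.ext3_12 (D.br₀ y z), BC.push_neg, BC.push_push]
    refine congrArg _ (BC.push_congr ?_ _)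
    intro e
    refine Hm.ext_tmul22 ?_ e
    intro _ _ _ _
    rfl
  · rw [map_ext3 hJ, ext2_one, hc.ext3_12 (D.br₀ x z), BC.push_neg, BC.push_push]
    refine congrArg _ (BC.push_congr ?_ _)
    intro e
    refine Hm.ext_tmul22 ?_ e
    intro _ _ _ _
    rfl

/-- Here the inner bracket is in the last slot, and moving it to the front is a 3-cycle, so no sign
appears. -/
lemma map_hexL3 (hr : ∀ x f, BC.map k _ ρ (D.br₁ (D.cat.i x) f) = b x (ρ f))
    (hJ : ∀ x y z, BC.map k _ ρ (D.J x y z) = c x y z) (hc : c.IsSkew) :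
    BC.map k _ ρ (D.hexL3 (one k H x) (one k H y) (one k H z) (one k H w)) =
      ext2 b (one k H x) (c y z w)
      - BC.push (Hm.ord_14_23 k H H H H H) (ext3 c (D.br₀ x w) (one k H y) (one k H z))
      - BC.push (Hm.ord_2_134 k H H H H H) (ext2 b (one k H y) (c x z w))
      + BC.push (Hm.ord_24_13 k H H H H H) (ext3 c (D.br₀ y w) (one k H x) (one k H z)) := by
  refine (BC.map_add _ _ _).trans ?_
  refine congrArg₂ (· + ·) ((BC.map_sub _ _ _).trans (congrArg₂ (· - ·)
    ((BC.map_sub _ _ _).trans (congrArg₂ (· - ·) ?_ ?_)) ?_)) ?_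
  · rw [ext_br_right hr, map_ext3 hJ, ext3_one]
  · refine (BC.push_map' _ _ _).trans ?_
    rw [map_ext3 hJ, ext2_one, skew_rot hc (D.br₀ x w), BC.push_push]
    refine BC.push_congr ?_ _
    intro e
    refine Hm.ext_tmul22 ?_ e
    intro _ _ _ _
    rfl
  · refine (BC.push_map' _ _ _).trans ?_
    rw [ext_br_right hr, map_ext3 hJ, ext3_one]
  · refine (BC.push_map' _ _ _).trans ?_
    rw [map_ext3 hJ, ext2_one, skew_rot hc (D.br₀ y w), BC.push_push]
    refine BC.push_congr ?_ _
    intro e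
    refine Hm.ext_tmul22 ?_ e
    intro _ _ _ _
    rfl

lemma map_hexR1 (hJ : ∀ x y z, BC.map k _ ρ (D.J x y z) = c x y z) :
    BC.map k _ ρ (D.hexR1 (one k H x) (one k H y) (one k H z) (one k H w)) =
      BC.push (Hm.ord_12_34 k H H H H H) (ext3 c (D.br₀ x y) (one k H z) (one k H w)) := by
  refine (BC.push_map' _ _ _).trans ?_
  rw [map_ext3 hJ, ext2_one]

/-- The identities in this arrow and in the next one only make sources and targets match; `ρ`
removes them. -/
lemma map_hexR2 (hρ : ∀ x, ρ (D.cat.i x) = 0)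
    (hr : ∀ x f, BC.map k _ ρ (D.br₁ (D.cat.i x) f) = b x (ρ f))
    (hJ : ∀ x y z, BC.map k _ ρ (D.J x y z) = c x y z) :
    BC.map k _ ρ (D.hexR2 (one k H x) (one k H y) (one k H z) (one k H w)) =
      -BC.push (Hm.ord_3_124 k H H H H H) (ext2 b (one k H z) (c x y w)) := by
  refine (BC.map_sub _ _ _).trans ?_
  rw [map_idn hρ, zero_sub]
  refine congrArg _ ((BC.push_map' _ _ _).trans ?_)
  rw [ext_br_right hr, map_ext3 hJ, ext3_one]

lemma map_hexR3 (hρ : ∀ x, ρ (D.cat.i x) = 0)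
    (hJ : ∀ x y z, BC.map k _ ρ (D.J x y z) = c x y z) (hc : c.IsSkew) :
    BC.map k _ ρ (D.hexR3 (one k H x) (one k H y) (one k H z) (one k H w)) =
      BC.push (Hm.ord_34_12 k H H H H H) (ext3 c (D.br₀ z w) (one k H x) (one k H y)) := by
  refine (BC.map_add _ _ _).trans ?_
  rw [map_idn hρ, add_zero]
  refine (BC.map_sub _ _ _).trans ?_
  rw [map_idn hρ, sub_zero, map_ext3 hJ, ext2_one, skew_rot hc (D.br₀ z w)]
  refine BC.push_congr ?_ _
  intro e
  refine Hm.ext_tmul22 ?_ e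
  intro _ _ _ _
  rfl

/-- The letters `a` to `j` stand for the ten terms of `hexDiff` in their order. -/
lemma hexDiff_aux {Y : Type*} [AddCommGroup Y] (a b c d e f g h i j : Y) :
    (-d + (-h - -f) + (a - g - b + i)) - (e + -c + j) =
      a - b + c - d - e + f - g - h + i - j := by abel

/-- Under `ρ` each side of the coherence law becomes the sum of its three arrows. After sorting by
skew-symmetry, the terms that survive are the ten terms of axiom 5. Keeping `ρ` abstract makes the
computation serve `S` and `T` alike. -/
lemma map_hexL_sub_hexR (hD : D.IsGraph) (hρ : ∀ x, ρ (D.cat.i x) = 0)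
    (hl : ∀ f x, BC.map k _ ρ (D.br₁ f (D.cat.i x)) = b.opp (ρ f) x)
    (hr : ∀ x f, BC.map k _ ρ (D.br₁ (D.cat.i x) f) = b x (ρ f))
    (hJ : ∀ x y z, BC.map k _ ρ (D.J x y z) = c x y z) (hc : c.IsSkew) :
    BC.map k _ ρ (hD.hexL (one k H x) (one k H y) (one k H z) (one k H w)) -
      BC.map k _ ρ (hD.hexR (one k H x) (one k H y) (one k H z) (one k H w)) =
    hexDiff b c x y z w := by
  refine (congrArg₂ (· - ·)
    ((IntCat.map_comp_of_map_i D.cat hρ _ _ _).trans (congrArg₂ (· + ·)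
      ((IntCat.map_comp_of_map_i D.cat hρ _ _ _).trans (congrArg₂ (· + ·)
        (map_hexL1 x y z w hl hJ) (map_hexL2 x y z w hJ hc))) (map_hexL3 x y z w hr hJ hc)))
    ((IntCat.map_comp_of_map_i D.cat hρ _ _ _).trans (congrArg₂ (· + ·)
      ((IntCat.map_comp_of_map_i D.cat hρ _ _ _).trans (congrArg₂ (· + ·)
        (map_hexR1 x y z w hJ) (map_hexR2 x y z w hρ hr hJ))) (map_hexR3 x y z w hρ hJ hc)))).trans ?_
  exact hexDiff_aux _ _ _ _ _ _ _ _ _ _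

end Parts

end Lie2Data

end Hexagon

end HPseudo

end
-- The 2-term algebra on the kernel of the source map: `S` on objects.
noncomputable section

namespace HPseudo

open BC (one)

variable {k : Type w} [Field k] {H : Type u} [Ring H] [HopfAlgebra k H]
variable {A : Type*} [Ring A] [Algebra k A] [OverH k H A]
variable {B : Type*} [Ring B] [Algebra k B] [OverH k H B]
variable {C : Type*} [Ring C] [Algebra k C] [OverH k H C]
variable [Coalgebra.IsCocomm k H]

namespace Lie2Data

variable {D D' D'' : Lie2Data.{w, u, v} k H}

lemma prKer_coe (f : D.C₁) : (D.prKer f : D.C₁) = D.cat.pr f := rfl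

lemma prKer_subtype (u : LinearMap.ker D.cat.s) : D.prKer u = u := by
  apply Subtype.ext
  rw [prKer_coe, IntCat.pr_apply, LinearMap.mem_ker.1 u.2, map_zero, sub_zero]

lemma prKer_i (x : D.C₀) : D.prKer (D.cat.i x) = 0 := Subtype.ext (D.cat.pr_i x)

lemma pr_coe_ker (u : LinearMap.ker D.cat.s) : D.cat.pr u = u :=
  congrArg Subtype.val (prKer_subtype u)

lemma prKer_pr (f : D.C₁) : D.prKer (D.cat.pr f) = D.prKer f := prKer_subtype (D.prKer f)

lemma map_subtype_injective : Function.Injective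
    (BC.map k A (LinearMap.ker D.cat.s).subtype) := BC.map_injective (ρ := D.prKer) prKer_subtype

lemma map_subtype_map_prKer (x : BC k H A D.C₁) :
    BC.map k A (LinearMap.ker D.cat.s).subtype (BC.map k A D.prKer x) = BC.map k A D.cat.pr x :=
  BC.map_map _ _ _

/-- The composite of an arrow starting at `0` with an identity. -/
lemma IntCat.comp_of_eq_zero {R : Type*} [Ring R] {C₀ C₁ : Type*} [AddCommGroup C₀] [Module R C₀]
    [AddCommGroup C₁] [Module R C₁] (E : IntCat R C₀ C₁) (f g : C₁) (e : E.t f = E.s g)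
    (hf : f = 0) : E.comp f g e = g := by
  rw [IntCat.comp_eq, hf, map_zero, map_zero, zero_add, sub_zero]

variable (D) in
/-- The arrow part of `[1 * u]`, for `u` in the kernel of the source map. -/
def kerBr : Poly2 k H D.C₀ (LinearMap.ker D.cat.s) (LinearMap.ker D.cat.s) :=
  (D.br₁.pre D.cat.i (LinearMap.ker D.cat.s).subtype).post D.prKer

variable (D) in
/-- The arrow part of the Jacobiator, in the kernel of the source map. -/
def kerJ : Poly3 k H D.C₀ D.C₀ D.C₀ (LinearMap.ker D.cat.s) := D.J.post D.prKer

variable (D) in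
/-- The target map on the kernel of the source map. -/
def kerT : LinearMap.ker D.cat.s →ₗ[H] D.C₀ := D.cat.t ∘ₗ (LinearMap.ker D.cat.s).subtype

variable (D) in
/-- A form of `S D` in which the modules are transparent. -/
abbrev ker : TwoTermData.{w, u, v} k H where
  L₀ := D.C₀
  L₁ := LinearMap.ker D.cat.s
  d := D.kerT
  b₀₀ := D.br₀
  b₀₁ := D.kerBr
  b₃ := D.kerJ

namespace IsLie2

variable (hD : D.IsLie2)

include hD

/-- Write `f` as its arrow part plus `1_{s f}`. The second summand contributes `[1_{s f} * 1_x] =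
1_{[s f * x]}`, which `prKer` kills. -/
lemma map_prKer_br_left (f : D.C₁) (x : D.C₀) :
    BC.map k _ D.prKer (D.br₁ f (D.cat.i x)) = D.kerBr.opp (D.prKer f) x := by
  have e : D.kerBr.opp (D.prKer f) x = BC.map k _ D.prKer (D.br₁ (D.cat.pr f) (D.cat.i x)) := by
    rw [hD.skew₁ (D.cat.i x) (D.cat.pr f), BC.map_neg, ← BC.push_map]
    rfl
  have e' : D.br₁ f (D.cat.i x) = D.br₁ (D.cat.pr f) (D.cat.i x) +
      D.br₁ (D.cat.i (D.cat.s f)) (D.cat.i x) := by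
    rw [← D.br₁.add_left, IntCat.pr_apply, sub_add_cancel]
  rw [e, e', hD.br_id, BC.map_add]
  refine (congrArg (_ + ·) (BC.map_comp_zero prKer_i _)).trans (add_zero _)

lemma map_prKer_br_right (x : D.C₀) (f : D.C₁) :
    BC.map k _ D.prKer (D.br₁ (D.cat.i x) f) = D.kerBr x (D.prKer f) := by
  rw [hD.skew₁ f (D.cat.i x), BC.map_neg, ← BC.push_map, hD.map_prKer_br_left]
  change -BC.push _ (-BC.push _ _) = _
  -- Skew-symmetry of the bracket and the definition of `opp` each contribute a flip and a sign;
  -- both pairs cancel.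
  rw [BC.push_neg, neg_neg, BC.push_push]
  refine BC.push_id ?_ _
  intro e
  exact (Algebra.TensorProduct.comm k H H).symm_apply_apply e

/-- The bracket of two arrows that start at `0`, computed in two ways. -/
lemma br_ker (f g : D.C₁) (hf : D.cat.s f = 0) (hg : D.cat.s g = 0) :
    D.br₁ f g = D.br₁ (D.cat.i (D.cat.t f)) g ∧ D.br₁ f g = D.br₁ f (D.cat.i (D.cat.t g)) := by
  have h0 : D.cat.t 0 = D.cat.s g := by rw [map_zero, hg]
  have h0' : D.cat.t 0 = D.cat.s f := by rw [map_zero, hf]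
  have h1 := (D.cat.s_i (D.cat.t f)).symm
  have h1' := (D.cat.s_i (D.cat.t g)).symm
  constructor
  -- Interchange law for `f = f ; 1_{t f}` and `g = 0 ; g`, where `0` is the identity of the object
  -- `0`. It gives `[f * g] = [f * 0] ; [1_{t f} * g]`, whose first factor is `0`.
  · have e := hD.br_comp f (D.cat.i (D.cat.t f)) 0 g h1 h0
    rw [IntCat.comp_of_eq_zero D.cat 0 g h0 rfl] at e
    have e' : D.cat.comp f (D.cat.i (D.cat.t f)) h1 = f := D.cat.comp_id f
    rw [e', IntCat.comp_of_eq_zero D.E2 _ _ _ (D.br₁.zero_right f)] at e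
    exact e
  -- The same law with the roles exchanged: `f = 0 ; f` and `g = g ; 1_{t g}`.
  · have e := hD.br_comp 0 f g (D.cat.i (D.cat.t g)) h0' h1'
    rw [IntCat.comp_of_eq_zero D.cat 0 f h0' rfl] at e
    have e' : D.cat.comp g (D.cat.i (D.cat.t g)) h1' = g := D.cat.comp_id g
    rw [e', IntCat.comp_of_eq_zero D.E2 _ _ _ (D.br₁.zero_left g)] at e
    exact e

/-- The skew-symmetry of the Jacobiator is stated for arrow parts as elements of `C₁`. It descends
to `ker s` because the inclusion of `ker s` stays injective after `A ⊗_H -`. -/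
lemma kerJ_skew : D.kerJ.IsSkew := by
  constructor
  · intro x y z
    refine map_subtype_injective ?_
    rw [BC.map_neg, ← BC.push_map]
    refine (map_subtype_map_prKer _).trans (Eq.trans ?_
      (congrArg (fun a => -BC.push _ a) (map_subtype_map_prKer _).symm))
    have e := hD.J_skew₁₂ x y z
    rw [IntCat.arrow_eq, IntCat.arrow_eq] at e
    exact (IntCat.bc_pr _ _).symm.trans (e.trans
      (congrArg (fun a => -BC.push _ a) (IntCat.bc_pr _ _)))
  · intro x y z
    refine map_subtype_injective ?_
    rw [BC.map_neg, ← BC.push_map]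
    refine (map_subtype_map_prKer _).trans (Eq.trans ?_
      (congrArg (fun a => -BC.push _ a) (map_subtype_map_prKer _).symm))
    have e := hD.J_skew₂₃ x y z
    rw [IntCat.arrow_eq, IntCat.arrow_eq] at e
    exact (IntCat.bc_pr _ _).symm.trans (e.trans
      (congrArg (fun a => -BC.push _ a) (IntCat.bc_pr _ _)))

-- The arrow part of `f` runs from `0` to `t f - s f`. The terms in which `β₁` is applied to an
-- arrow part, in the axioms for algebras and for homomorphisms, are computed from this.
omit hD in
lemma map_kerT_prKer (f : BC k H A D.C₁) : BC.map k A D.kerT (BC.map k A D.prKer f) =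
    BC.map k A D.cat.t f - BC.map k A D.cat.s f := by
  rw [← BC.map_sub_hom]
  exact BC.map_comp_eq (D.cat.t_pr) f

/-- This is naturality of the Jacobiator at `1_x`, `1_y` and `v : 0 → t v`. The component at the
sources is `J_{x,y,0} = 0`, the one at the targets is `J_{x,y,t v}`, and `prKer` turns the two
composites into sums. -/
lemma kerBr_kerBr (x y : D.C₀) (v : LinearMap.ker D.cat.s) :
    nestL D.kerBr D.br₀ (one k H x) (one k H y) (one k H v)
      - nestR D.kerBr D.kerBr (one k H x) (one k H y) (one k H v)
      + nestM D.kerBr D.kerBr (one k H x) (one k H y) (one k H v) =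
    -D.kerJ x y (D.kerT v) := by
  have e := congrArg (BC.map k _ D.prKer) (hD.J_nat (D.cat.i x) (D.cat.i y) v)
  have e1 : BC.map k _ D.prKer (nestL D.br₁ D.br₁ (one k H (D.cat.i x)) (one k H (D.cat.i y))
      (one k H (v : D.C₁))) =
      nestL D.kerBr D.br₀ (one k H x) (one k H y) (one k H v) := by
    refine (BC.push_map' _ _ _).trans (congrArg _ ?_)
    rw [ext2_one, hD.br_id]
    refine (ext_br_right (b := D.kerBr) hD.map_prKer_br_right _ _).trans ?_
    rw [BC.map_one, prKer_subtype, ext2_one]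
  have e2 : ∀ x y : D.C₀, BC.map k _ D.prKer (ext2 D.br₁ (one k H (D.cat.i x))
      (ext2 D.br₁ (one k H (D.cat.i y)) (one k H (v : D.C₁)))) =
      ext2 D.kerBr (one k H x) (ext2 D.kerBr (one k H y) (one k H v)) := by
    intro x y
    rw [← BC.map_one, ← BC.map_one]
    refine (ext_br_right (b := D.kerBr) hD.map_prKer_br_right _ _).trans (congrArg _ ?_)
    refine (ext_br_right (b := D.kerBr) hD.map_prKer_br_right _ _).trans (congrArg _ ?_)
    rw [BC.map_one, prKer_subtype]
  have e3 := (IntCat.map_comp_of_map_i D.cat prKer_i _ _ _).symm.trans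
    (e.trans (IntCat.map_comp_of_map_i D.cat prKer_i _ _ _))
  rw [D.cat.t_i, D.cat.t_i, D.cat.s_i, D.cat.s_i, LinearMap.mem_ker.1 v.2, D.J.zero_right,
    BC.map_zero, zero_add, e1] at e3
  have e4 := e3.trans ((BC.map_sub _ _ _).trans (congrArg₂ (· - ·) (e2 x y)
    ((BC.push_map' _ _ _).trans (congrArg _ (e2 y x)))))
  have e5 : ∀ {Y : Type _} [AddCommGroup Y] (a b c d : Y), a + d = b - c → a - b + c = -d := by
    intro Y _ a b c d h
    rw [eq_neg_iff_add_eq_zero, ← sub_eq_zero.2 h]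
    abel
  exact e5 _ _ _ _ e4

/-- Axioms 1 and 3 compare target and source, of `[1_x * u]` and of `J`. Axiom 2 is the interchange
law in the form `br_ker`, axiom 4 the naturality of `J`, and axiom 5 its coherence law. -/
lemma ker : D.ker.IsTwoTerm where
  skew₂ := hD.skew₀
  skew₃ := hD.kerJ_skew
  ax1 x u := by
    refine (map_kerT_prKer _).trans ?_
    refine (congrArg₂ (· - ·) (hD.t_br (D.cat.i x) u) (hD.s_br (D.cat.i x) u)).trans ?_
    -- The source `[x * s u] = [x * 0]` vanishes, which leaves the target `[x * t u]`.
    rw [D.cat.t_i, LinearMap.mem_ker.1 u.2, D.br₀.zero_right, sub_zero]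
    rfl
  ax2 u v := by
    have e := hD.br_ker u v u.2 v.2
    have e1 := hD.map_prKer_br_left u (D.cat.t v)
    rw [prKer_subtype, ← e.2, e.1] at e1
    exact e1
  ax3 x y z := by
    refine Eq.trans ?_ (congrArg Neg.neg (map_kerT_prKer (D.J x y z)).symm)
    refine Eq.trans ?_ (congrArg Neg.neg (congrArg₂ (· - ·) (hD.t_J x y z) (hD.s_J x y z))).symm
    exact (sub_add _ _ _).trans (neg_sub _ _).symm
  ax4 := hD.kerBr_kerBr
  ax5 x y z w := by
    refine (map_hexL_sub_hexR (ρ := D.prKer) (b := D.kerBr) (c := D.kerJ) x y z w hD.toIsGraph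
      prKer_i hD.map_prKer_br_left hD.map_prKer_br_right (fun _ _ _ => rfl)
      hD.kerJ_skew).symm.trans ?_
    exact sub_eq_zero.2 (congrArg _ (hD.hexagon x y z w))

lemma S : D.S.IsTwoTerm := hD.ker

end IsLie2

end Lie2Data

end HPseudo

end
-- Transport of coherence laws, and `S` on homomorphisms.
noncomputable section

namespace HPseudo

open BC (one)

variable {k : Type w} [Field k] {H : Type u} [Ring H] [HopfAlgebra k H]
variable {A : Type*} [Ring A] [Algebra k A] [OverH k H A]
variable {B : Type*} [Ring B] [Algebra k B] [OverH k H B]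
variable {C : Type*} [Ring C] [Algebra k C] [OverH k H C]
variable [Coalgebra.IsCocomm k H]

lemma Poly2.map_opp {L L' M M' N N' : Type*} [AddCommGroup L] [Module H L] [AddCommGroup L']
    [Module H L'] [AddCommGroup M] [Module H M] [AddCommGroup M'] [Module H M'] [AddCommGroup N]
    [Module H N] [AddCommGroup N'] [Module H N'] {β : Poly2 k H L M N} {β' : Poly2 k H L' M' N'}
    {φ : L →ₗ[H] L'} {ψ : M →ₗ[H] M'} {χ : N →ₗ[H] N'}
    (h : ∀ x y, BC.map k _ χ (β x y) = β' (φ x) (ψ y)) (y : M) (x : L) :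
    BC.map k _ χ (β.opp y x) = β'.opp (ψ y) (φ x) :=
  (BC.map_neg _ _).trans (congrArg Neg.neg ((BC.push_map _ _ _).symm.trans (congrArg _ (h x y))))

namespace TwoTermData

variable {T T' K K' : TwoTermData.{w, u, v} k H}

section Transfer

variable {f : HomData T T'} {g : HomData K K'} {φ : T.L₀ →ₗ[H] K.L₀} {φ' : T'.L₀ →ₗ[H] K'.L₀}
  {ψ' : T'.L₁ →ₗ[H] K'.L₁}

/-- Strict maps `φ` between the domains and `φ'`, `ψ'` between the codomains relate `f` to `g`.
Nothing is required of `f₁` and `g₁`, since the terms `UL` and `UR` do not involve them. -/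
lemma HomData.map_UL (h₀ : ∀ x, φ' (f.f₀ x) = g.f₀ (φ x))
    (h₂ : ∀ x y, BC.map k _ ψ' (f.f₂ x y) = g.f₂ (φ x) (φ y))
    (hφ : ∀ x y, BC.map k _ φ (T.b₀₀ x y) = K.b₀₀ (φ x) (φ y))
    (hψ : ∀ x u, BC.map k _ ψ' (T'.b₀₁ x u) = K'.b₀₁ (φ' x) (ψ' u)) (p : BC k H A T.L₀)
    (q : BC k H B T.L₀) (r : BC k H C T.L₀) :
    BC.map k _ ψ' (f.UL p q r) = g.UL (BC.map k _ φ p) (BC.map k _ φ q) (BC.map k _ φ r) := by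
  refine (BC.map_add _ _ _).trans (congrArg₂ (· + ·) ?_ ?_)
  · refine (map_ext2 (φ := ψ') (ψ := φ') (Poly2.map_opp hψ) _ _).trans ?_
    exact congrArg₂ (fun a b => ext2 K'.b₁₀ a b) (map_ext2 h₂ p q) (BC.map_comp_congr h₀ r)
  · refine (map_ext2 h₂ _ _).trans ?_
    exact congrArg (fun a => ext2 g.f₂ a _) (map_ext2 hφ p q)

lemma HomData.map_UR (h₀ : ∀ x, φ' (f.f₀ x) = g.f₀ (φ x))
    (h₂ : ∀ x y, BC.map k _ ψ' (f.f₂ x y) = g.f₂ (φ x) (φ y))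
    (hφ : ∀ x y, BC.map k _ φ (T.b₀₀ x y) = K.b₀₀ (φ x) (φ y))
    (hψ : ∀ x u, BC.map k _ ψ' (T'.b₀₁ x u) = K'.b₀₁ (φ' x) (ψ' u)) (p : BC k H A T.L₀)
    (q : BC k H B T.L₀) (r : BC k H C T.L₀) :
    BC.map k _ ψ' (f.UR p q r) = g.UR (BC.map k _ φ p) (BC.map k _ φ q) (BC.map k _ φ r) := by
  refine (BC.map_add _ _ _).trans (congrArg₂ (· + ·) ?_ ?_)
  · refine (map_ext2 hψ _ _).trans ?_
    exact congrArg₂ (fun a b => ext2 K'.b₀₁ a b) (BC.map_comp_congr h₀ p) (map_ext2 h₂ q r)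
  · refine (map_ext2 h₂ _ _).trans ?_
    exact congrArg (fun a => ext2 g.f₂ _ a) (map_ext2 hφ q r)

/-- The left hand side of the coherence law of a homomorphism -/
def HomData.coh (f : HomData T T') (x y z : T.L₀) : BC k H (H ⊗[k] (H ⊗[k] H)) T'.L₁ :=
  BC.push (Hm.assoc k H H H H) (f.UL (one k H x) (one k H y) (one k H z))
    - f.UR (one k H x) (one k H y) (one k H z)
    + BC.push (Hm.swap12 k H H H H) (f.UR (one k H y) (one k H x) (one k H z))

/-- This is used twice: with `ψ' = prKer`, to pass from arrow parts in `C₁` to `ker s`, and with `ψ'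
= inr`, to pass from `L₁` to the arrows of `T(L)`. -/
lemma HomData.map_coh (h₀ : ∀ x, φ' (f.f₀ x) = g.f₀ (φ x))
    (h₂ : ∀ x y, BC.map k _ ψ' (f.f₂ x y) = g.f₂ (φ x) (φ y))
    (hφ : ∀ x y, BC.map k _ φ (T.b₀₀ x y) = K.b₀₀ (φ x) (φ y))
    (hψ : ∀ x u, BC.map k _ ψ' (T'.b₀₁ x u) = K'.b₀₁ (φ' x) (ψ' u)) (x y z : T.L₀) :
    BC.map k _ ψ' (f.coh x y z) = g.coh (φ x) (φ y) (φ z) := by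
  have eL := HomData.map_UL h₀ h₂ hφ hψ (one k H x) (one k H y) (one k H z)
  have eR := fun x y => HomData.map_UR h₀ h₂ hφ hψ (one k H x) (one k H y) (one k H z)
  simp only [BC.map_one] at eL eR
  refine (BC.map_add _ _ _).trans (congrArg₂ (· + ·) ((BC.map_sub _ _ _).trans
    (congrArg₂ (· - ·) ?_ (eR x y))) ?_)
  · exact (BC.push_map' _ _ _).trans (congrArg _ eL)
  · exact (BC.push_map' _ _ _).trans (congrArg _ (eR y x))

end Transfer

lemma HomData.UL_of_zero {f₀ : T.L₀ →ₗ[H] T'.L₀} {f₁ : T.L₁ →ₗ[H] T'.L₁} (p : BC k H A T.L₀)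
    (q : BC k H B T.L₀) (r : BC k H C T.L₀) : (⟨f₀, f₁, 0⟩ : HomData T T').UL p q r = 0 := by
  rw [HomData.UL, ext2_zero_hom, ext2_zero_hom, map_zero, AddMonoidHom.zero_apply, add_zero]

lemma HomData.UR_of_zero {f₀ : T.L₀ →ₗ[H] T'.L₀} {f₁ : T.L₁ →ₗ[H] T'.L₁} (p : BC k H A T.L₀)
    (q : BC k H B T.L₀) (r : BC k H C T.L₀) : (⟨f₀, f₁, 0⟩ : HomData T T').UR p q r = 0 := by
  rw [HomData.UR, ext2_zero_hom, ext2_zero_hom, map_zero, add_zero]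

/-- A morphism that preserves the structure strictly. -/
lemma IsHom.of_strict {f₀ : T.L₀ →ₗ[H] T'.L₀} {f₁ : T.L₁ →ₗ[H] T'.L₁}
    (hd : ∀ u, f₀ (T.d u) = T'.d (f₁ u))
    (h₀₀ : ∀ x y, BC.map k _ f₀ (T.b₀₀ x y) = T'.b₀₀ (f₀ x) (f₀ y))
    (h₀₁ : ∀ x u, BC.map k _ f₁ (T.b₀₁ x u) = T'.b₀₁ (f₀ x) (f₁ u))
    (h₃ : ∀ x y z, BC.map k _ f₁ (T.b₃ x y z) = T'.b₃ (f₀ x) (f₀ y) (f₀ z)) :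
    IsHom (⟨f₀, f₁, 0⟩ : HomData T T') where
  skew x y := by
    change 0 = -BC.push _ 0
    rw [map_zero, neg_zero]
  ax1 := hd
  ax2 x y := (sub_eq_zero.2 (h₀₀ x y)).trans (BC.map_zero _).symm
  ax3 x u := sub_eq_zero.2 (h₀₁ x u)
  ax4 x y z := by
    refine (IsHom.ax4_iff _ x y z).2 (Eq.trans ?_ (sub_eq_zero.2 (h₃ x y z).symm).symm)
    rw [HomData.UL_of_zero, HomData.UR_of_zero, HomData.UR_of_zero, map_zero, map_zero, sub_zero,
      add_zero]

end TwoTermData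

namespace Lie2Data

variable {D D' D'' : Lie2Data.{w, u, v} k H} {F : HomData D D'} {G : HomData D' D''}

/-- The restriction of `F₁` to the kernels of the source maps. -/
def IsGraphHom.kerMap (hF : IsGraphHom F) :
    LinearMap.ker D.cat.s →ₗ[H] LinearMap.ker D'.cat.s :=
  F.F₁.restrict (p := LinearMap.ker D.cat.s) (q := LinearMap.ker D'.cat.s) (fun u hu => by
    rw [LinearMap.mem_ker] at hu ⊢
    rw [hF.s_F, hu, map_zero])

/-- A form of `S F` in which the modules are transparent. -/
abbrev IsGraphHom.ker (hF : IsGraphHom F) : TwoTermData.HomData D.ker D'.ker where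
  f₀ := F.F₀
  f₁ := hF.kerMap
  f₂ := F.F₂.post D'.prKer

lemma IsGraphHom.prKer_F₁ (hF : IsGraphHom F)
    (hF' : ∀ x, F.F₁ (D.cat.i x) = D'.cat.i (F.F₀ x)) (f : D.C₁) :
    D'.prKer (F.F₁ f) = hF.kerMap (D.prKer f) := Subtype.ext (pr_F₁ hF hF' f)

/-- This is the hypothesis `hψ` of `HomData.map_coh` for the projection `prKer`. -/
lemma IsLie2.map_prKer_a₀₁ (hD : D.IsLie2) (x : D.C₀) (f : D.C₁) :
    BC.map k _ D.prKer (D.a₀₁ x f) = D.kerBr x (D.prKer f) :=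
  (hD.map_prKer_br_right x (D.cat.pr f)).trans (congrArg _ (prKer_pr f))

lemma map_prKer_map_pr (f : BC k H A D.C₁) :
    BC.map k A D.prKer (BC.map k A D.cat.pr f) = BC.map k A D.prKer f :=
  BC.map_comp_eq prKer_pr f

lemma a₀₁_ker (x : D.C₀) (u : LinearMap.ker D.cat.s) :
    BC.map k _ D.prKer (D.a₀₁ x u) = D.kerBr x u := by
  change BC.map k _ D.prKer (D.br₁ (D.cat.i x) (D.cat.pr u)) = _
  rw [pr_coe_ker]
  rfl

/-- Axioms 3 and 4 are already available for `F.arr`, where degree 1 is all of `C₁`; applying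
`prKer` brings them to `ker s`. Axiom 2 is the difference of target and source of `F₂`. -/
lemma IsHom.ker (hD : D.IsLie2) (hD' : D'.IsLie2)
    (hF : IsHom hD.toIsGraph hD'.toIsGraph F) : TwoTermData.IsHom hF.toIsGraphHom.ker where
  skew x y := by
    change BC.map k _ D'.prKer (F.F₂ y x) = -BC.push _ (BC.map k _ D'.prKer (F.F₂ x y))
    rw [hF.F₂_skew x y, BC.map_neg, BC.push_map]
  ax1 u := (hF.t_F u).symm
  ax2 x y := by
    refine Eq.trans ?_ (IsLie2.map_kerT_prKer _).symm
    exact congrArg₂ (· - ·) (hF.t_F₂ x y).symm (hF.s_F₂ x y).symm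
  ax3 x u := by
    have e := congrArg (BC.map k _ D'.prKer) ((hF.arr hD hD').ax3 x u)
    have e1 : BC.map k _ D'.prKer (BC.map k _ F.F₁ (D.a₀₁ x u)) =
        BC.map k _ hF.kerMap (D.kerBr x u) :=
      (BC.map_comp_congr (hF.prKer_F₁ hF.F_id) _).trans (congrArg _ (a₀₁_ker x u))
    have e2 : BC.map k _ D'.prKer (D'.a₀₁ (F.F₀ x) (F.F₁ u)) =
        D'.kerBr (F.F₀ x) (hF.kerMap u) := a₀₁_ker (F.F₀ x) (hF.kerMap u)
    -- The differential of `D.arr` is `t - s`, which restricts to `t` on `ker s`.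
    have e3 : D.arr.d u = D.kerT u := by
      change D.cat.t u - D.cat.s u = _
      rw [LinearMap.mem_ker.1 u.2, sub_zero]
      rfl
    rw [e3] at e
    exact (congrArg₂ (· - ·) e1 e2).symm.trans ((BC.map_sub _ _ _).symm.trans
      (e.trans (map_prKer_map_pr _)))
  ax4 x y z := by
    refine (TwoTermData.IsHom.ax4_iff hF.toIsGraphHom.ker x y z).2 ?_
    have e := congrArg (BC.map k _ D'.prKer)
      ((TwoTermData.IsHom.ax4_iff F.arr x y z).1 ((hF.arr hD hD').ax4 x y z))
    have e1 := TwoTermData.HomData.map_coh (f := F.arr) (g := hF.toIsGraphHom.ker)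
      (φ := LinearMap.id) (φ' := LinearMap.id) (ψ' := D'.prKer) (fun _ => rfl)
      (fun x y => map_prKer_map_pr _) (fun x y => BC.map_id _) hD'.map_prKer_a₀₁ x y z
    refine e1.symm.trans (e.trans ((BC.map_sub _ _ _).trans (congrArg₂ (· - ·) ?_ ?_)))
    · exact map_prKer_map_pr _
    · refine (BC.map_comp_congr (hF.prKer_F₁ hF.F_id) _).trans (congrArg _ ?_)
      exact map_prKer_map_pr _

end Lie2Data

/-- The construction `S` is functorial. -/
lemma isFunctorS (k : Type w) [Field k] (H : Type u) [Ring H] [HopfAlgebra k H]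
    [Coalgebra.IsCocomm k H] : IsFunctorS.{w, u, v} k H where
  obj D := D.ax.S
  map {D D'} F := Lie2Data.IsHom.ker D.ax D'.ax F.isHom
  map_id D := by
    refine TwoTermData.HomData.ext rfl rfl ?_
    ext x y
    -- The transformation of the identity homomorphism consists of identities, whose arrow parts
    -- vanish.
    exact BC.map_comp_zero Lie2Data.prKer_i _
  map_comp {D D' D''} F G := by
    refine TwoTermData.HomData.ext rfl rfl ?_
    ext x y
    change BC.map k _ D''.prKer (Lie2Data.compF₂ F.isHom.toIsGraphHom G.isHom.toIsGraphHom x y) =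
      BC.map k _ D''.prKer (G.F₂ (F.F₀ x) (F.F₀ y)) +
        BC.map k _ G.isHom.kerMap (BC.map k _ D'.prKer (F.F₂ x y))
    -- The transformation of a composite is a composite of arrows, so its arrow part is a sum; this
    -- is the composition law for `f₂`.
    refine (IntCat.map_comp_of_map_i D''.cat Lie2Data.prKer_i _ _ _).trans (congrArg _ ?_)
    exact BC.map_comp_congr (G.isHom.prKer_F₁ G.isHom.F_id) _

end HPseudo

end
-- The Lie-2 pseudoalgebra on `L₀ ⊕ L₁`: `T` on objects.
noncomputable section

namespace HPseudo

open BC (one)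

variable {k : Type w} [Field k] {H : Type u} [Ring H] [HopfAlgebra k H]
variable {A : Type*} [Ring A] [Algebra k A] [OverH k H A]
variable {B : Type*} [Ring B] [Algebra k B] [OverH k H B]
variable {C : Type*} [Ring C] [Algebra k C] [OverH k H C]
variable [Coalgebra.IsCocomm k H]

lemma Poly2.opp_opp {L M N : Type*} [AddCommGroup L] [Module H L] [AddCommGroup M] [Module H M]
    [AddCommGroup N] [Module H N] (β : Poly2 k H L M N) (x : L) (y : M) :
    -BC.push (Hm.swap k H H H) (β.opp y x) = β x y := by
  change -BC.push _ (-BC.push _ _) = _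
  rw [BC.push_neg, neg_neg, BC.push_push]
  refine BC.push_id ?_ _
  intro e
  exact (Algebra.TensorProduct.comm k H H).symm_apply_apply e

section Swap

variable {L M N P Q : Type*} [AddCommGroup L] [Module H L] [AddCommGroup M] [Module H M]
  [AddCommGroup N] [Module H N] [AddCommGroup P] [Module H P] [AddCommGroup Q] [Module H Q]

/-- With its five companions this records how transpositions permute the three terms of the Jacobi
identity: `(2 3)` exchanges the nestings `L` and `M` and fixes `R`, while `(1 2)` exchanges `R` and
`M` and fixes `L`. A sign and an `opp` appear when the two arguments of one of the brackets trade
places. The fourth axiom is moved in this way from one position of its degree 1 element to another.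
-/
lemma push_swap23_nestL (β' : Poly2 k H N P Q) (β : Poly2 k H L M N) (p : BC k H A L)
    (q : BC k H B M) (r : BC k H C P) :
    BC.push (Hm.swap23 k H A B C) (nestL β' β p q r) = -nestM β'.opp β p r q := by
  rw [nestM, ext2_opp, BC.push_neg, neg_neg, nestL, BC.push_push, BC.push_push]
  refine BC.push_congr ?_ _
  intro e
  refine Hm.ext_tmulL ?_ e
  intro _ _ _
  rfl

lemma push_swap23_nestR (β' : Poly2 k H P N Q) (β : Poly2 k H L M N) (p : BC k H A P)
    (q : BC k H B L) (r : BC k H C M) :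
    BC.push (Hm.swap23 k H A B C) (nestR β' β p q r) = -nestR β' β.opp p r q := by
  rw [nestR, nestR, ext2_opp, map_neg, neg_neg, ext2_push_right]
  rfl

lemma push_swap23_nestM (β' : Poly2 k H P N Q) (β : Poly2 k H L M N) (p : BC k H A L)
    (q : BC k H B P) (r : BC k H C M) :
    BC.push (Hm.swap23 k H A B C) (nestM β' β p q r) = -nestL β'.opp β p r q := by
  rw [nestL, ext2_opp, BC.push_neg, neg_neg, nestM, BC.push_push, BC.push_push]
  refine BC.push_congr ?_ _
  intro e
  refine Hm.ext_tmulR ?_ e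
  intro _ _ _
  rfl

lemma push_swap12_nestL (β' : Poly2 k H N P Q) (β : Poly2 k H L M N) (p : BC k H A L)
    (q : BC k H B M) (r : BC k H C P) :
    BC.push (Hm.swap12 k H A B C) (nestL β' β p q r) = -nestL β' β.opp q p r := by
  rw [nestL, nestL, ext2_opp, map_neg, AddMonoidHom.neg_apply, BC.push_neg, neg_neg,
    ext2_push_left, BC.push_push, BC.push_push]
  refine BC.push_congr ?_ _
  intro e
  refine Hm.ext_tmulL ?_ e
  intro _ _ _
  rfl

lemma push_swap12_nestR (β' : Poly2 k H P N Q) (β : Poly2 k H L M N) (p : BC k H A P)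
    (q : BC k H B L) (r : BC k H C M) :
    BC.push (Hm.swap12 k H A B C) (nestR β' β p q r) = nestM β' β q p r := rfl

lemma push_swap12_nestM (β' : Poly2 k H P N Q) (β : Poly2 k H L M N) (p : BC k H A L)
    (q : BC k H B P) (r : BC k H C M) :
    BC.push (Hm.swap12 k H A B C) (nestM β' β p q r) = nestR β' β q p r := by
  rw [nestM, nestR, BC.push_push]
  refine BC.push_id ?_ _
  intro e
  exact (Algebra.TensorProduct.leftComm k B A C).symm_apply_apply e

end Swap

/-- Both paths start at `[[[x * y] * z] * w]`; only the two ways of reassociating four tensor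
factors have to be compared. -/
lemma Lie2Data.IsGraph.s_hexL1 {D : Lie2Data.{w, u, v} k H} (hD : D.IsGraph) {A₄ : Type*} [Ring A₄]
    [Algebra k A₄] [OverH k H A₄] (x : BC k H A D.C₀) (y : BC k H B D.C₀) (z : BC k H C D.C₀)
    (w : BC k H A₄ D.C₀) :
    (D.cat.bc k _).s (D.hexL1 x y z w) = (D.cat.bc k _).s (D.hexR1 x y z w) := by
  refine (hD.s_br' (ext3 D.J x y z) (D.idn w) _).trans
    (Eq.trans ?_ (hD.s_J' (ext2 D.br₀ x y) z w _).symm)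
  rw [D.s_idn w, hD.s_ext3 x y z, nestL, ext2_push_left, BC.push_push]
  refine BC.push_congr ?_ _
  intro e
  refine Hm.ext_tmulL ?_ e
  intro a b c
  -- The leftmost block is itself a tensor product `A ⊗ B` and has to be decomposed once more.
  induction a using TensorProduct.induction_on with
  | zero => simp only [TensorProduct.zero_tmul, map_zero]
  | add a a' h h' => simp only [TensorProduct.add_tmul, map_add, h, h']
  | tmul a a' => rfl

namespace TwoTermData

variable {K : TwoTermData.{w, u, v} k H}

namespace IsTwoTerm

variable (hK : K.IsTwoTerm)

include hK

lemma ax1' (u : K.L₁) (x : K.L₀) : BC.map k _ K.d (K.b₁₀ u x) = K.b₀₀ (K.d u) x := by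
  refine (BC.map_neg _ _).trans ((congrArg Neg.neg ((BC.push_map _ _ _).symm.trans
    (congrArg _ (hK.ax1 x u)))).trans ?_)
  exact (hK.skew₂ x (K.d u)).symm

lemma ext_ax1' (p : BC k H A K.L₁) (q : BC k H B K.L₀) :
    BC.map k _ K.d (ext2 K.b₁₀ p q) = ext2 K.b₀₀ (BC.map k _ K.d p) q := by
  refine (map_ext2 (φ := K.d) (ψ := LinearMap.id) hK.ax1' p q).trans ?_
  rw [BC.map_id]

lemma ext_ax2 (p : BC k H A K.L₁) (q : BC k H B K.L₁) :
    ext2 K.b₀₁ (BC.map k _ K.d p) q = ext2 K.b₁₀ p (BC.map k _ K.d q) := by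
  have e : K.b₀₁.pre K.d LinearMap.id = K.b₁₀.pre LinearMap.id K.d := by
    ext u v
    exact hK.ax2 u v
  have e' := DFunLike.congr_fun (DFunLike.congr_fun (congrArg ext2 e) p) q
  rwa [ext2_pre, ext2_pre, BC.map_id, BC.map_id] at e'

/-- The fourth axiom, with the element of degree 1 in the middle. -/
lemma ax4_middle (x : K.L₀) (v : K.L₁) (z : K.L₀) :
    nestL K.b₁₀ K.b₀₁ (one k H x) (one k H v) (one k H z)
      - nestR K.b₀₁ K.b₁₀ (one k H x) (one k H v) (one k H z)
      + nestM K.b₁₀ K.b₀₀ (one k H x) (one k H v) (one k H z) = -K.b₃ x (K.d v) z := by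
  -- The axiom is taken at `(x, z, v)`, so that the transposition puts `v` in the middle; on the
  -- right hand side the skew-symmetry of `β₃` absorbs it.
  have e := congrArg (BC.push (Hm.swap23 k H H H H)) (hK.ax4 x z v)
  rw [BC.push_add, BC.push_sub, push_swap23_nestL, push_swap23_nestR, push_swap23_nestM,
    BC.push_neg, ← hK.skew₃.2] at e
  rw [← e, b₁₀]
  abel

/-- The fourth axiom, with the element of degree 1 on the left. -/
lemma ax4_left (u : K.L₁) (y z : K.L₀) :
    nestL K.b₁₀ K.b₁₀ (one k H u) (one k H y) (one k H z)
      - nestR K.b₁₀ K.b₀₀ (one k H u) (one k H y) (one k H z)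
      + nestM K.b₀₁ K.b₁₀ (one k H u) (one k H y) (one k H z) = -K.b₃ (K.d u) y z := by
  -- A second transposition moves the degree 1 element from the middle to the left.
  have e := congrArg (BC.push (Hm.swap12 k H H H H)) (hK.ax4_middle y u z)
  rw [BC.push_add, BC.push_sub, push_swap12_nestL, push_swap12_nestR, push_swap12_nestM,
    BC.push_neg, ← hK.skew₃.1] at e
  rw [← e]
  change _ = -(-nestL K.b₁₀ K.b₁₀ _ _ _ - _ + _)
  abel

end IsTwoTerm

variable (K)

/-- The target map of the arrows `L₀ ⊕ L₁`. -/
def tgt : K.L₀ × K.L₁ →ₗ[H] K.L₀ := LinearMap.fst H K.L₀ K.L₁ + K.d ∘ₗ LinearMap.snd H K.L₀ K.L₁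

/-- The category `L₀ ⊕ L₁ ⇉ L₀`. -/
def pairCat : IntCat H K.L₀ (K.L₀ × K.L₁) :=
  IntCat.ofReflexive (LinearMap.fst H K.L₀ K.L₁) K.tgt (LinearMap.inl H K.L₀ K.L₁)
    (fun _ => rfl) (fun x => (congrArg (x + ·) (map_zero K.d)).trans (add_zero x))

/-- The pseudobracket of the arrows `L₀ ⊕ L₁`. -/
def pairBr : Poly2 k H (K.L₀ × K.L₁) (K.L₀ × K.L₁) (K.L₀ × K.L₁) :=
  (K.b₀₀.pre (LinearMap.fst H K.L₀ K.L₁) (LinearMap.fst H K.L₀ K.L₁)).post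
      (LinearMap.inl H K.L₀ K.L₁) +
    (K.b₀₁.pre (LinearMap.fst H K.L₀ K.L₁) (LinearMap.snd H K.L₀ K.L₁) +
      K.b₁₀.pre (LinearMap.snd H K.L₀ K.L₁) (LinearMap.fst H K.L₀ K.L₁) +
      K.b₀₁.pre (K.d ∘ₗ LinearMap.snd H K.L₀ K.L₁) (LinearMap.snd H K.L₀ K.L₁)).post
      (LinearMap.inr H K.L₀ K.L₁)

/-- The Jacobiator with arrow part `β₃`. -/
def pairJ : Poly3 k H K.L₀ K.L₀ K.L₀ (K.L₀ × K.L₁) :=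
  (nestLPoly K.b₀₀ K.b₀₀).post (LinearMap.inl H K.L₀ K.L₁) +
    K.b₃.post (LinearMap.inr H K.L₀ K.L₁)

/-- A form of `T K` in which the modules are transparent. -/
abbrev pair : Lie2Data.{w, u, v} k H where
  C₀ := K.L₀
  C₁ := K.L₀ × K.L₁
  cat := K.pairCat
  br₀ := K.b₀₀
  br₁ := K.pairBr
  J := K.pairJ

variable {K}

section Components

variable {X Y : Type*} [AddCommGroup X] [Module H X] [AddCommGroup Y] [Module H Y]

lemma map_fst_inl_add_inr (a : BC k H A X) (b : BC k H A Y) :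
    BC.map k A (LinearMap.fst H X Y) (BC.map k A (LinearMap.inl H X Y) a +
      BC.map k A (LinearMap.inr H X Y) b) = a := by
  rw [BC.map_add, BC.map_comp_id (fun _ => rfl), BC.map_comp_zero (fun _ => rfl), add_zero]

lemma map_snd_inl_add_inr (a : BC k H A X) (b : BC k H A Y) :
    BC.map k A (LinearMap.snd H X Y) (BC.map k A (LinearMap.inl H X Y) a +
      BC.map k A (LinearMap.inr H X Y) b) = b := by
  rw [BC.map_add, BC.map_comp_id (fun _ => rfl), BC.map_comp_zero (fun _ => rfl), zero_add]

end Components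

lemma map_tgt (f : BC k H A (K.L₀ × K.L₁)) :
    BC.map k A K.tgt f = BC.map k A (LinearMap.fst H K.L₀ K.L₁) f +
      BC.map k A K.d (BC.map k A (LinearMap.snd H K.L₀ K.L₁) f) := by
  rw [tgt, BC.map_add_hom, ← BC.map_map]

lemma map_fst_pairBr (f g : K.L₀ × K.L₁) :
    BC.map k _ (LinearMap.fst H K.L₀ K.L₁) (K.pairBr f g) = K.b₀₀ f.1 g.1 :=
  map_fst_inl_add_inr _ _

/-- For `f = (x, u)` and `g = (y, v)` the terms `β₂(x, v)` and `β₂(β₁ u, v)` merge into `β₂(t f,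
v)`. What results is the arrow part of `[f * 1_{s g}] ; [1_{t f} * g]`, and in this form the later
computations telescope. -/
lemma map_snd_pairBr (f g : K.L₀ × K.L₁) :
    BC.map k _ (LinearMap.snd H K.L₀ K.L₁) (K.pairBr f g) =
      K.b₀₁ (K.tgt f) g.2 + K.b₁₀ f.2 g.1 := by
  refine (map_snd_inl_add_inr _ _).trans ?_
  change K.b₀₁ f.1 g.2 + K.b₁₀ f.2 g.1 + K.b₀₁ (K.d f.2) g.2 =
    K.b₀₁ (f.1 + K.d f.2) g.2 + K.b₁₀ f.2 g.1
  rw [K.b₀₁.add_left]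
  abel

lemma map_fst_ext_pairBr (p : BC k H A (K.L₀ × K.L₁)) (q : BC k H B (K.L₀ × K.L₁)) :
    BC.map k _ (LinearMap.fst H K.L₀ K.L₁) (ext2 K.pairBr p q) =
      ext2 K.b₀₀ (BC.map k _ (LinearMap.fst H K.L₀ K.L₁) p)
        (BC.map k _ (LinearMap.fst H K.L₀ K.L₁) q) := map_ext2 map_fst_pairBr p q

lemma map_snd_ext_pairBr (p : BC k H A (K.L₀ × K.L₁)) (q : BC k H B (K.L₀ × K.L₁)) :
    BC.map k _ (LinearMap.snd H K.L₀ K.L₁) (ext2 K.pairBr p q) =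
      ext2 K.b₀₁ (BC.map k _ K.tgt p) (BC.map k _ (LinearMap.snd H K.L₀ K.L₁) q) +
      ext2 K.b₁₀ (BC.map k _ (LinearMap.snd H K.L₀ K.L₁) p)
        (BC.map k _ (LinearMap.fst H K.L₀ K.L₁) q) := by
  have e : K.pairBr.post (LinearMap.snd H K.L₀ K.L₁) =
      K.b₀₁.pre K.tgt (LinearMap.snd H K.L₀ K.L₁) +
      K.b₁₀.pre (LinearMap.snd H K.L₀ K.L₁) (LinearMap.fst H K.L₀ K.L₁) := by
    ext f g
    exact map_snd_pairBr f g
  have e' := DFunLike.congr_fun (DFunLike.congr_fun (congrArg ext2 e) p) q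
  rwa [ext2_post, ext2_add_hom, ext2_pre, ext2_pre] at e'

lemma map_fst_pairJ (x y z : K.L₀) : BC.map k _ (LinearMap.fst H K.L₀ K.L₁) (K.pairJ x y z) =
    nestL K.b₀₀ K.b₀₀ (one k H x) (one k H y) (one k H z) := map_fst_inl_add_inr _ _

lemma map_snd_pairJ (x y z : K.L₀) : BC.map k _ (LinearMap.snd H K.L₀ K.L₁) (K.pairJ x y z) =
    K.b₃ x y z := map_snd_inl_add_inr _ _

lemma pair_ext {f g : BC k H A (K.L₀ × K.L₁)} (hs : (K.pairCat.bc k A).s f = (K.pairCat.bc k A).s g)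
    (h : BC.map k A (LinearMap.snd H K.L₀ K.L₁) f = BC.map k A (LinearMap.snd H K.L₀ K.L₁) g) :
    f = g := BC.prod_ext hs h

/-- Identities are the pairs `(x, 0)`, so the second coordinate is a map that kills them. -/
lemma map_snd_comp (f g : BC k H A (K.L₀ × K.L₁))
    (e : (K.pairCat.bc k A).t f = (K.pairCat.bc k A).s g) :
    BC.map k A (LinearMap.snd H K.L₀ K.L₁) ((K.pairCat.bc k A).comp f g e) =
      BC.map k A (LinearMap.snd H K.L₀ K.L₁) f + BC.map k A (LinearMap.snd H K.L₀ K.L₁) g :=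
  IntCat.map_comp_of_map_i K.pairCat (fun _ => rfl) f g e

lemma pairCat_pr (f : K.L₀ × K.L₁) : K.pairCat.pr f = (0, f.2) := by
  refine Prod.ext (sub_self f.1) ?_
  exact sub_zero f.2

lemma map_pr_inl_add_inr (a : BC k H A K.L₀) (b : BC k H A K.L₁) :
    BC.map k A K.pairCat.pr (BC.map k A (LinearMap.inl H K.L₀ K.L₁) a +
      BC.map k A (LinearMap.inr H K.L₀ K.L₁) b) = BC.map k A (LinearMap.inr H K.L₀ K.L₁) b := by
  rw [BC.map_add, BC.map_comp_zero (fun x => pairCat_pr (x, 0)),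
    BC.map_comp_eq (χ := LinearMap.inr H K.L₀ K.L₁) (fun u => pairCat_pr (0, u)), zero_add]

namespace IsTwoTerm

variable (hK : K.IsTwoTerm)

include hK

/-- For the target of a bracket, axiom 1 in both mixed positions gives `β₂(x, y) + β₂(t f, β₁ v) +
β₂(β₁ u, y)`, which biadditivity reassembles to `β₂(t f, t g)`. The target of the Jacobiator is
axiom 3. -/
lemma pair_isGraph : K.pair.IsGraph where
  s_br := map_fst_pairBr
  t_br f g := by
    refine (map_tgt (K.pairBr f g)).trans ?_
    rw [map_fst_pairBr, map_snd_pairBr, BC.map_add, hK.ax1, hK.ax1', ← add_assoc, add_right_comm,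
      ← K.b₀₀.add_left]
    exact (K.b₀₀.add_right _ _ _).symm
  s_J := map_fst_pairJ
  t_J x y z := by
    refine (map_tgt (K.pairJ x y z)).trans ?_
    rw [map_fst_pairJ, map_snd_pairJ, ← sub_neg_eq_add, ← hK.ax3]
    abel

lemma map_snd_pairBr_left (f : K.L₀ × K.L₁) (x : K.L₀) :
    BC.map k _ (LinearMap.snd H K.L₀ K.L₁) (K.pairBr f (K.pairCat.i x)) = K.b₁₀ f.2 x :=
  (map_snd_pairBr f (x, 0)).trans ((congrArg (· + _) (K.b₀₁.zero_right _)).trans (zero_add _))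

lemma map_snd_pairBr_right (x : K.L₀) (f : K.L₀ × K.L₁) :
    BC.map k _ (LinearMap.snd H K.L₀ K.L₁) (K.pairBr (K.pairCat.i x) f) = K.b₀₁ x f.2 := by
  refine (map_snd_pairBr (x, 0) f).trans ((congrArg (_ + ·) (K.b₁₀.zero_left _)).trans ?_)
  rw [add_zero]
  exact congrArg (fun a => K.b₀₁ a f.2) (K.pairCat.t_i x)

/-- Let `u'` and `v` be the second coordinates of `f'` and `g`. After expansion the two sides differ
only in that one contains `β₂(β₁ u', v)` and the other `β₂(u', β₁ v)`, so the interchange law is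
axiom 2. -/
lemma pair_br_comp (f f' g g' : K.L₀ × K.L₁) (e : K.pairCat.t f = K.pairCat.s f')
    (e' : K.pairCat.t g = K.pairCat.s g') :
    K.pairBr (K.pairCat.comp f f' e) (K.pairCat.comp g g' e') =
      (K.pairCat.bc k _).comp (K.pairBr f g) (K.pairBr f' g')
        (hK.pair_isGraph.t_br_comp f f' g g' e e') := by
  refine pair_ext ?_ ?_
  · refine (hK.pair_isGraph.s_br _ _).trans (Eq.trans ?_ (IntCat.s_comp' _ _ _ _).symm)
    refine Eq.trans ?_ (hK.pair_isGraph.s_br _ _).symm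
    exact congrArg₂ (fun a b => K.b₀₀ a b) (IntCat.s_comp' _ _ _ _) (IntCat.s_comp' _ _ _ _)
  · refine Eq.trans ?_ (map_snd_comp _ _ _).symm
    have h2 : ∀ f g e, (K.pairCat.comp f g e).2 = f.2 + g.2 := by
      intro f g e
      rw [IntCat.comp_eq]
      exact sub_zero _
    have ht : K.tgt (K.pairCat.comp f f' e) = K.tgt f' := K.pairCat.t_comp' f f' e
    have hs : (K.pairCat.comp g g' e').1 = g.1 := K.pairCat.s_comp' g g' e'
    have he : K.tgt f' = K.tgt f + K.d f'.2 := congrArg (· + _) (Eq.symm e)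
    have he' : g'.1 = g.1 + K.d g.2 := Eq.symm e'
    rw [map_snd_pairBr, map_snd_pairBr, map_snd_pairBr, h2, h2, ht, hs, he', K.b₁₀.add_right,
      K.b₁₀.add_left, K.b₀₁.add_right, ← hK.ax2, he, K.b₀₁.add_left _ _ g.2]
    abel

/-- The formula on arrows is lopsided: it uses the target of its first argument and the source of
its second. By axiom 2 the opposite choice gives the same element. -/
lemma pair_skew : K.pairBr.IsSkew := by
  intro f g
  refine BC.prod_ext ?_ ?_
  · rw [BC.map_neg, ← BC.push_map, map_fst_pairBr, map_fst_pairBr]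
    exact hK.skew₂ _ _
  · rw [BC.map_neg, ← BC.push_map, map_snd_pairBr, map_snd_pairBr, BC.push_add, neg_add,
      b₁₀, Poly2.opp_opp]
    change K.b₀₁ (g.1 + K.d g.2) f.2 + K.b₀₁.opp g.2 f.1 =
      K.b₀₁.opp g.2 (f.1 + K.d f.2) + K.b₀₁ g.1 f.2
    rw [K.b₀₁.add_left, K.b₀₁.opp.add_right, hK.ax2]
    change _ + K.b₀₁.opp g.2 (K.d f.2) + _ = _
    abel

/-- There is one term for each position of the degree 1 entry: earlier entries are replaced by their
targets, later ones by their sources. All three nestings are brought to this pattern, which is also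
the one in which `β₃` telescopes in `b₃_tgt`. -/
lemma map_snd_nestL (f g h : K.L₀ × K.L₁) :
    BC.map k _ (LinearMap.snd H K.L₀ K.L₁)
      (nestL K.pairBr K.pairBr (one k H f) (one k H g) (one k H h)) =
    nestL K.b₀₁ K.b₀₀ (one k H (K.tgt f)) (one k H (K.tgt g)) (one k H h.2) +
    (nestL K.b₁₀ K.b₀₁ (one k H (K.tgt f)) (one k H g.2) (one k H h.1) +
    nestL K.b₁₀ K.b₁₀ (one k H f.2) (one k H g.1) (one k H h.1)) := by
  refine (BC.push_map' _ _ _).trans ?_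
  have et : BC.map k _ K.tgt (ext2 K.pairBr (one k H f) (one k H g)) = _ :=
    hK.pair_isGraph.t_ext2 (one k H f) (one k H g)
  rw [map_snd_ext_pairBr, et, map_snd_ext_pairBr, BC.push_add, ext2_add_left, BC.push_add]
  simp only [BC.map_one]
  rfl

lemma map_snd_nestR (f g h : K.L₀ × K.L₁) :
    BC.map k _ (LinearMap.snd H K.L₀ K.L₁)
      (nestR K.pairBr K.pairBr (one k H f) (one k H g) (one k H h)) =
    nestR K.b₀₁ K.b₀₁ (one k H (K.tgt f)) (one k H (K.tgt g)) (one k H h.2) +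
    (nestR K.b₀₁ K.b₁₀ (one k H (K.tgt f)) (one k H g.2) (one k H h.1) +
    nestR K.b₁₀ K.b₀₀ (one k H f.2) (one k H g.1) (one k H h.1)) := by
  refine (map_snd_ext_pairBr _ _).trans ?_
  rw [map_snd_ext_pairBr, map_fst_ext_pairBr, ext2_add_right, add_assoc]
  simp only [BC.map_one]
  rfl

/-- In `[g * [f * h]]` the bracket formula treats `g` as the earlier entry, whereas the common
pattern wants `f` before `g`. The discrepancy is a term of degree 1 in both `f` and `g`, and axioms
2 and 1 identify its two expressions. -/
lemma map_snd_nestM (f g h : K.L₀ × K.L₁) :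
    BC.map k _ (LinearMap.snd H K.L₀ K.L₁)
      (nestM K.pairBr K.pairBr (one k H f) (one k H g) (one k H h)) =
    nestM K.b₀₁ K.b₀₁ (one k H (K.tgt f)) (one k H (K.tgt g)) (one k H h.2) +
    (nestM K.b₁₀ K.b₀₀ (one k H (K.tgt f)) (one k H g.2) (one k H h.1) +
    nestM K.b₀₁ K.b₁₀ (one k H f.2) (one k H g.1) (one k H h.1)) := by
  refine (BC.push_map' _ _ _).trans ?_
  have et : ∀ f : K.L₀ × K.L₁, one k H (K.tgt f) = one k H f.1 + BC.map k _ K.d (one k H f.2) := by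
    intro f
    rw [BC.map_one, ← BC.one_add]
    rfl
  -- With `u`, `v` the second coordinates of `f`, `g` and `z` the source of `h`, the excess is
  -- `β₂(β₁ v, β₂(u, z)) = β₂(v, β₁ β₂(u, z)) = β₂(v, β₂(β₁ u, z))`; the same term is split off in
  -- `e3`.
  have e2 : ext2 K.b₀₁ (one k H (K.tgt g)) (ext2 K.b₁₀ (one k H f.2) (one k H h.1)) =
      ext2 K.b₀₁ (one k H g.1) (ext2 K.b₁₀ (one k H f.2) (one k H h.1)) +
      ext2 K.b₁₀ (one k H g.2) (ext2 K.b₀₀ (BC.map k _ K.d (one k H f.2)) (one k H h.1)) := by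
    rw [et, ext2_add_left, hK.ext_ax2, hK.ext_ax1']
  have e3 : ext2 K.b₁₀ (one k H g.2) (ext2 K.b₀₀ (one k H (K.tgt f)) (one k H h.1)) =
      ext2 K.b₁₀ (one k H g.2) (ext2 K.b₀₀ (one k H f.1) (one k H h.1)) +
      ext2 K.b₁₀ (one k H g.2) (ext2 K.b₀₀ (BC.map k _ K.d (one k H f.2)) (one k H h.1)) := by
    rw [et f, ext2_add_left, ext2_add_right]
  have e4 : BC.map k _ (LinearMap.snd H K.L₀ K.L₁)
        (ext2 K.pairBr (one k H g) (ext2 K.pairBr (one k H f) (one k H h))) =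
      ext2 K.b₀₁ (one k H (K.tgt g)) (ext2 K.b₀₁ (one k H (K.tgt f)) (one k H h.2)) +
      (ext2 K.b₁₀ (one k H g.2) (ext2 K.b₀₀ (one k H (K.tgt f)) (one k H h.1)) +
      ext2 K.b₀₁ (one k H g.1) (ext2 K.b₁₀ (one k H f.2) (one k H h.1))) := by
    refine (map_snd_ext_pairBr _ _).trans ?_
    rw [map_snd_ext_pairBr, map_fst_ext_pairBr, ext2_add_right]
    simp only [BC.map_one]
    change _ + ext2 K.b₀₁ (one k H (K.tgt g)) (ext2 K.b₁₀ (one k H f.2) (one k H h.1)) +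
      ext2 K.b₁₀ (one k H g.2) (ext2 K.b₀₀ (one k H f.1) (one k H h.1)) = _
    rw [e2, e3, add_assoc]
    refine congrArg _ ?_
    abel
  exact (congrArg _ e4).trans ((BC.push_add _ _ _).trans (congrArg _ (BC.push_add _ _ _)))

-- The arguments move from source to target one after the other, from left to right, and each move
-- contributes a term with `β₁` in its slot.
omit hK in
lemma b₃_tgt (f g h : K.L₀ × K.L₁) : K.b₃ (K.tgt f) (K.tgt g) (K.tgt h) =
    K.b₃ f.1 g.1 h.1 + K.b₃ (K.d f.2) g.1 h.1 + K.b₃ (K.tgt f) (K.d g.2) h.1 +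
      K.b₃ (K.tgt f) (K.tgt g) (K.d h.2) := by
  have e (f : K.L₀ × K.L₁) : K.tgt f = f.1 + K.d f.2 := rfl
  rw [← K.b₃.add_left, ← e f, ← K.b₃.add_middle, ← e g, ← K.b₃.add_right, ← e h]

-- The indices 1, 2, 3 stand for a degree 1 entry in the last, middle and first place.
omit hK in
lemma nat_aux {Y : Type*} [AddCommGroup Y] {l₁ l₂ l₃ r₁ r₂ r₃ m₁ m₂ m₃ b b₁ b₂ b₃ : Y}
    (h₁ : l₁ - r₁ + m₁ = -b₁) (h₂ : l₂ - r₂ + m₂ = -b₂) (h₃ : l₃ - r₃ + m₃ = -b₃) :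
    l₁ + (l₂ + l₃) + (b + b₃ + b₂ + b₁) =
      b + (r₁ + (r₂ + r₃) - (m₁ + (m₂ + m₃))) := by
  have e₁ : l₁ = -b₁ - m₁ + r₁ := by rw [← h₁]; abel
  have e₂ : l₂ = -b₂ - m₂ + r₂ := by rw [← h₂]; abel
  have e₃ : l₃ = -b₃ - m₃ + r₃ := by rw [← h₃]; abel
  rw [e₁, e₂, e₃]
  abel

/-- Both composites start at `[[s f * s g] * s h]`. Their second coordinates agree by the sum of the
three forms of axiom 4, one for each of the arrows `f`, `g`, `h`. -/
lemma pair_J_nat (f g h : K.L₀ × K.L₁) :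
    K.pair.E3.comp (nestL K.pairBr K.pairBr (one k H f) (one k H g) (one k H h))
        (K.pairJ (K.tgt f) (K.tgt g) (K.tgt h)) (hK.pair_isGraph.nat₁ f g h) =
      K.pair.E3.comp (K.pairJ f.1 g.1 h.1)
        (nestR K.pairBr K.pairBr (one k H f) (one k H g) (one k H h) -
          nestM K.pairBr K.pairBr (one k H f) (one k H g) (one k H h))
        (hK.pair_isGraph.nat₂ f g h) := by
  refine pair_ext ?_ ?_
  · refine (IntCat.s_comp' _ _ _ _).trans (Eq.trans ?_ (IntCat.s_comp' _ _ _ _).symm)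
    refine (hK.pair_isGraph.s_br' (ext2 K.pairBr (one k H f) (one k H g)) (one k H h)
      (Hm.assoc k H H H H)).trans (Eq.trans ?_ (map_fst_pairJ _ _ _).symm)
    have es : BC.map k _ (LinearMap.fst H K.L₀ K.L₁) (ext2 K.pairBr (one k H f) (one k H g)) = _ :=
      map_fst_ext_pairBr (one k H f) (one k H g)
    refine congrArg (BC.push _) ?_
    refine congrArg₂ (fun a b => ext2 K.b₀₀ a b) (es.trans ?_) (BC.map_one _ _)
    rw [BC.map_one, BC.map_one]
    rfl
  · refine (map_snd_comp _ _ _).trans (Eq.trans ?_ (map_snd_comp _ _ _).symm)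
    rw [map_snd_pairJ, map_snd_pairJ, BC.map_sub, hK.map_snd_nestL, hK.map_snd_nestR,
      hK.map_snd_nestM, b₃_tgt]
    exact nat_aux (hK.ax4 _ _ _) (hK.ax4_middle _ _ _) (hK.ax4_left _ _ _)

omit hK in
lemma pair_arrow_J (x y z : K.L₀) : K.pair.E3.arrow (K.pairJ x y z) =
    BC.map k _ (LinearMap.inr H K.L₀ K.L₁) (K.b₃ x y z) :=
  (IntCat.bc_pr K.pairCat _).trans (map_pr_inl_add_inr _ _)

/-- The two composites share their source, and their second coordinates differ by the left hand side
of axiom 5. -/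
lemma pair_hexagon (x y z w : K.L₀) :
    hK.pair_isGraph.hexL (one k H x) (one k H y) (one k H z) (one k H w) =
      hK.pair_isGraph.hexR (one k H x) (one k H y) (one k H z) (one k H w) := by
  refine pair_ext ?_ ?_
  · refine (IntCat.s_comp' _ _ _ _).trans ((IntCat.s_comp' _ _ _ _).trans (Eq.trans ?_
      ((IntCat.s_comp' _ _ _ _).trans (IntCat.s_comp' _ _ _ _)).symm))
    exact hK.pair_isGraph.s_hexL1 _ _ _ _
  · exact sub_eq_zero.1 ((Lie2Data.map_hexL_sub_hexR (D := K.pair)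
      (ρ := LinearMap.snd H K.L₀ K.L₁) (b := K.b₀₁) (c := K.b₃) x y z w hK.pair_isGraph
      (fun _ => rfl) hK.map_snd_pairBr_left hK.map_snd_pairBr_right map_snd_pairJ
      hK.skew₃).trans (hK.ax5 x y z w))

lemma pair : K.pair.IsLie2 where
  toIsGraph := hK.pair_isGraph
  br_id x y := by
    refine BC.prod_ext ((map_fst_pairBr _ _).trans (BC.map_comp_id (fun _ => rfl) _).symm) ?_
    refine (hK.map_snd_pairBr_left (x, 0) y).trans (Eq.trans ?_
      (BC.map_comp_zero (fun _ => rfl) _).symm)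
    exact K.b₁₀.zero_left _
  br_comp := hK.pair_br_comp
  skew₀ := hK.skew₂
  skew₁ := hK.pair_skew
  J_nat := hK.pair_J_nat
  -- Invertibility is automatic for arrows of a category internal to modules.
  J_iso x y z := K.pair.E3.isIso _
  J_skew₁₂ x y z := by
    rw [pair_arrow_J, pair_arrow_J, hK.skew₃.1, BC.map_neg, BC.push_map]
  J_skew₂₃ x y z := by
    rw [pair_arrow_J, pair_arrow_J, hK.skew₃.2, BC.map_neg, BC.push_map]
  hexagon := hK.pair_hexagon

lemma T : K.T.IsLie2 := hK.pair

end IsTwoTerm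

end TwoTermData

end HPseudo

end
-- `T` on homomorphisms, and the isomorphism from `S(T(L))` to `L`.
noncomputable section

namespace HPseudo

open BC (one)

open CategoryTheory

variable {k : Type w} [Field k] {H : Type u} [Ring H] [HopfAlgebra k H]
variable [Coalgebra.IsCocomm k H]

namespace TwoTermData

variable {K K' K'' : TwoTermData.{w, u, v} k H}

/-- A form of `T f` in which the modules are transparent. -/
abbrev HomData.pair (f : HomData K K') : Lie2Data.HomData K.pair K'.pair where
  F₀ := f.f₀
  F₁ := f.f₀.prodMap f.f₁
  F₂ := (K'.b₀₀.pre f.f₀ f.f₀).post (LinearMap.inl H K'.L₀ K'.L₁) +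
    f.f₂.post (LinearMap.inr H K'.L₀ K'.L₁)

lemma map_fst_pairF₂ (f : HomData K K') (x y : K.L₀) :
    BC.map k _ (LinearMap.fst H K'.L₀ K'.L₁) (f.pair.F₂ x y) = K'.b₀₀ (f.f₀ x) (f.f₀ y) :=
  map_fst_inl_add_inr _ _

lemma map_snd_pairF₂ (f : HomData K K') (x y : K.L₀) :
    BC.map k _ (LinearMap.snd H K'.L₀ K'.L₁) (f.pair.F₂ x y) = f.f₂ x y :=
  map_snd_inl_add_inr _ _

/-- This is the hypothesis `hψ` of `HomData.map_coh` for the inclusion `inr`. -/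
lemma IsTwoTerm.pair_a₀₁_inr (hK : K.IsTwoTerm) (x : K.L₀) (u : K.L₁) :
    BC.map k _ (LinearMap.inr H K.L₀ K.L₁) (K.b₀₁ x u) =
      K.pair.a₀₁ x (LinearMap.inr H K.L₀ K.L₁ u) := by
  have e : K.pairCat.pr (LinearMap.inr H K.L₀ K.L₁ u) = (0, u) := pairCat_pr (0, u)
  change _ = K.pairBr (K.pairCat.i x) (K.pairCat.pr (LinearMap.inr H K.L₀ K.L₁ u))
  rw [e]
  refine BC.prod_ext ?_ ?_
  · rw [BC.map_comp_zero (fun _ => rfl), map_fst_pairBr]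
    exact (K.b₀₀.zero_right _).symm
  · rw [BC.map_comp_id (fun _ => rfl), hK.map_snd_pairBr_right]

namespace IsHom

variable {f : HomData K K'}

lemma tgt_prodMap (hf : IsHom f) (p : K.L₀ × K.L₁) :
    K'.tgt (f.f₀.prodMap f.f₁ p) = f.f₀ (K.tgt p) :=
  Eq.trans (congrArg (f.f₀ p.1 + ·) (hf.ax1 p.2).symm) (map_add f.f₀ p.1 (K.d p.2)).symm

lemma pair_isGraphHom (hf : IsHom f) : Lie2Data.IsGraphHom f.pair where
  s_F p := rfl
  t_F := hf.tgt_prodMap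
  s_F₂ := map_fst_pairF₂ f
  t_F₂ x y := by
    refine (map_tgt _).trans ?_
    rw [map_fst_pairF₂, map_snd_pairF₂, ← hf.ax2, add_sub_cancel]

lemma pair_F_id (f : HomData K K') (x : K.L₀) :
    f.pair.F₁ (K.pairCat.i x) = K'.pairCat.i (f.f₀ x) := Prod.ext rfl (map_zero f.f₁)

lemma map_snd_prodMap (f : HomData K K') {A : Type*} [Ring A] [Algebra k A] [OverH k H A]
    (p : BC k H A (K.L₀ × K.L₁)) :
    BC.map k A (LinearMap.snd H K'.L₀ K'.L₁) (BC.map k A (f.f₀.prodMap f.f₁) p) =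
      BC.map k A f.f₁ (BC.map k A (LinearMap.snd H K.L₀ K.L₁) p) :=
  BC.map_comp_congr (φ := f.f₀.prodMap f.f₁) (ψ := LinearMap.snd H K'.L₀ K'.L₁)
    (φ' := LinearMap.snd H K.L₀ K.L₁) (ψ' := f.f₁) (fun _ => rfl) p

/-- By `coh_iff` only arrow parts matter, and these are the images under `inr` of the two sides of
axiom 4 for `f`. -/
lemma pair_coh (hf : IsHom f) (hK : K.IsTwoTerm) (hK' : K'.IsTwoTerm) (x y z : K.L₀) :
    hf.pair_isGraphHom.cohL hK.pair_isGraph hK'.pair_isGraph (one k H x) (one k H y) (one k H z) =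
      hf.pair_isGraphHom.cohR hK'.pair_isGraph (one k H x) (one k H y) (one k H z) := by
  refine (Lie2Data.coh_iff hK.pair hK'.pair hf.pair_isGraphHom (pair_F_id f) x y z).2 ?_
  have e := HomData.map_coh (f := f) (g := f.pair.arr) (φ := LinearMap.id) (φ' := LinearMap.id)
    (ψ' := LinearMap.inr H K'.L₀ K'.L₁) (fun _ => rfl) (fun x y => (map_pr_inl_add_inr _ _).symm)
    (fun x y => BC.map_id _) hK'.pair_a₀₁_inr x y z
  refine e.symm.trans ((congrArg _ ((ax4_iff f x y z).1 (hf.ax4 x y z))).trans ?_)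
  refine (BC.map_sub _ _ _).trans (congrArg₂ (· - ·) (map_pr_inl_add_inr _ _).symm ?_)
  refine Eq.trans ?_ (congrArg _ (map_pr_inl_add_inr _ _).symm)
  exact BC.map_comp_congr (φ := f.f₁) (ψ := LinearMap.inr H K'.L₀ K'.L₁)
    (φ' := LinearMap.inr H K.L₀ K.L₁) (ψ' := f.f₀.prodMap f.f₁)
    (fun u => Prod.ext (map_zero f.f₀).symm rfl) _

lemma pair (hf : IsHom f) (hK : K.IsTwoTerm) (hK' : K'.IsTwoTerm) :
    Lie2Data.IsHom hK.pair_isGraph hK'.pair_isGraph f.pair where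
  toIsGraphHom := hf.pair_isGraphHom
  F_id := pair_F_id f
  F_comp p q e := by
    have e' := pair_F_id f (K.tgt p)
    rw [IntCat.comp_eq, IntCat.comp_eq, LinearMap.map_sub, LinearMap.map_add]
    refine congrArg (_ - ·) (e'.trans ?_)
    exact congrArg K'.pairCat.i (hf.tgt_prodMap p).symm
  F₂_nat p q := by
    refine pair_ext ?_ ?_
    · refine (IntCat.s_comp' _ _ _ _).trans (Eq.trans ?_ (IntCat.s_comp' _ _ _ _).symm)
      exact (map_fst_pairBr _ _).trans (map_fst_pairF₂ _ _ _).symm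
    · refine (map_snd_comp _ _ _).trans (Eq.trans ?_ (map_snd_comp _ _ _).symm)
      rw [map_snd_pairF₂, map_snd_pairF₂, map_snd_prodMap, map_snd_pairBr, map_snd_pairBr,
        hf.tgt_prodMap, BC.map_add]
      -- Axiom 3 is applied in each variable, at the target of `p` and at the source of `q`. The
      -- error terms are the increments by which `f₂` telescopes from the sources to the targets.
      have e1 := eq_add_of_sub_eq (hf.ax3 (K.tgt p) q.2)
      have e2 := eq_add_of_sub_eq (hf.ax3' p.2 q.1)
      have e3 : f.f₂ (K.tgt p) (K.tgt q) =
          f.f₂ p.1 q.1 + f.f₂ (K.d p.2) q.1 + f.f₂ (K.tgt p) (K.d q.2) := by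
        rw [← f.f₂.add_left]
        exact f.f₂.add_right _ _ _
      rw [e1, e2]
      refine (congrArg (_ + ·) e3).trans ?_
      change K'.b₀₁ (f.f₀ (K.tgt p)) (f.f₁ q.2) + K'.b₁₀ (f.f₁ p.2) (f.f₀ q.1) + _ =
        f.f₂ p.1 q.1 + _
      abel
  F₂_iso x y := K'.pair.E2.isIso _
  F₂_skew x y := by
    refine BC.prod_ext ?_ ?_
    · rw [BC.map_neg, ← BC.push_map, map_fst_pairF₂, map_fst_pairF₂]
      exact (Lie2Data.IsLie2.skew₀ (D := K'.pair) (IsTwoTerm.pair hK')) _ _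
    · rw [BC.map_neg, ← BC.push_map, map_snd_pairF₂, map_snd_pairF₂]
      exact hf.skew x y
  coh := hf.pair_coh hK hK'

end IsHom

/-- If the underlying maps of a strict morphism are invertible, then the inverses are strict. -/
lemma IsHom.of_strict_inverse {f₀ : K.L₀ →ₗ[H] K'.L₀} {f₁ : K.L₁ →ₗ[H] K'.L₁}
    {g₀ : K'.L₀ →ₗ[H] K.L₀} {g₁ : K'.L₁ →ₗ[H] K.L₁}
    (l₀ : ∀ x, g₀ (f₀ x) = x) (r₀ : ∀ x, f₀ (g₀ x) = x)
    (l₁ : ∀ u, g₁ (f₁ u) = u) (r₁ : ∀ u, f₁ (g₁ u) = u)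
    (hd : ∀ u, f₀ (K.d u) = K'.d (f₁ u))
    (h₀₀ : ∀ x y, BC.map k _ f₀ (K.b₀₀ x y) = K'.b₀₀ (f₀ x) (f₀ y))
    (h₀₁ : ∀ x u, BC.map k _ f₁ (K.b₀₁ x u) = K'.b₀₁ (f₀ x) (f₁ u))
    (h₃ : ∀ x y z, BC.map k _ f₁ (K.b₃ x y z) = K'.b₃ (f₀ x) (f₀ y) (f₀ z)) :
    IsHom (⟨g₀, g₁, 0⟩ : HomData K' K) := by
  refine .of_strict (fun u => ?_) (fun x y => ?_) (fun x u => ?_) (fun x y z => ?_)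
  · have e := hd (g₁ u)
    rw [r₁] at e
    rw [← e, l₀]
  · have e := h₀₀ (g₀ x) (g₀ y)
    rw [r₀, r₀] at e
    rw [← e, BC.map_comp_id l₀]
  · have e := h₀₁ (g₀ x) (g₁ u)
    rw [r₀, r₁] at e
    rw [← e, BC.map_comp_id l₁]
  · have e := h₃ (g₀ x) (g₀ y) (g₀ z)
    rw [r₀, r₀, r₀] at e
    rw [← e, BC.map_comp_id l₁]

lemma HomData.comp_of_zero {f₀ : K.L₀ →ₗ[H] K'.L₀} {f₁ : K.L₁ →ₗ[H] K'.L₁}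
    {g₀ : K'.L₀ →ₗ[H] K.L₀} {g₁ : K'.L₁ →ₗ[H] K.L₁}
    (l₀ : ∀ x, g₀ (f₀ x) = x) (l₁ : ∀ u, g₁ (f₁ u) = u) :
    (⟨f₀, f₁, 0⟩ : HomData K K').comp ⟨g₀, g₁, 0⟩ = .id K := by
  refine HomData.ext (LinearMap.ext l₀) (LinearMap.ext l₁) ?_
  ext x y
  exact (congrArg (0 + ·) (BC.map_zero g₁)).trans (add_zero 0)

variable (K) in
/-- The second component of the elements of the kernel of the source map of `L₀ ⊕ L₁`. -/
def kerSnd : LinearMap.ker K.pairCat.s →ₗ[H] K.L₁ :=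
  LinearMap.snd H K.L₀ K.L₁ ∘ₗ (LinearMap.ker K.pairCat.s).subtype

variable (K) in
/-- The inverse of `kerSnd`. -/
def kerInr : K.L₁ →ₗ[H] LinearMap.ker K.pairCat.s :=
  LinearMap.codRestrict _ (LinearMap.inr H K.L₀ K.L₁) (fun _ => LinearMap.mem_ker.2 rfl)

lemma kerSnd_kerInr (u : K.L₁) : K.kerSnd (K.kerInr u) = u := rfl

lemma kerInr_kerSnd (p : LinearMap.ker K.pairCat.s) : K.kerInr (K.kerSnd p) = p :=
  Subtype.ext (Prod.ext (LinearMap.mem_ker.1 p.2).symm rfl)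

lemma kerSnd_prKer (p : K.L₀ × K.L₁) :
    K.kerSnd (K.pair.prKer p) = LinearMap.snd H K.L₀ K.L₁ p := sub_zero p.2

lemma map_kerSnd_prKer {A : Type*} [Ring A] [Algebra k A] [OverH k H A]
    (p : BC k H A (K.L₀ × K.L₁)) :
    BC.map k A K.kerSnd (BC.map k A K.pair.prKer p) = BC.map k A (LinearMap.snd H K.L₀ K.L₁) p :=
  BC.map_comp_eq kerSnd_prKer p

variable (K) in
/-- The isomorphism `S (T K) → K`. -/
abbrev counitHom : HomData K.pair.ker K := ⟨LinearMap.id, K.kerSnd, 0⟩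

variable (K) in
/-- The isomorphism `K → S (T K)`. -/
abbrev counitInv : HomData K K.pair.ker := ⟨LinearMap.id, K.kerInr, 0⟩

lemma kerSnd_d (p : LinearMap.ker K.pairCat.s) : K.pair.kerT p = K.d (K.kerSnd p) :=
  (congrArg (· + K.d p.1.2) (LinearMap.mem_ker.1 p.2)).trans (zero_add _)

lemma IsTwoTerm.map_kerSnd_kerBr (hK : K.IsTwoTerm) (x : K.L₀) (p : LinearMap.ker K.pairCat.s) :
    BC.map k _ K.kerSnd (K.pair.kerBr x p) = K.b₀₁ x (K.kerSnd p) :=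
  (map_kerSnd_prKer _).trans (hK.map_snd_pairBr_right x p)

lemma map_kerSnd_kerJ (x y z : K.L₀) :
    BC.map k _ K.kerSnd (K.pair.kerJ x y z) = K.b₃ x y z :=
  (map_kerSnd_prKer _).trans (map_snd_pairJ x y z)

/-- The projection to `L₁` respects every operation strictly, so the homotopy can be zero. -/
lemma IsTwoTerm.counitHom (hK : K.IsTwoTerm) : IsHom K.counitHom :=
  .of_strict (T := K.pair.ker) (T' := K) (f₀ := LinearMap.id) (f₁ := K.kerSnd)
    (kerSnd_d (K := K)) (fun _ _ => BC.map_id _) hK.map_kerSnd_kerBr (map_kerSnd_kerJ (K := K))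

lemma IsTwoTerm.counitInv (hK : K.IsTwoTerm) : IsHom K.counitInv :=
  .of_strict_inverse (K := K.pair.ker) (K' := K) (f₀ := LinearMap.id) (f₁ := K.kerSnd)
    (g₀ := LinearMap.id) (g₁ := K.kerInr) (fun _ => rfl)
    (fun _ => rfl) kerInr_kerSnd kerSnd_kerInr (kerSnd_d (K := K)) (fun _ _ => BC.map_id _)
    hK.map_kerSnd_kerBr (map_kerSnd_kerJ (K := K))

/-- The counits have no homotopy of their own, so it remains to see that `kerSnd` recovers `f₂` from
the arrow part of `F₂`. -/
lemma IsHom.counit_naturality {f : HomData K K'} (hf : IsHom f) :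
    hf.pair_isGraphHom.ker.comp K'.counitHom = K.counitHom.comp f := by
  refine HomData.ext rfl rfl ?_
  ext x y
  change 0 + BC.map k _ K'.kerSnd (BC.map k _ K'.pair.prKer (f.pair.F₂ x y)) =
    f.f₂ x y + BC.map k _ f.f₁ 0
  rw [map_kerSnd_prKer, map_snd_pairF₂, BC.map_zero, zero_add, add_zero]

end TwoTermData

/-- The construction `T` is functorial. -/
lemma isFunctorT (k : Type w) [Field k] (H : Type u) [Ring H] [HopfAlgebra k H]
    [Coalgebra.IsCocomm k H] : IsFunctorT.{w, u, v} k H where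
  obj K := K.ax.T
  map {K K'} f := TwoTermData.IsHom.pair f.isHom K.ax K'.ax
  map_id K := by
    refine Lie2Data.HomData.ext rfl rfl ?_
    ext x y
    exact (congrArg (_ + ·) (BC.map_zero _)).trans (add_zero _)
  map_comp {K K' K''} f g := by
    refine Lie2Data.HomData.ext rfl rfl ?_
    ext x y
    refine TwoTermData.pair_ext (K := K''.toTwoTermData) ?_ ?_
    · refine Eq.trans ?_ (IntCat.s_comp' _ _ _ _).symm
      refine (TwoTermData.map_fst_pairF₂ (f.toHomData.comp g.toHomData) x y).trans ?_
      exact (TwoTermData.map_fst_pairF₂ g.toHomData (f.f₀ x) (f.f₀ y)).symm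
    · refine (TwoTermData.map_snd_pairF₂ (f.toHomData.comp g.toHomData) x y).trans
        (Eq.trans ?_ (TwoTermData.map_snd_comp _ _ _).symm)
      refine congrArg₂ (· + ·) (TwoTermData.map_snd_pairF₂ g.toHomData (f.f₀ x) (f.f₀ y)).symm ?_
      refine Eq.trans ?_ (TwoTermData.IsHom.map_snd_prodMap g.toHomData _).symm
      exact congrArg _ (TwoTermData.map_snd_pairF₂ f.toHomData x y).symm

/-! ### Strict homomorphisms, and the isomorphism from `C` to `T(S(C))`. -/

namespace Lie2Data

variable {D D' D'' : Lie2Data.{w, u, v} k H}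

namespace IntCat

variable {R : Type*} [Ring R] {C₀ C₁ : Type*} [AddCommGroup C₀] [Module R C₀] [AddCommGroup C₁]
  [Module R C₁]

lemma comp_i_right (E : IntCat R C₀ C₁) (f : C₁) (x : C₀) (e : E.t f = E.s (E.i x)) :
    E.comp f (E.i x) e = f := by
  rw [IntCat.comp_eq, e, E.s_i, add_sub_cancel_right]

lemma comp_i_left (E : IntCat R C₀ C₁) (f : C₁) (x : C₀) (e : E.t (E.i x) = E.s f) :
    E.comp (E.i x) f e = f := by
  rw [IntCat.comp_eq, E.t_i, add_sub_cancel_left]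

end IntCat

/-- The data of a homomorphism for which `F₂` is the identity transformation. -/
abbrev HomData.strict (F₀ : D.C₀ →ₗ[H] D'.C₀) (F₁ : D.C₁ →ₗ[H] D'.C₁) : HomData D D' :=
  ⟨F₀, F₁, (D'.br₀.pre F₀ F₀).post D'.cat.i⟩

/-- The maps `F₀` and `F₁` preserve the whole structure. -/
structure IsStrict (F₀ : D.C₀ →ₗ[H] D'.C₀) (F₁ : D.C₁ →ₗ[H] D'.C₁) : Prop where
  s_F : ∀ f, D'.cat.s (F₁ f) = F₀ (D.cat.s f)
  t_F : ∀ f, D'.cat.t (F₁ f) = F₀ (D.cat.t f)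
  F_id : ∀ x, F₁ (D.cat.i x) = D'.cat.i (F₀ x)
  br₀ : ∀ x y, BC.map k _ F₀ (D.br₀ x y) = D'.br₀ (F₀ x) (F₀ y)
  br₁ : ∀ f g, BC.map k _ F₁ (D.br₁ f g) = D'.br₁ (F₁ f) (F₁ g)
  J : ∀ x y z, BC.map k _ F₁ (D.J x y z) = D'.J (F₀ x) (F₀ y) (F₀ z)

namespace IsStrict

variable {F₀ : D.C₀ →ₗ[H] D'.C₀} {F₁ : D.C₁ →ₗ[H] D'.C₁}

lemma isGraphHom (h : IsStrict F₀ F₁) : IsGraphHom (HomData.strict F₀ F₁) where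
  s_F := h.s_F
  t_F := h.t_F
  s_F₂ x y := D'.E2.s_i _
  t_F₂ x y := (D'.E2.t_i _).trans (h.br₀ x y).symm

lemma isHom (h : IsStrict F₀ F₁) (hD : D.IsLie2) (hD' : D'.IsLie2) :
    IsHom hD.toIsGraph hD'.toIsGraph (HomData.strict F₀ F₁) where
  toIsGraphHom := h.isGraphHom
  F_id := h.F_id
  F_comp f g e := by
    rw [IntCat.comp_eq, IntCat.comp_eq, LinearMap.map_sub, LinearMap.map_add, h.F_id, h.t_F]
  -- One factor of each composite is an identity, so what is left is the preservation of the bracket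
  -- on arrows.
  F₂_nat f g := (IntCat.comp_i_right D'.E2 _ _ _).trans
    ((h.br₁ f g).symm.trans (IntCat.comp_i_left D'.E2 _ _ _).symm)
  F₂_iso x y := D'.E2.isIso _
  F₂_skew x y := by
    change BC.map k _ D'.cat.i (D'.br₀ (F₀ y) (F₀ x)) =
      -BC.push _ (BC.map k _ D'.cat.i (D'.br₀ (F₀ x) (F₀ y)))
    rw [hD'.skew₀ (F₀ x) (F₀ y), BC.map_neg, BC.push_map]
  coh x y z := by
    refine (coh_iff hD hD' h.isGraphHom h.F_id x y z).2 ?_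
    -- An identity transformation has zero arrow part. Every term of the coherence law that contains
    -- it vanishes, and only the compatibility with the Jacobiators remains.
    have e : (HomData.strict F₀ F₁).arr = ⟨F₀, F₁, 0⟩ := by
      refine TwoTermData.HomData.ext rfl rfl ?_
      ext x y
      exact BC.map_comp_zero D'.cat.pr_i _
    have e' : BC.map k _ F₁ (D.arr.b₃ x y z) = D'.arr.b₃ (F₀ x) (F₀ y) (F₀ z) :=
      (pr_map_F₁ h.isGraphHom h.F_id _).symm.trans (congrArg _ (h.J x y z))
    rw [e, TwoTermData.HomData.UL_of_zero, TwoTermData.HomData.UR_of_zero,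
      TwoTermData.HomData.UR_of_zero, map_zero, map_zero, sub_zero, add_zero, e', sub_self]

variable {G₀ : D'.C₀ →ₗ[H] D.C₀} {G₁ : D'.C₁ →ₗ[H] D.C₁}

/-- The inverses of the maps underlying a strict homomorphism are strict. -/
lemma inverse (h : IsStrict F₀ F₁) (l₀ : ∀ x, G₀ (F₀ x) = x) (r₀ : ∀ x, F₀ (G₀ x) = x)
    (l₁ : ∀ f, G₁ (F₁ f) = f) (r₁ : ∀ f, F₁ (G₁ f) = f) : IsStrict G₀ G₁ where
  s_F f := by rw [← l₀ (D.cat.s (G₁ f)), ← h.s_F, r₁]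
  t_F f := by rw [← l₀ (D.cat.t (G₁ f)), ← h.t_F, r₁]
  F_id x := by rw [← l₁ (D.cat.i (G₀ x)), h.F_id, r₀]
  br₀ x y := by
    have e := h.br₀ (G₀ x) (G₀ y)
    rw [r₀, r₀] at e
    rw [← e, BC.map_comp_id l₀]
  br₁ f g := by
    have e := h.br₁ (G₁ f) (G₁ g)
    rw [r₁, r₁] at e
    rw [← e, BC.map_comp_id l₁]
  J x y z := by
    have e := h.J (G₀ x) (G₀ y) (G₀ z)
    rw [r₀, r₀, r₀] at e
    rw [← e, BC.map_comp_id l₁]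

lemma compHom_eq_id (h : IsStrict F₀ F₁) (h' : IsStrict G₀ G₁) (l₀ : ∀ x, G₀ (F₀ x) = x)
    (l₁ : ∀ f, G₁ (F₁ f) = f) : compHom h.isGraphHom h'.isGraphHom = .id D := by
  refine HomData.ext (LinearMap.ext l₀) (LinearMap.ext l₁) ?_
  ext x y
  refine (IntCat.comp_i_left D.E2 _ _ _).trans ?_
  refine (BC.map_comp_congr h'.F_id _).trans (congrArg _ ?_)
  refine (h'.br₀ (F₀ x) (F₀ y)).trans ?_
  rw [l₀, l₀]

end IsStrict

/-- The bracket of two arrows, as a composite of whiskerings. -/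
lemma IsLie2.map_prKer_br (hD : D.IsLie2) (f g : D.C₁) :
    BC.map k _ D.prKer (D.br₁ f g) =
      D.kerBr (D.cat.t f) (D.prKer g) + D.kerBr.opp (D.prKer f) (D.cat.s g) := by
  have h := (D.cat.s_i (D.cat.t f)).symm
  have h' := D.cat.t_i (D.cat.s g)
  -- Interchange law for `f = f ; 1_{t f}` and `g = 1_{s g} ; g`.
  have e := congrArg (BC.map k _ D.prKer) (hD.br_comp f (D.cat.i (D.cat.t f))
    (D.cat.i (D.cat.s g)) g h h')
  rw [IntCat.comp_i_right, IntCat.comp_i_left] at e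
  refine e.trans ((IntCat.map_comp_of_map_i D.cat prKer_i _ _ _).trans ?_)
  rw [hD.map_prKer_br_left, hD.map_prKer_br_right, add_comm]

variable (D) in
/-- The isomorphism `C₁ → C₀ ⊕ ker s`. -/
def split : D.C₁ →ₗ[H] D.C₀ × LinearMap.ker D.cat.s := D.cat.s.prod D.prKer

variable (D) in
/-- The inverse of `split`. -/
def glue : D.C₀ × LinearMap.ker D.cat.s →ₗ[H] D.C₁ :=
  D.cat.i.coprod (LinearMap.ker D.cat.s).subtype

lemma glue_split (f : D.C₁) : D.glue (D.split f) = f := add_sub_cancel _ _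

lemma split_glue (p : D.C₀ × LinearMap.ker D.cat.s) : D.split (D.glue p) = p := by
  have e : D.cat.s (D.cat.i p.1 + p.2) = p.1 := by
    rw [map_add, D.cat.s_i, LinearMap.mem_ker.1 p.2.2, add_zero]
  refine Prod.ext e ((map_add D.prKer _ _).trans ?_)
  change D.prKer (D.cat.i p.1) + D.prKer p.2 = p.2
  rw [prKer_i, prKer_subtype, zero_add]

lemma tgt_split (f : D.C₁) : D.ker.tgt (D.split f) = D.cat.t f := by
  change D.cat.s f + D.cat.t (D.cat.pr f) = _
  rw [D.cat.t_pr, add_sub_cancel]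

lemma map_fst_split {A : Type*} [Ring A] [Algebra k A] [OverH k H A] (f : BC k H A D.C₁) :
    BC.map k A (LinearMap.fst H D.C₀ (LinearMap.ker D.cat.s)) (BC.map k A D.split f) =
      BC.map k A D.cat.s f := BC.map_comp_eq (fun _ => rfl) f

lemma map_snd_split {A : Type*} [Ring A] [Algebra k A] [OverH k H A] (f : BC k H A D.C₁) :
    BC.map k A (LinearMap.snd H D.C₀ (LinearMap.ker D.cat.s)) (BC.map k A D.split f) =
      BC.map k A D.prKer f := BC.map_comp_eq (fun _ => rfl) f

/-- The arrow part obtained by whiskering in `map_prKer_br` matches, term by term, the second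
coordinate in `map_snd_pairBr`. The bracket of `T` thus recovers the one of `C`. -/
lemma IsLie2.split_br (hD : D.IsLie2) (f g : D.C₁) :
    BC.map k _ D.split (D.br₁ f g) = D.ker.pairBr (D.split f) (D.split g) := by
  refine BC.prod_ext ?_ ?_
  · refine (map_fst_split _).trans ((hD.s_br f g).trans ?_)
    exact (TwoTermData.map_fst_pairBr (K := D.ker) (D.split f) (D.split g)).symm
  · refine (map_snd_split _).trans ((hD.map_prKer_br f g).trans ?_)
    refine Eq.trans ?_ (TwoTermData.map_snd_pairBr (K := D.ker) (D.split f) (D.split g)).symm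
    rw [tgt_split]
    rfl

lemma IsLie2.split_J (hD : D.IsLie2) (x y z : D.C₀) :
    BC.map k _ D.split (D.J x y z) = D.ker.pairJ x y z := by
  refine BC.prod_ext ?_ ?_
  · refine (map_fst_split _).trans ((hD.s_J x y z).trans ?_)
    exact (TwoTermData.map_fst_pairJ (K := D.ker) x y z).symm
  · refine (map_snd_split _).trans ?_
    exact (TwoTermData.map_snd_pairJ (K := D.ker) x y z).symm

lemma IsLie2.split (hD : D.IsLie2) :
    IsStrict (D := D) (D' := D.ker.pair) LinearMap.id D.split where
  s_F f := rfl
  t_F := tgt_split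
  F_id x := Prod.ext (D.cat.s_i x) (prKer_i x)
  br₀ x y := BC.map_id _
  br₁ := hD.split_br
  J := hD.split_J

lemma IsLie2.glue (hD : D.IsLie2) :
    IsStrict (D := D.ker.pair) (D' := D) LinearMap.id D.glue :=
  hD.split.inverse (fun _ => rfl) (fun _ => rfl) glue_split split_glue

/-- The transformations of the two units are identities, so each composite transformation reduces to
`F₂`: on one side its image under `split`, on the other the pair of its source and its arrow part.
-/
lemma IsHom.unit_naturality {F : HomData D D'} (hD : D.IsLie2) (hD' : D'.IsLie2)
    (hF : IsHom hD.toIsGraph hD'.toIsGraph F) :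
    compHom hF.toIsGraphHom hD'.split.isGraphHom =
      compHom hD.split.isGraphHom (hF.ker hD hD').pair_isGraphHom := by
  refine HomData.ext rfl (LinearMap.ext fun f => Prod.ext (hF.s_F f) (hF.prKer_F₁ hF.F_id f)) ?_
  ext x y
  refine (IntCat.comp_i_left D'.ker.pair.E2 _ _ _).trans ?_
  refine TwoTermData.pair_ext (K := D'.ker) ?_ ?_
  · refine Eq.trans ?_ (IntCat.s_comp' _ _ _ _).symm
    refine (map_fst_split _).trans ((hF.s_F₂ x y).trans ?_)
    exact (TwoTermData.map_fst_pairF₂ hF.toIsGraphHom.ker x y).symm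
  · refine Eq.trans ?_ (TwoTermData.map_snd_comp _ _ _).symm
    refine (map_snd_split _).trans ?_
    refine (add_zero _).symm.trans (congrArg₂ (· + ·)
      (TwoTermData.map_snd_pairF₂ hF.toIsGraphHom.ker x y).symm (Eq.symm ?_))
    refine (TwoTermData.IsHom.map_snd_prodMap hF.toIsGraphHom.ker _).trans ?_
    exact (congrArg _ (BC.map_comp_zero (fun _ => rfl) _)).trans (BC.map_zero _)

end Lie2Data

/-! ### Assembly of the equivalence. -/

section Equivalence

variable (k H)

/-- The isomorphism `D ≅ T (S D)`. -/
def unitIsoApp (D : Lie2.{w, u, v} k H) :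
    D ≅ ((isFunctorS k H).functor ⋙ (isFunctorT k H).functor).obj D where
  hom := ⟨.strict (D' := D.ker.pair) LinearMap.id D.split, D.ax.split.isHom D.ax D.ax.ker.pair⟩
  inv := ⟨.strict (D := D.ker.pair) LinearMap.id D.glue, D.ax.glue.isHom D.ax.ker.pair D.ax⟩
  hom_inv_id := Lie2.Hom.ext'
    (D.ax.split.compHom_eq_id D.ax.glue (fun _ => rfl) Lie2Data.glue_split)
  inv_hom_id := Lie2.Hom.ext'
    (D.ax.glue.compHom_eq_id D.ax.split (fun _ => rfl) Lie2Data.split_glue)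

/-- The isomorphism `S (T K) ≅ K`. -/
def counitIsoApp (K : TwoTerm.{w, u, v} k H) :
    ((isFunctorT k H).functor ⋙ (isFunctorS k H).functor).obj K ≅ K where
  hom := ⟨K.counitHom, K.ax.counitHom⟩
  inv := ⟨K.counitInv, K.ax.counitInv⟩
  hom_inv_id := TwoTerm.Hom.ext' (TwoTermData.HomData.comp_of_zero (K := K.pair.ker)
    (fun _ => rfl) TwoTermData.kerInr_kerSnd)
  inv_hom_id := TwoTerm.Hom.ext' (TwoTermData.HomData.comp_of_zero (K' := K.pair.ker)
    (fun _ => rfl) TwoTermData.kerSnd_kerInr)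

/-- The equivalence given by `S` and `T`. -/
def equivalence : Lie2.{w, u, v} k H ≌ TwoTerm.{w, u, v} k H :=
  -- No triangle identity has to be supplied: the unit is corrected to satisfy it, while both
  -- functors stay as given, so that the equations in the theorem hold by definition.
  .mk (isFunctorS k H).functor (isFunctorT k H).functor
    (NatIso.ofComponents (unitIsoApp k H)
      (fun {D D'} F => Lie2.Hom.ext' (F.isHom.unit_naturality D.ax D'.ax)))
    (NatIso.ofComponents (counitIsoApp k H)
      (fun {K K'} f => TwoTerm.Hom.ext' f.isHom.counit_naturality))

end Equivalence

end HPseudo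

end

/-- The functor `S` from Lie-2 `H`-pseudoalgebras to 2-term `L_∞` `H`-pseudoalgebras and the functor
`T` in the other direction are well defined, and they form an equivalence of categories. -/
theorem theorem6 (k : Type w) [Field k] (H : Type u) [Ring H] [HopfAlgebra k H]
    [Coalgebra.IsCocomm k H] :
    ∃ (hS : HPseudo.IsFunctorS.{w, u, v} k H) (hT : HPseudo.IsFunctorT.{w, u, v} k H)
      (e : CategoryTheory.Equivalence (HPseudo.Lie2.{w, u, v} k H)
        (HPseudo.TwoTerm.{w, u, v} k H)),
      e.functor = hS.functor ∧ e.inverse = hT.functor :=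
  ⟨HPseudo.isFunctorS k H, HPseudo.isFunctorT k H, HPseudo.equivalence k H, rfl, rfl⟩
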